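/- **Model.** A network is a finite simple graph $G=(V,E)$ with $n$ nodes and maximum degree $\Delta$, whose nodes carry pairwise distinct identifiers of at most $c\lceil\log_2 n\rceil$ bits ($c$ a constant) and address their neighbours through arbitrary local port numbers. A deterministic CONGEST algorithm runs in synchronous rounds; initially a node knows $n$, $\Delta$, its degree and its identifier; in each round it may send over each incident edge a message of $O(\log n)$ bits, then receives the messages of its neighbours, and performs arbitrary local computation. For every incident edge it irrevocably commits, at some time, to an output saying whether this edge is in the matching. An edge $e$ completes after $T_e$ rounds, once both its endpoints have committed to its output; a node $v$ completes after $T_v$ rounds, once all its incident edges have completed. The edge-averaged (node-averaged) complexity is the maximum over all such networks of $\frac1{|E|}\sum_{e\in E}T_e$ (of $\frac1{|V|}\sum_{v\in V}T_v$; an average over an empty set is $0$), and the worst-case complexity is the maximum number of rounds until all nodes have completed and no message is sent any more. Let $\log^* n$ be the least number of times $\log_2$ has to be applied, starting from $n$, to reach a value at most $1$. **Theorem.** For every constant $c$ there is a deterministic CONGEST algorithm that computes a maximal matching on every network as above and has edge-averaged complexity $O(\log^2\Delta+\log^* n)$, node-averaged complexity $O(\log^3\Delta+\log^* n)$ and worst-case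 complexity $O(\log^2\Delta\cdot\log n)$. The constants in the $O(\cdot)$ (including that of the message size) depend only on $c$. (For $\Delta=0$ read $\log\Delta$ as $0$, and for $n=0$ read $\log n$ as $0$.) -/

import Mathlib

open scoped ENNReal

/-- The iterated logarithm `log* n`: the least number of times the base-two logarithm has to be
applied, starting from `n`, until the value is at most `1`. -/
noncomputable def logStar (n : ℕ) : ℕ :=
  sInf {k : ℕ | (Real.logb 2)^[k] (n : ℝ) ≤ 1}

/-- A finite simple graph with distinct identifiers, in which every node `v` knows its incident
edges only by local port numbers `0, …, deg v - 1`; the port numbering is arbitrary. -/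
structure Network where
  V : Type
  [fintypeV : Fintype V]
  [decEqV : DecidableEq V]
  graph : SimpleGraph V
  [decAdj : DecidableRel graph.Adj]
  ident : V → ℕ
  ident_injective : Function.Injective ident
  port : ∀ v : V, Fin (graph.degree v) ≃ graph.neighborSet v

attribute [instance] Network.fintypeV Network.decEqV Network.decAdj

/-- The networks with `n` nodes, maximum degree `Δ`, and identifiers of at most
`c * ⌈log₂ n⌉` bits. -/
structure Network.InClass (N : Network) (c n Δ : ℕ) : Prop where
  card_eq : Fintype.card N.V = n
  maxDegree_eq : N.graph.maxDegree = Δ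
  ident_lt : ∀ v, N.ident v < 2 ^ (c * Nat.clog 2 n)

/-- A deterministic synchronous message-passing algorithm whose task is to put a Boolean label on
every edge. `State d` is the set of states of a node of degree `d`; local computation is not
restricted. -/
structure DistAlgorithm where
  State : ℕ → Type
  /-- The initial state, from `n`, `Δ`, the degree of the node and its identifier. -/
  init : (n Δ d ident : ℕ) → State d
  /-- The message sent over each port in the next round (a bit string; `none` is silence). -/
  send : {d : ℕ} → State d → Fin d → Option (List Bool)
  /-- The new state, from the old one and the messages received over the ports. -/
  receive : {d : ℕ} → State d → (Fin d → Option (List Bool)) → State d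
  /-- For each port, the label of the edge there, if the node has committed to one. -/
  output : {d : ℕ} → State d → Fin d → Option Bool

namespace DistAlgorithm

variable (A : DistAlgorithm) (N : Network)

/-- The port of the neighbour at port `p` of `v` which leads back to `v`. -/
def backPort (N : Network) (v : N.V) (p : Fin (N.graph.degree v)) :
    Fin (N.graph.degree (N.port v p : N.V)) :=
  (N.port (N.port v p)).symm ⟨v, (N.port v p).2.symm⟩

/-- The state of each node after `t` rounds. -/
def state : ℕ → (v : N.V) → A.State (N.graph.degree v)
  | 0, v => A.init (Fintype.card N.V) N.graph.maxDegree (N.graph.degree v) (N.ident v)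
  | t + 1, v =>
      A.receive (state t v) fun p => A.send (state t (N.port v p)) (backPort N v p)

/-- The message which `v` sends over port `p` in round `t + 1`. -/
def message (t : ℕ) (v : N.V) (p : Fin (N.graph.degree v)) : Option (List Bool) :=
  A.send (A.state N t v) p

/-- The label of the edge `{v, w}` to which `v` has committed after `t` rounds, if any. -/
def label (t : ℕ) (v w : N.V) (h : N.graph.Adj v w) : Option Bool :=
  A.output (A.state N t v) ((N.port v).symm ⟨w, h⟩)

/-- After `t` rounds, the output of the edge `e` is fixed: both endpoints have committed to it. -/
def EdgeCompleted (t : ℕ) (e : Sym2 N.V) : Prop :=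
  ∀ (v w : N.V) (h : N.graph.Adj v w), e = s(v, w) → (A.label N t v w h).isSome

/-- After `t` rounds, the outputs of all edges incident to `v` are fixed. -/
def NodeCompleted (t : ℕ) (v : N.V) : Prop :=
  ∀ w : N.V, N.graph.Adj v w → A.EdgeCompleted N t s(v, w)

/-- After `t` rounds, all nodes have completed, and no message is ever sent again. -/
def Terminated (t : ℕ) : Prop :=
  (∀ v, A.NodeCompleted N t v) ∧ ∀ t' ≥ t, ∀ v p, A.message N t' v p = none

/-- `T_v`, the number of rounds after which `v` completes (`∞` if it never does). -/
noncomputable def nodeTime (v : N.V) : ℝ≥0∞ :=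
  ⨅ (t : ℕ) (_ : A.NodeCompleted N t v), (t : ℝ≥0∞)

/-- `T_e`, the number of rounds after which `e` completes (`∞` if it never does). -/
noncomputable def edgeTime (e : Sym2 N.V) : ℝ≥0∞ :=
  ⨅ (t : ℕ) (_ : A.EdgeCompleted N t e), (t : ℝ≥0∞)

/-- The number of rounds until all nodes have terminated (`∞` if this never happens). -/
noncomputable def terminationTime : ℝ≥0∞ :=
  ⨅ (t : ℕ) (_ : A.Terminated N t), (t : ℝ≥0∞)

/-- The node-averaged complexity on the class of networks given by `c`, `n` and `Δ`. -/
noncomputable def nodeAvg (c n Δ : ℕ) : ℝ≥0∞ :=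
  ⨆ (N : Network) (_ : N.InClass c n Δ),
    (∑ v : N.V, A.nodeTime N v) / (Fintype.card N.V : ℝ≥0∞)

/-- The edge-averaged complexity on the class of networks given by `c`, `n` and `Δ`
(the average over an empty edge set counts as `0`). -/
noncomputable def edgeAvg (c n Δ : ℕ) : ℝ≥0∞ :=
  ⨆ (N : Network) (_ : N.InClass c n Δ),
    (∑ e ∈ N.graph.edgeFinset, A.edgeTime N e) / (N.graph.edgeFinset.card : ℝ≥0∞)

/-- The worst-case round complexity on the class of networks given by `c`, `n` and `Δ`. -/
noncomputable def worstCase (c n Δ : ℕ) : ℝ≥0∞ :=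
  ⨆ (N : Network) (_ : N.InClass c n Δ), A.terminationTime N

/-- The bandwidth condition of the CONGEST model: for a constant `B`, on all networks with
identifiers of at most `c * ⌈log₂ n⌉` bits, every message has at most `B * ⌈log₂ n⌉` bits. -/
def IsCongest (c : ℕ) : Prop :=
  ∃ B : ℕ, ∀ (n Δ : ℕ) (N : Network), N.InClass c n Δ →
    ∀ t v p m, A.message N t v p = some m → m.length ≤ B * Nat.clog 2 n

/-- On the network `N`, outputs are irrevocable, every edge eventually gets its output, and the
edges labelled `true` (by either endpoint) are those of a maximal matching of the graph. -/
def ComputesMaximalMatching : Prop :=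
  (∀ t v w h b, A.label N t v w h = some b → A.label N (t + 1) v w h = some b) ∧
  (∀ v w h, ∃ t, (A.label N t v w h).isSome) ∧
  ∃ M : N.graph.Subgraph, Maximal (fun M' : N.graph.Subgraph => M'.IsMatching) M ∧
    ∀ t v w h b, A.label N t v w h = some b → (b = true ↔ M.Adj v w)

end DistAlgorithm

/-!
The algorithm works in phases of `O(log² Δ)` rounds. Each phase finds a matching such that a
constant fraction (at least `1 / 256`) of the edges without output lies in the matching or is
adjacent to it; the former get the output `true` and the latter `false`. The number of edges
without output therefore decreases geometrically from phase to phase. Its sum over all phases is at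
most `256 |E|`, hence an average edge takes part in `O(1)` phases. It drops below `|V|` after
`O(log Δ)` phases, so that an average node takes part in `O(log Δ) + O(1)` phases, and it is zero
after `O(log n)` phases. A preprocessing of `log* n + O(1)` rounds, which computes an edge
colouring with `poly(Δ)` colours, is the only other step whose length depends on `n`.

A phase rounds a fractional matching locally. Let `w_e = d_u + d_v` for an edge `e = uv`, where the
degrees count edges without output; this is the number of edges removed with `e` (an edge removed
through both of its ends or `e` itself being counted twice). If every edge `e` were selected with
probability `x_e`, independently, and selected edges adjacent to selected edges were given up, then
the expected weight of the resulting matching would be at least `∑ w_e x_e - ∑ w_e x_e x_f`, the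
second sum being over the ordered pairs of adjacent edges. For `x_e ≈ 1 / (16 w_e)` this potential
is a constant fraction of the number of edges (`degreeInstr_spec`). As a function of each single
`x_e` the potential is linear, so the values can be rounded to `0` or `1` in a greedy way: an edge
which knows the partial derivative, a sum over adjacent edges, moves in the direction in which the
potential increases. If several edges move at the same time, the potential may decrease by the
interactions between them (`greedy_sweep`).

A schedule in which adjacent edges hardly ever move at the same time, but which is much shorter
than a proper edge colouring, is obtained by successive splitting. To split a set of edges into two
such that about one half of the conflicts in it disappears is again a greedy maximisation of a
quadratic function. Its schedule comes from labels which need one round: every node distributes `m`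
residues evenly among its edges, and an edge is labelled by the two residues it gets; it then
shares its label with a fraction `O(1 / m)` of the adjacent edges (`label_even`, `splitProg_spec`).
After `O(log log Δ)` splittings there are `O(log Δ)` classes, and only a fraction `O(1 / log Δ)` of
the conflicts is within a class. With the classes as slots, the edges with values in
`[2 ^ r, 2 ^ (r + 1))` (in units of `2 ^ (-K)`, where `2 ^ K = O(Δ)`) double their values or drop
them to zero, in `O(log Δ)` rounds (`roundProg_spec`). Over the `O(log Δ)` scales `r` this loses a constant
factor only (`scalesProg_spec`). At the end all nonzero values are at least a constant, and after
the removal of edges with too much value around them the remaining graph has constant degree.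
There, a proper edge colouring, obtained by colour reduction from the one of the preprocessing, is
the schedule for a final sweep without any loss (`finishProg_spec`).

All of this is expressed by edge programs: lists of instructions in which the nodes send one
integer over each edge, and the common state of the two copies of an edge is updated from the two
integers. Every integer is polynomial in `n`, which bounds the number of bits of the messages
(`Instr.Sound`).
-/

/-! ### Edge programs and their execution -/

/-- The variables of an edge program at one edge. Both endpoints of the edge hold the same copy. -/
structure EdgeState where
  /-- The label of the edge in the output, once it is fixed. -/
  out : Option Bool
  /-- A colour from a proper colouring of all edges; fixed after the preprocessing. -/
  col : ℕ
  /-- The colour of the edge while a colouring is being computed. -/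
  tcol : ℕ
  /-- The number of unlabelled edges at the two endpoints, the edge itself being counted twice. -/
  w : ℤ
  /-- The value of the edge in the current fractional matching, in multiples of `2 ^ (-K)`. -/
  x : ℤ
  /-- The class of the edge in the current splitting; `0` stands for no class. -/
  cls : ℕ
  /-- An auxiliary label within the class; `0` stands for no label. -/
  lab : ℕ
  /-- The side (`-1` or `1`) chosen by the edge while its class is being split. -/
  z : ℤ

/-- One round of an edge program: every node sends an integer over each of its ports, computed
from its identifier and the states of its incident edges, and the new state of an edge is
a symmetric function of the two integers sent over it. -/
structure Instr where
  /-- The integer sent over a port by a node with a given identifier. -/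
  msg : {d : ℕ} → ℕ → (Fin d → EdgeState) → Fin d → ℤ
  /-- The new state of an edge, from the old one and the two integers sent over it. -/
  upd : EdgeState → ℤ → ℤ → EdgeState
  upd_comm : ∀ s a b, upd s a b = upd s b a

/-- An integer as a bit string: the sign, then the absolute value in binary. -/
def encodeInt (m : ℤ) : List Bool := decide (m < 0) :: m.natAbs.bits

/-- The inverse of `encodeInt`. -/
def decodeInt : List Bool → ℤ
  | [] => 0
  | b :: l => if b then -(l.foldr Nat.bit 0 : ℕ) else (l.foldr Nat.bit 0 : ℕ)

lemma foldr_bit_bits (n : ℕ) : n.bits.foldr Nat.bit 0 = n := by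
  induction n using Nat.binaryRec' with
  | zero => simp
  | bit b n h ih => rw [Nat.bits_append_bit n b h]; simp [ih]

lemma decodeInt_encodeInt (m : ℤ) : decodeInt (encodeInt m) = m := by
  simp only [encodeInt, decodeInt, foldr_bit_bits]
  by_cases h : m < 0
  · simp [h, abs_of_neg h]
  · simp [h, abs_of_nonneg (not_lt.1 h)]

lemma length_encodeInt {m : ℤ} {k : ℕ} (h : |m| < 2 ^ k) : (encodeInt m).length ≤ k + 1 := by
  simp only [encodeInt, List.length_cons, Nat.size_eq_bits_len, add_le_add_iff_right]
  rw [Nat.size_le]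
  zify
  simpa using h

/-- The state of a node which executes an edge program. -/
structure NodeState (d : ℕ) where
  /-- The instructions which are still to be executed. -/
  prog : List Instr
  ident : ℕ
  /-- The states of the incident edges, by port. -/
  edges : Fin d → EdgeState

/-- The distributed algorithm which executes the edge program `P n Δ`, one instruction per round,
from the state `s₀ n Δ` of all edges, and falls silent when the program has ended. -/
def edgeAlgorithm (P : ℕ → ℕ → List Instr) (s₀ : ℕ → ℕ → EdgeState) : DistAlgorithm where
  State := NodeState
  init n Δ _ i := ⟨P n Δ, i, fun _ => s₀ n Δ⟩
  send s p := match s.prog with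
    | [] => none
    | I :: _ => some (encodeInt (I.msg s.ident s.edges p))
  receive s m := match s.prog with
    | [] => s
    | I :: l => ⟨l, s.ident, fun p =>
        I.upd (s.edges p) (I.msg s.ident s.edges p) (decodeInt ((m p).getD []))⟩
  output s p := (s.edges p).out

namespace Network

variable (N : Network)

/-- The edges of the network. -/
abbrev Edge : Type := N.graph.edgeSet

/-- The edge at port `p` of `v`. -/
def edge (v : N.V) (p : Fin (N.graph.degree v)) : N.Edge :=
  ⟨s(v, N.port v p), (N.port v p).2⟩

variable {N}

lemma mem_edge (v : N.V) (p : Fin (N.graph.degree v)) : v ∈ (N.edge v p).1 := by simp [edge]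

lemma edge_injective (v : N.V) : Function.Injective (N.edge v) := by
  intro p q h
  have h' : s(v, (N.port v p : N.V)) = s(v, (N.port v q : N.V)) := congrArg Subtype.val h
  exact (N.port v).injective (Subtype.ext (Sym2.congr_right.1 h'))

lemma exists_edge_eq {v : N.V} {e : N.Edge} (h : v ∈ e.1) : ∃ p, N.edge v p = e := by
  obtain ⟨w, hw⟩ := h
  have ha : N.graph.Adj v w := by
    have := e.2
    rwa [hw] at this
  exact ⟨(N.port v).symm ⟨w, ha⟩, Subtype.ext (by simp [edge, hw])⟩

/-- The port of `v` at which the edge `e` lies. -/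
noncomputable def portOf (v : N.V) (e : N.Edge) (h : v ∈ e.1) : Fin (N.graph.degree v) :=
  (exists_edge_eq h).choose

lemma edge_portOf (v : N.V) (e : N.Edge) (h : v ∈ e.1) : N.edge v (portOf v e h) = e :=
  (exists_edge_eq h).choose_spec

lemma portOf_edge (v : N.V) (p : Fin (N.graph.degree v)) :
    portOf v (N.edge v p) (mem_edge v p) = p :=
  edge_injective v (edge_portOf _ _ _)

lemma sum_edge {M : Type*} [AddCommMonoid M] (v : N.V) (G : N.Edge → M) :
    ∑ p, G (N.edge v p) = ∑ e : N.Edge, if v ∈ e.1 then G e else 0 := by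
  rw [← Finset.sum_filter]
  refine Finset.sum_bij (fun p _ => N.edge v p) (fun p _ => by simp [mem_edge])
    (fun p _ q _ h => edge_injective v h) (fun e he => ?_) (fun _ _ => rfl)
  obtain ⟨p, hp⟩ := exists_edge_eq (v := v) (e := e) (by simpa using he)
  exact ⟨p, by simp, hp⟩

lemma Edge.exists_eq (e : N.Edge) : ∃ v w, e.1 = s(v, w) ∧ v ≠ w := by
  obtain ⟨e, he⟩ := e
  induction e using Sym2.ind with
  | _ v w => exact ⟨v, w, rfl, SimpleGraph.Adj.ne he⟩

lemma Edge.ne_of_eq {e : N.Edge} {v w : N.V} (h : e.1 = s(v, w)) : v ≠ w := by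
  have := e.2
  rw [h] at this
  exact SimpleGraph.Adj.ne this

lemma sum_mem {M : Type*} [AddCommMonoid M] {e : N.Edge} {v w : N.V} (h : e.1 = s(v, w))
    (G : N.V → M) : (∑ u, if u ∈ e.1 then G u else 0) = G v + G w := by
  have hne := Edge.ne_of_eq h
  rw [← Finset.sum_filter, show Finset.univ.filter (fun u => u ∈ e.1) = {v, w} by
    ext u; simp [h], Finset.sum_pair hne]

/-- The number of nodes which two different edges share; `0` for an edge and itself. -/
def meet (e f : N.Edge) : ℤ :=
  if e = f then 0 else ∑ v : N.V, if v ∈ e.1 ∧ v ∈ f.1 then 1 else 0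

lemma meet_comm (e f : N.Edge) : meet e f = meet f e := by
  unfold meet
  simp only [eq_comm (a := e), and_comm]

lemma meet_nonneg (e f : N.Edge) : 0 ≤ meet e f := by
  unfold meet
  split_ifs
  · rfl
  · exact Finset.sum_nonneg fun _ _ => by split_ifs <;> simp

lemma meet_pos {e f : N.Edge} {v : N.V} (hne : e ≠ f) (he : v ∈ e.1) (hf : v ∈ f.1) :
    1 ≤ meet e f := by
  unfold meet
  rw [if_neg hne]
  refine le_trans ?_ (Finset.single_le_sum (a := v)
    (fun _ _ => by split_ifs <;> simp) (Finset.mem_univ v))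
  simp [he, hf]

lemma exists_of_meet_ne_zero {e f : N.Edge} (h : meet e f ≠ 0) :
    e ≠ f ∧ ∃ v, v ∈ e.1 ∧ v ∈ f.1 := by
  unfold meet at h
  split_ifs at h with h1
  · exact absurd rfl h
  refine ⟨h1, ?_⟩
  by_contra! h2
  exact h (Finset.sum_eq_zero fun v _ => by simpa using h2 v)

lemma sum_meet (e : N.Edge) (G : N.Edge → ℤ) :
    ∑ f, meet e f * G f =
      ∑ v : N.V, if v ∈ e.1 then (∑ f : N.Edge, if v ∈ f.1 then if f = e then 0 else G f else 0)
        else 0 := by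
  have : ∀ f, meet e f * G f =
      ∑ v : N.V, if v ∈ e.1 then (if v ∈ f.1 then if f = e then 0 else G f else 0) else 0 := by
    intro f
    unfold meet
    by_cases h : e = f
    · simp [h]
    · simp only [h, if_false, Finset.sum_mul, Ne.symm h, ite_mul, one_mul, zero_mul, ite_and]
  rw [Finset.sum_congr rfl fun f _ => this f, Finset.sum_comm]
  refine Finset.sum_congr rfl fun v _ => ?_
  split_ifs <;> simp

end Network

namespace Instr

variable {N : Network}

/-- The integer which `v` sends over its edge `e`, when the edges have the states `τ`. -/
noncomputable def sent (I : Instr) (τ : N.Edge → EdgeState) (v : N.V) (e : N.Edge) : ℤ :=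
  if h : v ∈ e.1 then I.msg (N.ident v) (fun p => τ (N.edge v p)) (Network.portOf v e h) else 0

/-- The states of all edges after one round. -/
noncomputable def step (I : Instr) (τ : N.Edge → EdgeState) (e : N.Edge) : EdgeState :=
  I.upd (τ e) (I.sent τ e.1.out.1 e) (I.sent τ e.1.out.2 e)

lemma step_eq (I : Instr) (τ : N.Edge → EdgeState) {e : N.Edge} {v w : N.V}
    (h : e.1 = s(v, w)) : I.step τ e = I.upd (τ e) (I.sent τ v e) (I.sent τ w e) := by
  have h1 : s(e.1.out.1, e.1.out.2) = s(v, w) := by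
    rw [← h]
    exact Quot.out_eq e.1
  unfold step
  rcases Sym2.eq_iff.1 h1 with ⟨h2, h3⟩ | ⟨h2, h3⟩
  · rw [h2, h3]
  · rw [h2, h3, I.upd_comm]

lemma sent_edge (I : Instr) (τ : N.Edge → EdgeState) (v : N.V) (p : Fin (N.graph.degree v)) :
    I.sent τ v (N.edge v p) = I.msg (N.ident v) (fun p => τ (N.edge v p)) p := by
  unfold sent
  rw [dif_pos (Network.mem_edge v p), Network.portOf_edge]

end Instr

/-- The states of all edges after the execution of a program. -/
noncomputable def run (N : Network) (P : List Instr) (τ : N.Edge → EdgeState) :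
    N.Edge → EdgeState :=
  P.foldl (fun τ I => I.step τ) τ

section run
variable {N : Network}

@[simp] lemma run_nil (τ : N.Edge → EdgeState) : run N [] τ = τ := rfl

@[simp] lemma run_cons (I : Instr) (P : List Instr) (τ : N.Edge → EdgeState) :
    run N (I :: P) τ = run N P (I.step τ) := rfl

lemma run_append (P Q : List Instr) (τ : N.Edge → EdgeState) :
    run N (P ++ Q) τ = run N Q (run N P τ) := by
  simp [run, List.foldl_append]

lemma run_singleton (I : Instr) (τ : N.Edge → EdgeState) : run N [I] τ = I.step τ := rfl

end run

namespace edgeAlgorithm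

variable (P : ℕ → ℕ → List Instr) (s₀ : ℕ → ℕ → EdgeState) (N : Network)

/-- The program executed on the network `N`. -/
abbrev progOn : List Instr := P (Fintype.card N.V) N.graph.maxDegree

/-- The states of the edges of `N` after `t` rounds. -/
noncomputable def at_ (t : ℕ) : N.Edge → EdgeState :=
  run N ((progOn P N).take t) fun _ => s₀ (Fintype.card N.V) N.graph.maxDegree

lemma edge_backPort (v : N.V) (p : Fin (N.graph.degree v)) :
    N.edge (N.port v p) (DistAlgorithm.backPort N v p) = N.edge v p := by
  apply Subtype.ext
  simp [Network.edge, DistAlgorithm.backPort]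

lemma at_succ {t : ℕ} {I : Instr} (h : (progOn P N)[t]? = some I) :
    at_ P s₀ N (t + 1) = I.step (at_ P s₀ N t) := by
  unfold at_
  rw [List.take_add_one, h, run_append]
  rfl

lemma at_succ_of_le {t : ℕ} (h : (progOn P N).length ≤ t) :
    at_ P s₀ N (t + 1) = at_ P s₀ N t := by
  unfold at_
  rw [List.take_of_length_le h, List.take_of_length_le (by omega)]

/-- The two copies of the state of an edge always agree: the states of the nodes are determined
by those of the edges. -/
theorem state_eq (t : ℕ) (v : N.V) :
    (edgeAlgorithm P s₀).state N t v =
      ⟨(progOn P N).drop t, N.ident v, fun p => at_ P s₀ N t (N.edge v p)⟩ := by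
  induction t generalizing v with
  | zero => rfl
  | succ t ih =>
    rw [DistAlgorithm.state]
    simp only [ih]
    rcases h : (progOn P N)[t]? with _ | I
    · have hl : (progOn P N).length ≤ t := List.getElem?_eq_none_iff.1 h
      rw [at_succ_of_le P s₀ N hl]
      rw [List.drop_of_length_le hl, List.drop_of_length_le (by omega)]
      rfl
    · have hd : (progOn P N).drop t = I :: (progOn P N).drop (t + 1) := by
        obtain ⟨hlt, hI⟩ := List.getElem?_eq_some_iff.1 h
        rw [List.drop_eq_getElem_cons hlt, hI]
      rw [at_succ P s₀ N h, hd]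
      show NodeState.mk _ _ _ = _
      congr 1
      funext p
      have h1 : (N.edge v p).1 = s(v, (N.port v p : N.V)) := rfl
      rw [I.step_eq _ h1, I.sent_edge]
      congr 1
      show decodeInt (encodeInt _) = _
      rw [decodeInt_encodeInt, ← I.sent_edge, edge_backPort]

theorem message_eq (t : ℕ) (v : N.V) (p : Fin (N.graph.degree v)) :
    (edgeAlgorithm P s₀).message N t v p =
      (progOn P N)[t]?.map fun I => encodeInt (I.sent (at_ P s₀ N t) v (N.edge v p)) := by
  unfold DistAlgorithm.message
  rw [state_eq]
  rcases h : (progOn P N)[t]? with _ | I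
  · have hl : (progOn P N).length ≤ t := List.getElem?_eq_none_iff.1 h
    rw [List.drop_of_length_le hl]
    rfl
  · have hd : (progOn P N).drop t = I :: (progOn P N).drop (t + 1) := by
      obtain ⟨hlt, hI⟩ := List.getElem?_eq_some_iff.1 h
      rw [List.drop_eq_getElem_cons hlt, hI]
    rw [hd, Option.map_some, I.sent_edge]
    rfl

theorem label_eq (t : ℕ) (v w : N.V) (h : N.graph.Adj v w) :
    (edgeAlgorithm P s₀).label N t v w h = (at_ P s₀ N t ⟨s(v, w), h⟩).out := by
  unfold DistAlgorithm.label
  rw [state_eq]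
  show (at_ P s₀ N t (N.edge v _)).out = _
  congr 2
  apply Subtype.ext
  simp [Network.edge]

theorem edgeCompleted_iff (t : ℕ) (e : N.Edge) :
    (edgeAlgorithm P s₀).EdgeCompleted N t e.1 ↔ (at_ P s₀ N t e).out.isSome := by
  unfold DistAlgorithm.EdgeCompleted
  constructor
  · intro h
    obtain ⟨v, w, hvw, -⟩ := e.exists_eq
    have ha : N.graph.Adj v w := by
      have := e.2
      rwa [hvw] at this
    have := h v w ha hvw
    rw [label_eq] at this
    rwa [show e = ⟨s(v, w), ha⟩ from Subtype.ext hvw]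
  · intro h v w ha hvw
    rw [label_eq]
    rwa [show (⟨s(v, w), ha⟩ : N.Edge) = e from Subtype.ext hvw.symm]

end edgeAlgorithm

/-! ### The instructions -/

/-- A code of the unordered pair of two natural numbers (given as integers). -/
def symPair (a b : ℤ) : ℕ := Nat.pair (max a.toNat b.toNat) (min a.toNat b.toNat)

lemma symPair_comm (a b : ℤ) : symPair a b = symPair b a := by
  unfold symPair
  rw [max_comm, min_comm]

lemma symPair_lt {a b : ℤ} {m : ℕ} (hm : 0 < m) (ha : a < m) (hb : b < m) :
    symPair a b < m ^ 2 := by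
  unfold symPair
  refine (Nat.pair_lt_max_add_one_sq _ _).trans_le (Nat.pow_le_pow_left ?_ 2)
  omega

lemma symPair_eq {a b c d : ℤ} (ha : 0 ≤ a) (hb : 0 ≤ b) (hc : 0 ≤ c) (hd : 0 ≤ d)
    (h : symPair a b = symPair c d) : (a = c ∧ b = d) ∨ (a = d ∧ b = c) := by
  obtain ⟨h1, h2⟩ := Nat.pair_eq_pair.1 h
  omega

namespace Instr

/-- Every node tells each of its edges `e` the sum of `g e f` over its other edges `f`; an edge
computes its new state from its old one and the sum of the two numbers it has been told. -/
def gather (g : EdgeState → EdgeState → ℤ) (f : EdgeState → ℤ → EdgeState) : Instr where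
  msg _ σ p := ∑ q, if q = p then 0 else g (σ p) (σ q)
  upd s a b := f s (a + b)
  upd_comm s a b := by rw [add_comm]

/-- A round without communication. -/
def silent (f : EdgeState → EdgeState) : Instr := gather (fun _ _ => 0) fun s _ => f s

/-- Every node numbers its edges in every class, and reduces these numbers modulo `m`. The label
of an edge encodes the two residues which it gets from its endpoints; edges without a class get
no label. The sides are reset. -/
def label (m : ℕ) : Instr where
  msg _ σ p := ((Finset.univ.filter fun q => q < p ∧ (σ q).cls = (σ p).cls).card % m : ℕ)
  upd s a b := { s with lab := if s.cls = 0 then 0 else 1 + symPair a b, z := 0 }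
  upd_comm s a b := by rw [symPair_comm]

/-- The temporary colour of an edge becomes a code of the identifiers of its endpoints. -/
def ids : Instr where
  msg i _ _ := i
  upd s a b := { s with tcol := symPair a b }
  upd_comm s a b := by rw [symPair_comm]

end Instr

/-- The lowest binary digit in which two numbers differ (`0` if they are equal). -/
noncomputable def diffBit (a b : ℕ) : ℕ := sInf {i | a.testBit i ≠ b.testBit i}

lemma testBit_diffBit {a b : ℕ} (h : a ≠ b) :
    a.testBit (diffBit a b) ≠ b.testBit (diffBit a b) := by
  have : {i | a.testBit i ≠ b.testBit i}.Nonempty := by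
    by_contra hn
    rw [Set.not_nonempty_iff_eq_empty] at hn
    refine h (Nat.eq_of_testBit_eq fun i => ?_)
    by_contra hi
    exact (Set.eq_empty_iff_forall_notMem.1 hn i) hi
  exact Nat.sInf_mem this

lemma diffBit_lt {a b k : ℕ} (hk : 0 < k) (ha : a < 2 ^ k) (hb : b < 2 ^ k) :
    diffBit a b < k := by
  by_cases h : a = b
  · simpa [diffBit, h] using hk
  · by_contra! hle
    apply testBit_diffBit h
    have h2 : 2 ^ k ≤ 2 ^ diffBit a b := Nat.pow_le_pow_right (by norm_num) hle
    rw [Nat.testBit_lt_two_pow (ha.trans_le h2), Nat.testBit_lt_two_pow (hb.trans_le h2)]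

/-- A code of the statement that the binary digit number `k` of `a` has the value it has, where
`k` is the lowest digit in which `a` differs from `b`; codes are positive. -/
noncomputable def digitFact (a b : ℕ) : ℕ :=
  1 + 2 * diffBit a b + (a.testBit (diffBit a b)).toNat

lemma digitFact_le {a b k : ℕ} (hk : 0 < k) (ha : a < 2 ^ k) (hb : b < 2 ^ k) :
    digitFact a b ≤ 2 * k := by
  have := diffBit_lt hk ha hb
  have := Bool.toNat_le (a.testBit (diffBit a b))
  unfold digitFact
  omega

/-- One step of colour reduction in the style of Cole and Vishkin: every node tells each of its
edges a binary digit in which its colour differs from that of another edge with the same label,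
and the new colour of an edge encodes the two facts it has been told. -/
noncomputable def Instr.reduce : Instr where
  msg _ σ p := (Finset.univ.sup fun q =>
    if q ≠ p ∧ (σ q).lab = (σ p).lab ∧ (σ p).lab ≠ 0 then
      digitFact (σ p).tcol (σ q).tcol else 0 : ℕ)
  upd s a b := { s with tcol := symPair a b }
  upd_comm s a b := by rw [symPair_comm]

namespace Instr

variable {N : Network} (τ : N.Edge → EdgeState)

open Network

lemma step_gather (g : EdgeState → EdgeState → ℤ) (f : EdgeState → ℤ → EdgeState)
    (e : N.Edge) : (gather g f).step τ e = f (τ e) (∑ e', meet e e' * g (τ e) (τ e')) := by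
  have hs : ∀ v, v ∈ e.1 → (gather g f).sent τ v e =
      ∑ f : N.Edge, if v ∈ f.1 then if f = e then 0 else g (τ e) (τ f) else 0 := by
    intro v hv
    obtain ⟨p, rfl⟩ := exists_edge_eq hv
    rw [sent_edge, ← sum_edge]
    simp only [gather, (edge_injective v).eq_iff]
  obtain ⟨v, w, h, -⟩ := e.exists_eq
  rw [step_eq _ _ h, sum_meet, sum_mem h, hs v (by simp [h]), hs w (by simp [h])]
  rfl

@[simp] lemma step_silent (f : EdgeState → EdgeState) (e : N.Edge) :
    (silent f).step τ e = f (τ e) := by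
  rw [silent, step_gather]

lemma step_ids {e : N.Edge} {v w : N.V} (h : e.1 = s(v, w)) :
    ids.step τ e = { τ e with tcol := symPair (N.ident v) (N.ident w) } := by
  rw [step_eq _ _ h]
  simp [ids, sent, h]

lemma card_rank_mod_le {d : ℕ} (S : Finset (Fin d)) (m i : ℕ) :
    (S.filter fun p => (S.filter fun q => q < p).card % m = i).card ≤ (S.card - 1) / m + 1 := by
  have key : (S.filter fun p => (S.filter fun q => q < p).card % m = i).card ≤
      (Finset.range ((S.card - 1) / m + 1)).card := by
    refine Finset.card_le_card_of_injOn (fun p => (S.filter fun q => q < p).card / m) ?_ ?_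
    · intro p hp
      have hp' : p ∈ S := (Finset.mem_filter.1 hp).1
      have hlt : (S.filter fun q => q < p).card < S.card :=
        Finset.card_lt_card (Finset.filter_ssubset.2 ⟨p, hp', by simp⟩)
      simp only [Finset.coe_range, Set.mem_Iio, Nat.lt_succ_iff]
      exact Nat.div_le_div_right (by omega)
    · intro p hp q hq hpq
      have hp' := Finset.mem_filter.1 hp
      have hq' := Finset.mem_filter.1 hq
      have hcard : (S.filter fun q => q < p).card = (S.filter fun p => p < q).card := by
        rw [← Nat.div_add_mod (S.filter fun q => q < p).card m, hp'.2]
        rw [← Nat.div_add_mod (S.filter fun p => p < q).card m, hq'.2]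
        simp only at hpq
        rw [hpq]
      have hmono : ∀ a b : Fin d, a ∈ S → a < b →
          (S.filter fun q => q < a).card < (S.filter fun q => q < b).card := by
        intro a b ha hab
        refine Finset.card_lt_card ((Finset.ssubset_iff_of_subset ?_).2 ⟨a, by simp [ha, hab]⟩)
        intro c
        simp only [Finset.mem_filter]
        exact fun h => ⟨h.1, h.2.trans hab⟩
      rcases lt_trichotomy p q with h | h | h
      · exact absurd hcard (hmono p q hp'.1 h).ne
      · exact h
      · exact absurd hcard (hmono q p hq'.1 h).ne'
  simpa using key

lemma card_edge_filter (v : N.V) (Q : N.Edge → Prop) [DecidablePred Q] :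
    (Finset.univ.filter fun e : N.Edge => v ∈ e.1 ∧ Q e).card =
      (Finset.univ.filter fun p => Q (N.edge v p)).card := by
  have := sum_edge v (fun e => if Q e then 1 else 0)
  simp only [← ite_and, Finset.sum_boole, Nat.cast_id] at this
  exact this.symm

/-- The labels come from residues which every node distributes evenly among its edges in each
class. -/
lemma step_label {m : ℕ} (hm : 0 < m) : ∃ r : N.V → N.Edge → ℕ,
    (∀ v e, r v e < m) ∧
    (∀ v k i, (Finset.univ.filter fun e : N.Edge => v ∈ e.1 ∧ (τ e).cls = k ∧ r v e = i).card ≤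
      ((Finset.univ.filter fun e : N.Edge => v ∈ e.1 ∧ (τ e).cls = k).card - 1) / m + 1) ∧
    ∀ (e : N.Edge) (v w : N.V), e.1 = s(v, w) → (label m).step τ e =
      { τ e with
        lab := if (τ e).cls = 0 then 0 else 1 + symPair (r v e) (r w e)
        z := 0 } := by
  have hs : ∀ v p, (label m).sent τ v (N.edge v p) = ((Finset.univ.filter fun q =>
      q < p ∧ (τ (N.edge v q)).cls = (τ (N.edge v p)).cls).card % m : ℕ) := by
    intro v p
    rw [sent_edge]
    rfl
  have h0 : ∀ v e, 0 ≤ (label m).sent τ v e := by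
    intro v e
    by_cases h : v ∈ e.1
    · obtain ⟨p, rfl⟩ := exists_edge_eq h
      rw [hs]
      positivity
    · simp [sent, h]
  refine ⟨fun v e => ((label m).sent τ v e).toNat, ?_, ?_, ?_⟩
  · intro v e
    by_cases h : v ∈ e.1
    · obtain ⟨p, rfl⟩ := exists_edge_eq h
      simp only [hs, Int.toNat_natCast]
      exact Nat.mod_lt _ hm
    · simpa [sent, h] using hm
  · intro v k i
    rw [card_edge_filter v fun e => (τ e).cls = k ∧ ((label m).sent τ v e).toNat = i,
      card_edge_filter v fun e => (τ e).cls = k]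
    refine le_trans (le_of_eq ?_) (card_rank_mod_le
      (Finset.univ.filter fun p => (τ (N.edge v p)).cls = k) m i)
    congr 1
    ext p
    simp only [Finset.mem_filter, Finset.mem_univ, true_and, hs, Int.toNat_natCast]
    refine and_congr_right fun hp => ?_
    rw [hp, Finset.filter_filter]
    simp only [and_comm]
  · intro e v w h
    rw [step_eq _ _ h]
    simp only [Int.toNat_of_nonneg (h0 _ _)]
    rfl

/-- No three edges at a node have the same label. -/
def SparseLabels (τ : N.Edge → EdgeState) : Prop :=
  ∀ v (e f g : N.Edge), v ∈ e.1 → v ∈ f.1 → v ∈ g.1 → e ≠ f → e ≠ g → f ≠ g →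
    (τ e).lab = (τ f).lab → (τ e).lab = (τ g).lab → (τ e).lab = 0

/-- Edges which share a node and have the same label have different temporary colours. -/
def ProperWithinLabels (τ : N.Edge → EdgeState) : Prop :=
  ∀ v (e f : N.Edge), v ∈ e.1 → v ∈ f.1 → e ≠ f → (τ e).lab = (τ f).lab → (τ e).lab ≠ 0 →
    (τ e).tcol ≠ (τ f).tcol

lemma step_reduce_eq (e : N.Edge) :
    reduce.step τ e = { τ e with tcol := (reduce.step τ e).tcol } := rfl

lemma sent_reduce (v : N.V) (p : Fin (N.graph.degree v)) :
    reduce.sent τ v (N.edge v p) = (Finset.univ.sup fun q =>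
      if q ≠ p ∧ (τ (N.edge v q)).lab = (τ (N.edge v p)).lab ∧ (τ (N.edge v p)).lab ≠ 0 then
        digitFact (τ (N.edge v p)).tcol (τ (N.edge v q)).tcol else 0 : ℕ) := by
  rw [sent_edge]
  rfl

lemma sent_reduce_eq_zero_or (v : N.V) (e : N.Edge) : reduce.sent τ v e = 0 ∨
    ∃ f : N.Edge, reduce.sent τ v e = digitFact (τ e).tcol (τ f).tcol := by
  by_cases h : v ∈ e.1
  · obtain ⟨p, rfl⟩ := exists_edge_eq h
    rw [sent_reduce]
    obtain ⟨q, -, hq⟩ := Finset.exists_mem_eq_sup Finset.univ ⟨p, Finset.mem_univ p⟩ (fun q =>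
      if q ≠ p ∧ (τ (N.edge v q)).lab = (τ (N.edge v p)).lab ∧ (τ (N.edge v p)).lab ≠ 0 then
        digitFact (τ (N.edge v p)).tcol (τ (N.edge v q)).tcol else 0)
    rw [hq]
    split_ifs
    · exact Or.inr ⟨_, rfl⟩
    · exact Or.inl rfl
  · exact Or.inl (by simp [sent, h])

lemma sent_reduce_of_mate (hs : SparseLabels τ) {v : N.V} {e f : N.Edge} (he : v ∈ e.1)
    (hf : v ∈ f.1) (hne : e ≠ f) (hlab : (τ e).lab = (τ f).lab) (h0 : (τ e).lab ≠ 0) :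
    reduce.sent τ v e = digitFact (τ e).tcol (τ f).tcol := by
  obtain ⟨p, rfl⟩ := exists_edge_eq he
  obtain ⟨q, rfl⟩ := exists_edge_eq hf
  rw [sent_reduce, Nat.cast_inj]
  have hqp : q ≠ p := fun h => hne (by rw [h])
  refine le_antisymm (Finset.sup_le fun q' _ => ?_) ?_
  · by_cases hq' : q' = q
    · subst hq'
      split_ifs <;> simp
    · split_ifs with h
      · refine absurd (hs v _ _ _ he hf (mem_edge v q') hne ?_ ?_ hlab h.2.1.symm) h0
        · exact fun h2 => h.1 (edge_injective v h2.symm)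
        · exact fun h2 => hq' (edge_injective v h2.symm)
      · simp
  · refine le_trans ?_ (Finset.le_sup (Finset.mem_univ q))
    rw [if_pos ⟨hqp, hlab.symm, h0⟩]

lemma sent_reduce_nonneg (v : N.V) (e : N.Edge) : 0 ≤ reduce.sent τ v e := by
  rcases sent_reduce_eq_zero_or τ v e with h | ⟨f, h⟩ <;> rw [h]
  positivity

/-- A colour reduction step keeps the colouring proper: if two edges got the same pair of facts,
the digit in which their colours differ would have the same value in both. -/
lemma step_reduce_proper (hs : SparseLabels τ) (hp : ProperWithinLabels τ) :
    ProperWithinLabels (reduce.step τ) := by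
  intro v e f he hf hne hlab h0 hcol
  rw [step_reduce_eq, step_reduce_eq τ f] at hlab
  rw [step_reduce_eq] at h0
  simp only at hlab h0
  have hd := testBit_diffBit (hp v e f he hf hne hlab h0)
  have h1 := sent_reduce_of_mate τ hs he hf hne hlab h0
  have h2 := sent_reduce_of_mate τ hs hf he hne.symm hlab.symm (hlab ▸ h0)
  have hfact : ∀ {a b c d : ℕ}, (digitFact a b : ℤ) = digitFact c d →
      diffBit a b = diffBit c d ∧ a.testBit (diffBit a b) = c.testBit (diffBit a b) := by
    intro a b c d h
    have h' : digitFact a b = digitFact c d := by exact_mod_cast h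
    unfold digitFact at h'
    have l1 := Bool.toNat_le (a.testBit (diffBit a b))
    have l2 := Bool.toNat_le (c.testBit (diffBit c d))
    have l3 : diffBit a b = diffBit c d := by omega
    refine ⟨l3, ?_⟩
    have l4 : (a.testBit (diffBit c d)).toNat = (c.testBit (diffBit c d)).toNat := by
      rw [l3] at h'
      omega
    rw [l3]
    cases h5 : a.testBit (diffBit c d) <;> cases h6 : c.testBit (diffBit c d) <;> simp_all
  obtain ⟨u, hu⟩ := he
  obtain ⟨u', hu'⟩ := hf
  rw [step_eq _ _ hu, step_eq _ _ hu'] at hcol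
  rcases symPair_eq (sent_reduce_nonneg ..) (sent_reduce_nonneg ..) (sent_reduce_nonneg ..)
    (sent_reduce_nonneg ..) hcol with ⟨h3, -⟩ | ⟨h3, -⟩
  · rw [h1, h2] at h3
    exact hd (hfact h3).2
  · rcases sent_reduce_eq_zero_or τ u' f with h4 | ⟨g, h4⟩
    · rw [h1, h4] at h3
      unfold digitFact at h3
      omega
    · rw [h1, h4] at h3
      exact hd (hfact h3).2

lemma step_reduce_lt {k : ℕ} (hk : 0 < k) (h : ∀ e, (τ e).tcol < 2 ^ k) (e : N.Edge) :
    (reduce.step τ e).tcol < (2 * k + 1) ^ 2 := by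
  obtain ⟨v, w, hvw, -⟩ := e.exists_eq
  rw [step_eq _ _ hvw]
  have hb : ∀ u, reduce.sent τ u e < (2 * k + 1 : ℕ) := by
    intro u
    rcases sent_reduce_eq_zero_or τ u e with h1 | ⟨f, h1⟩ <;> rw [h1]
    · positivity
    · have := digitFact_le hk (h e) (h f)
      exact_mod_cast Nat.lt_succ_of_le this
  exact symPair_lt (by omega) (hb v) (hb w)

end Instr

/-! ### Even labels -/

namespace Instr

variable {N : Network} (τ : N.Edge → EdgeState)

open Network

lemma lab_step_label {m : ℕ} (e : N.Edge) :
    ((label m).step τ e).lab = 0 ↔ (τ e).cls = 0 := by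
  obtain ⟨v, w, h, -⟩ := e.exists_eq
  rw [step_eq _ _ h]
  simp only [label]
  split_ifs with h <;> simp [h]

lemma lab_step_label_le {m : ℕ} (hm : 0 < m) (e : N.Edge) :
    ((label m).step τ e).lab ≤ m ^ 2 := by
  obtain ⟨r, hr, -, hlab⟩ := step_label τ hm
  obtain ⟨v, w, h, -⟩ := e.exists_eq
  rw [hlab e v w h]
  simp only
  split_ifs
  · simp
  · have := symPair_lt (a := r v e) (b := r w e) hm (by exact_mod_cast hr v e)
      (by exact_mod_cast hr w e)
    omega

lemma label_residues {m : ℕ} {r : N.V → N.Edge → ℕ}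
    (hlab : ∀ (e : N.Edge) (v w : N.V), e.1 = s(v, w) → (label m).step τ e =
      { τ e with
        lab := if (τ e).cls = 0 then 0 else 1 + symPair (r v e) (r w e)
        z := 0 }) {v w : N.V} {e f : N.Edge} (he : e.1 = s(v, w)) (hf : v ∈ f.1)
    (h0 : ((label m).step τ e).lab ≠ 0)
    (h : ((label m).step τ f).lab = ((label m).step τ e).lab) : r v f = r v e ∨ r v f = r w e := by
  obtain ⟨w', hw'⟩ := hf
  have h0' : (τ e).cls ≠ 0 := fun hc => h0 ((lab_step_label τ e).2 hc)
  have h1' : (τ f).cls ≠ 0 := fun hc => h0 (h ▸ (lab_step_label τ f).2 hc)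
  rw [hlab e v w he, hlab f v w' hw'] at h
  simp only [h0', h1', if_false, add_right_inj] at h
  rcases symPair_eq (by positivity) (by positivity) (by positivity) (by positivity) h
    with ⟨h2, -⟩ | ⟨h2, -⟩
  · exact Or.inl (by exact_mod_cast h2)
  · exact Or.inr (by exact_mod_cast h2)

/-- An edge shares its label with few of the adjacent edges of its class. -/
lemma label_even {m : ℕ} (hm : 0 < m) (e : N.Edge) (he : (τ e).cls ≠ 0) :
    m * ∑ f, meet e f * (if (τ f).cls = (τ e).cls ∧
      ((label m).step τ f).lab = ((label m).step τ e).lab then 1 else 0) ≤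
    2 * (∑ f, meet e f * if (τ f).cls = (τ e).cls then 1 else 0) + 4 * m := by
  obtain ⟨r, -, hcard, hlab⟩ := step_label τ hm
  obtain ⟨v, w, h, -⟩ := e.exists_eq
  have h0 : ((label m).step τ e).lab ≠ 0 := fun hc => he ((lab_step_label τ e).1 hc)
  have key : ∀ v w, e.1 = s(v, w) →
      m * (∑ f : N.Edge, if v ∈ f.1 then if f = e then 0 else
        (if (τ f).cls = (τ e).cls ∧ ((label m).step τ f).lab = ((label m).step τ e).lab
          then 1 else 0) else 0) ≤
      2 * (∑ f : N.Edge, if v ∈ f.1 then if f = e then 0 else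
        (if (τ f).cls = (τ e).cls then (1 : ℤ) else 0) else 0) + 2 * m := by
    intro v w h
    have hv : v ∈ e.1 := by simp [h]
    set n := (Finset.univ.filter fun f : N.Edge => v ∈ f.1 ∧ (τ f).cls = (τ e).cls).card with hn
    have h1 : (∑ f : N.Edge, if v ∈ f.1 then if f = e then 0 else
        (if (τ f).cls = (τ e).cls then (1 : ℤ) else 0) else 0) = n - 1 := by
      have : ∀ f : N.Edge, (if v ∈ f.1 then if f = e then 0 else
        (if (τ f).cls = (τ e).cls then (1 : ℤ) else 0) else 0) =
        (if v ∈ f.1 ∧ (τ f).cls = (τ e).cls then 1 else 0) - if f = e then 1 else 0 := by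
        intro f
        by_cases hfe : f = e
        · subst hfe
          simp [hv]
        · simp [hfe, ite_and]
      rw [Finset.sum_congr rfl fun f _ => this f, Finset.sum_sub_distrib, Finset.sum_boole]
      simp [hn]
    have h2 : (∑ f : N.Edge, if v ∈ f.1 then if f = e then 0 else
        (if (τ f).cls = (τ e).cls ∧ ((label m).step τ f).lab = ((label m).step τ e).lab
          then (1 : ℤ) else 0) else 0) ≤ 2 * (((n - 1) / m : ℕ) + 1) := by
      have : ∀ f : N.Edge, (if v ∈ f.1 then if f = e then 0 else
        (if (τ f).cls = (τ e).cls ∧ ((label m).step τ f).lab = ((label m).step τ e).lab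
          then (1 : ℤ) else 0) else 0) ≤
        (if v ∈ f.1 ∧ (τ f).cls = (τ e).cls ∧ r v f = r v e then 1 else 0) +
        (if v ∈ f.1 ∧ (τ f).cls = (τ e).cls ∧ r v f = r w e then 1 else 0) := by
        intro f
        by_cases hc : v ∈ f.1 ∧ f ≠ e ∧ (τ f).cls = (τ e).cls ∧
            ((label m).step τ f).lab = ((label m).step τ e).lab
        · obtain ⟨c1, c2, c3, c4⟩ := hc
          rw [if_pos c1, if_neg c2, if_pos ⟨c3, c4⟩]
          rcases label_residues τ hlab h c1 h0 c4 with h5 | h5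
          · rw [if_pos ⟨c1, c3, h5⟩]
            split_ifs <;> simp
          · rw [add_comm, if_pos ⟨c1, c3, h5⟩]
            split_ifs <;> simp
        · have : (if v ∈ f.1 then if f = e then 0 else
            (if (τ f).cls = (τ e).cls ∧ ((label m).step τ f).lab = ((label m).step τ e).lab
              then (1 : ℤ) else 0) else 0) = 0 := by
            split_ifs <;> tauto
          rw [this]
          split_ifs <;> simp
      refine (Finset.sum_le_sum fun f _ => this f).trans ?_
      rw [Finset.sum_add_distrib, Finset.sum_boole, Finset.sum_boole]
      have c1 := hcard v (τ e).cls (r v e)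
      have c2 := hcard v (τ e).cls (r w e)
      rw [← hn] at c1 c2
      have c3 := add_le_add c1 c2
      rw [← two_mul] at c3
      exact_mod_cast c3
    have hn1 : 1 ≤ n := Finset.card_pos.2 ⟨e, by simp [hv]⟩
    have h3 : (m : ℤ) * ((n - 1) / m : ℕ) ≤ n - 1 := by
      have := Nat.mul_div_le (n - 1) m
      generalize (n - 1) / m = k at this ⊢
      have h4 : ((m * k : ℕ) : ℤ) ≤ ((n - 1 : ℕ) : ℤ) := by exact_mod_cast this
      push_cast [Nat.cast_sub hn1] at h4
      exact h4
    rw [h1]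
    have h4 := mul_le_mul_of_nonneg_left h2 (Int.natCast_nonneg m)
    linarith
  rw [sum_meet, sum_meet, sum_mem h, sum_mem h]
  have k1 := key v w h
  have k2 := key w v (by rw [h, Sym2.eq_swap])
  linarith

/-- If there are enough residues for the edges of a class at every node, then these edges get
different residues, and no three of them can have the same label. -/
lemma label_sparse {m : ℕ} (hm : 0 < m)
    (h : ∀ v k, k ≠ 0 →
      (Finset.univ.filter fun e : N.Edge => v ∈ e.1 ∧ (τ e).cls = k).card ≤ m)
    (hcls : ∀ e f : N.Edge, (τ e).cls ≠ 0 → (τ f).cls ≠ 0 → (τ e).cls = (τ f).cls) :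
    SparseLabels ((label m).step τ) := by
  obtain ⟨r, -, hcard, hlab⟩ := step_label τ hm
  intro v e f g he hf hg hef heg hfg hlf hlg
  by_contra h0
  have hce : (τ e).cls ≠ 0 := fun hc => h0 ((lab_step_label τ e).2 hc)
  have hcf : (τ f).cls ≠ 0 := fun hc => h0 (hlf ▸ (lab_step_label τ f).2 hc)
  have hcg : (τ g).cls ≠ 0 := fun hc => h0 (hlg ▸ (lab_step_label τ g).2 hc)
  have hinj : ∀ a b : N.Edge, v ∈ a.1 → v ∈ b.1 → (τ a).cls ≠ 0 → (τ b).cls ≠ 0 →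
      r v a = r v b → a = b := by
    intro a b ha hb hca hcb hab
    have h1 := hcard v (τ a).cls (r v a)
    have h2 := h v (τ a).cls hca
    have h3 : ((Finset.univ.filter fun e : N.Edge => v ∈ e.1 ∧ (τ e).cls = (τ a).cls).card - 1) /
        m = 0 := Nat.div_eq_of_lt (by omega)
    rw [h3] at h1
    exact Finset.card_le_one.1 h1 a (by simp [ha]) b (by simp [hb, hab, hcls b a hcb hca])
  obtain ⟨w, hw⟩ := id he
  rcases label_residues τ hlab hw hf h0 hlf.symm with h1 | h1
  · exact hef (hinj e f he hf hce hcf h1.symm)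
  rcases label_residues τ hlab hw hg h0 hlg.symm with h2 | h2
  · exact heg (hinj e g he hg hce hcg h2.symm)
  · exact hfg (hinj f g hf hg hcf hcg (h1.trans h2.symm))

lemma step_label_eq {m : ℕ} (e : N.Edge) :
    (label m).step τ e = { τ e with lab := ((label m).step τ e).lab, z := 0 } := rfl

end Instr

/-! ### Greedy sweeps -/

/-- Local maximisation of a quadratic function: in round `t` the variables in slot `t + 1` change
simultaneously, each in a direction in which the function increases. The loss caused by
simultaneous changes is bounded by the interactions within the slots. -/
lemma greedy_sweep {E : Type*} [Fintype E] (q : E → E → ℝ) (hsymm : ∀ e f, q e f = q f e)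
    (hq : ∀ e f, 0 ≤ q e f) (l β : E → ℝ) (slot : E → ℕ) (z : ℕ → E → ℝ)
    (hstay : ∀ t e, slot e ≠ t + 1 → z (t + 1) e = z t e)
    (hgreedy : ∀ t e, slot e = t + 1 →
      0 ≤ (z (t + 1) e - z t e) * (l e - ∑ f, q e f * z t f))
    (hβ : ∀ t e, slot e = t + 1 → |z (t + 1) e - z t e| ≤ β e) (T : ℕ) :
    (∑ e, l e * z 0 e - 1 / 2 * ∑ e, ∑ f, q e f * z 0 e * z 0 f) -
      1 / 2 * ∑ e, ∑ f, (if slot e = slot f ∧ slot e ≠ 0 then q e f * β e * β f else 0) ≤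
    ∑ e, l e * z T e - 1 / 2 * ∑ e, ∑ f, q e f * z T e * z T f := by
  have hβ0 : ∀ e, slot e ≠ 0 → 0 ≤ β e := by
    intro e he
    obtain ⟨t, ht⟩ := Nat.exists_eq_succ_of_ne_zero he
    exact (abs_nonneg _).trans (hβ t e ht)
  have key : ∀ t, (∑ e, l e * z 0 e - 1 / 2 * ∑ e, ∑ f, q e f * z 0 e * z 0 f) -
      1 / 2 * ∑ e, ∑ f, (if slot e = slot f ∧ slot e ≠ 0 ∧ slot e ≤ t then
        q e f * β e * β f else 0) ≤
      ∑ e, l e * z t e - 1 / 2 * ∑ e, ∑ f, q e f * z t e * z t f := by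
    intro t
    induction t with
    | zero =>
      rw [Finset.sum_eq_zero (f := fun e => ∑ f, _) fun e _ => Finset.sum_eq_zero fun f _ =>
        if_neg (by omega)]
      simp
    | succ t ih =>
      set δ : E → ℝ := fun e => z (t + 1) e - z t e with hδ
      have hz : ∀ e, z (t + 1) e = z t e + δ e := fun e => by simp [hδ]
      have hδ0 : ∀ e, slot e ≠ t + 1 → δ e = 0 := fun e he => by simp [hδ, hstay t e he]
      have h1 : ∑ e, ∑ f, q e f * z (t + 1) e * z (t + 1) f =
          ∑ e, ∑ f, q e f * z t e * z t f + 2 * ∑ e, δ e * ∑ f, q e f * z t f +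
          ∑ e, ∑ f, q e f * δ e * δ f := by
        have hswap : ∑ e, ∑ f, q e f * z t e * δ f = ∑ e, ∑ f, q e f * δ e * z t f := by
          rw [Finset.sum_comm]
          refine Finset.sum_congr rfl fun e _ => Finset.sum_congr rfl fun f _ => ?_
          rw [hsymm]
          ring
        have h2 : ∑ e, δ e * ∑ f, q e f * z t f = ∑ e, ∑ f, q e f * δ e * z t f := by
          refine Finset.sum_congr rfl fun e _ => ?_
          rw [Finset.mul_sum]
          exact Finset.sum_congr rfl fun f _ => by ring
        rw [h2, two_mul]
        nth_rw 1 [← hswap]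
        simp only [← Finset.sum_add_distrib]
        refine Finset.sum_congr rfl fun e _ => Finset.sum_congr rfl fun f _ => ?_
        rw [hz, hz]
        ring
      have h2 : ∑ e, l e * z (t + 1) e = ∑ e, l e * z t e + ∑ e, l e * δ e := by
        rw [← Finset.sum_add_distrib]
        exact Finset.sum_congr rfl fun e _ => by rw [hz]; ring
      have h3 : 0 ≤ ∑ e, l e * δ e - ∑ e, δ e * ∑ f, q e f * z t f := by
        rw [← Finset.sum_sub_distrib]
        refine Finset.sum_nonneg fun e _ => ?_
        by_cases he : slot e = t + 1
        · have := hgreedy t e he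
          simp only [hδ]
          linarith
        · simp [hδ0 e he]
      have h4 : ∑ e, ∑ f, q e f * δ e * δ f ≤
          ∑ e, ∑ f, (if slot e = slot f ∧ slot e = t + 1 then q e f * β e * β f else 0) := by
        refine Finset.sum_le_sum fun e _ => Finset.sum_le_sum fun f _ => ?_
        split_ifs with h
        · have he := h.2
          have hf := h.1 ▸ h.2
          rw [mul_assoc, mul_assoc]
          refine mul_le_mul_of_nonneg_left ?_ (hq e f)
          refine (le_abs_self _).trans ?_
          rw [abs_mul]
          exact mul_le_mul (hβ t e he) (hβ t f hf) (abs_nonneg _) (hβ0 e (by omega))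
        · by_cases he : slot e = t + 1
          · rw [hδ0 f (fun hf => h ⟨by omega, he⟩)]
            simp
          · rw [hδ0 e he]
            simp
      have h5 : ∑ e, ∑ f, (if slot e = slot f ∧ slot e ≠ 0 ∧ slot e ≤ t + 1 then
          q e f * β e * β f else 0) =
          ∑ e, ∑ f, (if slot e = slot f ∧ slot e ≠ 0 ∧ slot e ≤ t then
            q e f * β e * β f else 0) +
          ∑ e, ∑ f, (if slot e = slot f ∧ slot e = t + 1 then q e f * β e * β f else 0) := by
        simp only [← Finset.sum_add_distrib]
        refine Finset.sum_congr rfl fun e _ => Finset.sum_congr rfl fun f _ => ?_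
        by_cases ha : slot e = slot f
        · by_cases hb : slot e = t + 1
          · rw [if_pos ⟨ha, by omega⟩, if_neg (by omega), if_pos ⟨ha, hb⟩, zero_add]
          · rw [if_neg (c := slot e = slot f ∧ slot e = t + 1) (by omega), add_zero]
            refine if_congr ?_ rfl rfl
            omega
        · simp [ha]
      rw [h1, h2, h5]
      linarith
  refine le_trans ?_ (key T)
  refine sub_le_sub_left (mul_le_mul_of_nonneg_left ?_ (by norm_num)) _
  refine Finset.sum_le_sum fun e _ => Finset.sum_le_sum fun f _ => ?_
  by_cases h : slot e = slot f ∧ slot e ≠ 0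
  · rw [if_pos h]
    have : 0 ≤ q e f * β e * β f :=
      mul_nonneg (mul_nonneg (hq e f) (hβ0 e h.2)) (hβ0 f (h.1 ▸ h.2))
    split_ifs
    · rfl
    · exact this
  · rw [if_neg h, if_neg (fun h' => h ⟨h'.1, h'.2.1⟩)]

lemma run_map_range_succ {N : Network} (I : ℕ → Instr) (τ : N.Edge → EdgeState) (t : ℕ) :
    run N ((List.range (t + 1)).map I) τ = (I t).step (run N ((List.range t).map I) τ) := by
  rw [List.range_succ, List.map_append, run_append]
  rfl

lemma run_replicate_succ {N : Network} (P : List Instr) (τ : N.Edge → EdgeState) (k : ℕ) :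
    run N (List.replicate (k + 1) P).flatten τ =
      run N P (run N (List.replicate k P).flatten τ) := by
  rw [List.replicate_succ', List.flatten_append, run_append]
  simp

/-! ### Splitting the classes -/

/-- Round `t` of a sweep in which every edge chooses the side of its class on which there is less
adjacent weight so far. -/
def splitInstr (t : ℕ) : Instr :=
  Instr.gather (fun s s' => if s'.cls = s.cls then (s.w + s'.w) * s'.z else 0)
    fun s m => if s.lab = t + 1 then { s with z := if 0 ≤ m then -1 else 1 } else s

/-- The two sides of every class become classes of their own. -/
def newClassInstr : Instr :=
  Instr.silent fun s =>
    { s with cls := if s.cls = 0 then 0 else 2 * s.cls + if s.z = 1 then 1 else 0 }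

/-- Every class is split into two, such that about one half of the conflicts within the class
disappears; the larger `m`, the closer to one half. -/
def splitProg (m : ℕ) : List Instr :=
  Instr.label m :: ((List.range (m ^ 2)).map splitInstr ++ [newClassInstr])

section split

variable {N : Network}

open Network

/-- Two assignments of states agree in the outputs, the colours, the weights and the values. -/
def SameMain (τ τ' : N.Edge → EdgeState) : Prop :=
  ∀ e, (τ' e).out = (τ e).out ∧ (τ' e).col = (τ e).col ∧ (τ' e).w = (τ e).w ∧ (τ' e).x = (τ e).x

lemma SameMain.refl (τ : N.Edge → EdgeState) : SameMain τ τ := fun _ => ⟨rfl, rfl, rfl, rfl⟩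

lemma SameMain.trans {τ τ' τ'' : N.Edge → EdgeState} (h : SameMain τ τ') (h' : SameMain τ' τ'') :
    SameMain τ τ'' := fun e =>
  ⟨(h' e).1.trans (h e).1, (h' e).2.1.trans (h e).2.1, (h' e).2.2.1.trans (h e).2.2.1,
    (h' e).2.2.2.trans (h e).2.2.2⟩

/-- The total weight of the conflicts between edges of the same class (every conflict is counted
twice). -/
noncomputable def classConflict (τ : N.Edge → EdgeState) : ℝ :=
  ∑ e, ∑ f, if (τ e).cls = (τ f).cls ∧ (τ e).cls ≠ 0 then
    (((τ e).w + (τ f).w) * meet e f : ℝ) else 0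

/-- The total weight of the edges which are in some class. -/
noncomputable def classWeight (τ : N.Edge → EdgeState) : ℝ :=
  ∑ e, if (τ e).cls ≠ 0 then ((τ e).w : ℝ) else 0

lemma classConflict_nonneg (τ : N.Edge → EdgeState) (hw : ∀ e, 0 ≤ (τ e).w) :
    0 ≤ classConflict τ := by
  refine Finset.sum_nonneg fun e _ => Finset.sum_nonneg fun f _ => ?_
  have h1 : (0 : ℝ) ≤ (τ e).w := by exact_mod_cast hw e
  have h2 : (0 : ℝ) ≤ (τ f).w := by exact_mod_cast hw f
  have h3 : (0 : ℝ) ≤ meet e f := by exact_mod_cast meet_nonneg e f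
  split_ifs
  · positivity
  · rfl

lemma classWeight_nonneg (τ : N.Edge → EdgeState) (hw : ∀ e, 0 ≤ (τ e).w) :
    0 ≤ classWeight τ := by
  refine Finset.sum_nonneg fun e _ => ?_
  have h1 : (0 : ℝ) ≤ (τ e).w := by exact_mod_cast hw e
  split_ifs
  · exact h1
  · rfl

lemma step_splitInstr (τ : N.Edge → EdgeState) (t : ℕ) (e : N.Edge) :
    (splitInstr t).step τ e = if (τ e).lab = t + 1 then
      { τ e with z := if 0 ≤ ∑ f, meet e f *
          (if (τ f).cls = (τ e).cls then ((τ e).w + (τ f).w) * (τ f).z else 0) then -1 else 1 }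
      else τ e := by
  rw [splitInstr, Instr.step_gather]

lemma sum_symm_two {E : Type*} [Fintype E] (q : E → E → ℝ) (hsymm : ∀ e f, q e f = q f e)
    (w : E → ℝ) : ∑ e, ∑ f, (w e + w f) * q e f = 2 * ∑ e, w e * ∑ f, q e f := by
  have h : ∑ e, ∑ f, w f * q e f = ∑ e, ∑ f, w e * q e f := by
    rw [Finset.sum_comm]
    exact Finset.sum_congr rfl fun e _ => Finset.sum_congr rfl fun f _ => by rw [hsymm]
  simp only [add_mul, Finset.sum_add_distrib, h, Finset.mul_sum]
  ring_nf
  simp only [Finset.sum_mul]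

/-- One splitting of the classes: what remains is one half of the conflicts, one half of those
between edges with equal labels (which choose simultaneously), and nothing else. -/
theorem splitProg_spec {m : ℕ} (hm : 0 < m) (τ : N.Edge → EdgeState) (hw : ∀ e, 0 ≤ (τ e).w) :
    SameMain τ (run N (splitProg m) τ) ∧
    (∀ e, (τ e).cls = 0 → (run N (splitProg m) τ e).cls = 0) ∧
    (∀ e, (τ e).cls ≠ 0 → (run N (splitProg m) τ e).cls = 2 * (τ e).cls ∨
      (run N (splitProg m) τ e).cls = 2 * (τ e).cls + 1) ∧
    classConflict (run N (splitProg m) τ) ≤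
      1 / 2 * (1 + 2 / m) * classConflict τ + 4 * classWeight τ := by
  set τ₀ := (Instr.label m).step τ with hτ₀
  set σ : ℕ → N.Edge → EdgeState := fun t => run N ((List.range t).map splitInstr) τ₀ with hσ
  have hσs : ∀ t, σ (t + 1) = (splitInstr t).step (σ t) := fun t => run_map_range_succ _ _ _
  have hfr : ∀ t e, σ t e = { τ₀ e with z := (σ t e).z } := by
    intro t
    induction t with
    | zero => intro e; rfl
    | succ t ih =>
      intro e
      rw [hσs, step_splitInstr]
      have h1 := ih e
      generalize σ t e = s at h1 ⊢
      split_ifs <;> rw [h1]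
  have hlab : ∀ t e, (σ t e).lab = (τ₀ e).lab := fun t e => by rw [hfr]
  have hcls : ∀ t e, (σ t e).cls = (τ e).cls := fun t e => by rw [hfr]; rfl
  have hwt : ∀ t e, (σ t e).w = (τ e).w := fun t e => by rw [hfr]; rfl
  have hz0 : ∀ t e, (τ₀ e).lab = 0 ∨ t < (τ₀ e).lab → (σ t e).z = 0 := by
    intro t
    induction t with
    | zero => intro e _; rfl
    | succ t ih =>
      intro e he
      rw [hσs, step_splitInstr, hlab, if_neg (by omega)]
      exact ih e (by omega)
  have hz1 : ∀ t e, (τ₀ e).lab ≠ 0 → (τ₀ e).lab ≤ t → (σ t e).z = -1 ∨ (σ t e).z = 1 := by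
    intro t
    induction t with
    | zero => intro e _ _; omega
    | succ t ih =>
      intro e he he'
      rw [hσs, step_splitInstr, hlab]
      split_ifs
      · exact Or.inl rfl
      · exact Or.inr rfl
      · exact ih e he (by omega)
  have hl0 : ∀ e, (τ₀ e).lab = 0 ↔ (τ e).cls = 0 := Instr.lab_step_label τ
  set T := m ^ 2 with hT
  have hlT : ∀ e, (τ₀ e).lab ≤ T := Instr.lab_step_label_le τ hm
  have hrun : run N (splitProg m) τ = newClassInstr.step (σ T) := by
    rw [splitProg, run_cons, run_append]
    rfl
  have hnew : ∀ e, run N (splitProg m) τ e = { σ T e with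
      cls := if (τ e).cls = 0 then 0 else 2 * (τ e).cls + if (σ T e).z = 1 then 1 else 0 } := by
    intro e
    rw [hrun, newClassInstr, Instr.step_silent, hcls]
  -- the interactions which the greedy choice of sides keeps small
  set q : N.Edge → N.Edge → ℝ := fun e f => if (τ e).cls = (τ f).cls ∧ (τ e).cls ≠ 0 then
    (((τ e).w + (τ f).w) * meet e f : ℝ) else 0 with hq
  have hqs : ∀ e f, q e f = q f e := by
    intro e f
    simp only [hq, meet_comm e f, add_comm ((τ e).w : ℝ)]
    exact if_congr ⟨fun h => ⟨h.1.symm, h.1 ▸ h.2⟩, fun h => ⟨h.1.symm, h.1 ▸ h.2⟩⟩ rfl rfl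
  have hq0 : ∀ e f, 0 ≤ q e f := by
    intro e f
    have h1 : (0 : ℝ) ≤ (τ e).w := by exact_mod_cast hw e
    have h2 : (0 : ℝ) ≤ (τ f).w := by exact_mod_cast hw f
    have h3 : (0 : ℝ) ≤ meet e f := by exact_mod_cast meet_nonneg e f
    simp only [hq]
    split_ifs
    · positivity
    · rfl
  have hsweep := greedy_sweep q hqs hq0 (fun _ => 0) (fun _ => 1) (fun e => (τ₀ e).lab)
    (fun t e => ((σ t e).z : ℝ))
    (by
      intro t e he
      simp only [hσs, step_splitInstr, hlab, if_neg he])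
    (by
      intro t e he
      have hc : (τ e).cls ≠ 0 := fun h => by rw [(hl0 e).2 h] at he; omega
      have hsum : ∑ f, q e f * ((σ t f).z : ℝ) = ((∑ f, meet e f *
          (if (σ t f).cls = (σ t e).cls then ((σ t e).w + (σ t f).w) * (σ t f).z else 0) : ℤ)
            : ℝ) := by
        push_cast
        refine Finset.sum_congr rfl fun f _ => ?_
        simp only [hq, hcls, hwt, hc, ne_eq, not_false_eq_true, and_true,
          eq_comm (a := (τ e).cls)]
        split_ifs
        · ring
        · simp
      simp only [hσs, step_splitInstr, hlab, if_pos he, hsum]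
      rw [hz0 t e (Or.inr (by omega))]
      generalize (∑ f, meet e f *
          (if (σ t f).cls = (σ t e).cls then ((σ t e).w + (σ t f).w) * (σ t f).z else 0)) = S
      split_ifs with hS
      · have : (0 : ℝ) ≤ S := by exact_mod_cast hS
        push_cast
        linarith
      · have : (S : ℝ) < 0 := by exact_mod_cast not_le.1 hS
        push_cast
        linarith)
    (by
      intro t e he
      rcases hz1 (t + 1) e (by omega) (by omega) with h | h <;>
      rw [h, hz0 t e (Or.inr (by omega))] <;> simp) T
  have hz00 : ∀ e, (σ 0 e).z = 0 := fun e => rfl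
  simp only [hz00, Int.cast_zero, mul_zero, Finset.sum_const_zero, zero_mul, mul_one, sub_zero,
    zero_sub] at hsweep
  -- conflicts between edges with equal labels
  have hslot : ∑ e, ∑ f, (if (τ₀ e).lab = (τ₀ f).lab ∧ (τ₀ e).lab ≠ 0 then q e f else 0) ≤
      2 / m * classConflict τ + 8 * classWeight τ := by
    set p : N.Edge → N.Edge → ℝ := fun e f => if (τ e).cls = (τ f).cls ∧ (τ e).cls ≠ 0 then
      (meet e f : ℝ) else 0 with hp
    set p' : N.Edge → N.Edge → ℝ := fun e f => if (τ₀ e).lab = (τ₀ f).lab then p e f else 0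
      with hp'
    have hps : ∀ e f, p e f = p f e := by
      intro e f
      simp only [hp, meet_comm e f]
      exact if_congr ⟨fun h => ⟨h.1.symm, h.1 ▸ h.2⟩, fun h => ⟨h.1.symm, h.1 ▸ h.2⟩⟩ rfl rfl
    have hps' : ∀ e f, p' e f = p' f e := by
      intro e f
      simp only [hp', hps e f, eq_comm (a := (τ₀ e).lab)]
    have e1 : classConflict τ = 2 * ∑ e, ((τ e).w : ℝ) * ∑ f, p e f := by
      rw [← sum_symm_two p hps, classConflict]
      refine Finset.sum_congr rfl fun e _ => Finset.sum_congr rfl fun f _ => ?_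
      simp only [hp, mul_ite, mul_zero]
    have e2 : ∑ e, ∑ f, (if (τ₀ e).lab = (τ₀ f).lab ∧ (τ₀ e).lab ≠ 0 then q e f else 0) =
        2 * ∑ e, ((τ e).w : ℝ) * ∑ f, p' e f := by
      rw [← sum_symm_two p' hps']
      refine Finset.sum_congr rfl fun e _ => Finset.sum_congr rfl fun f _ => ?_
      simp only [hp', hp, hq, ne_eq, hl0]
      split_ifs <;> first | tauto | simp
    have e3 : ∀ e, ((τ e).w : ℝ) * ∑ f, p' e f ≤
        2 / m * (((τ e).w : ℝ) * ∑ f, p e f) + 4 * if (τ e).cls ≠ 0 then ((τ e).w : ℝ) else 0 := by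
      intro e
      have h1 : (0 : ℝ) ≤ (τ e).w := by exact_mod_cast hw e
      by_cases hc : (τ e).cls = 0
      · simp [hp, hp', hc]
      · have h2 := Instr.label_even τ hm e hc
        have h3 : (m : ℝ) * ∑ f, p' e f ≤ 2 * ∑ f, p e f + 4 * m := by
          have h4 : ∑ f, p' e f = ((∑ f, meet e f * (if (τ f).cls = (τ e).cls ∧
              (τ₀ f).lab = (τ₀ e).lab then 1 else 0) : ℤ) : ℝ) := by
            push_cast
            refine Finset.sum_congr rfl fun f _ => ?_
            simp only [hp', hp, hc, ne_eq, not_false_eq_true, and_true, mul_ite, mul_one, mul_zero,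
              eq_comm (a := (τ e).cls), eq_comm (a := (τ₀ e).lab)]
            split_ifs <;> tauto
          have h5 : ∑ f, p e f =
              ((∑ f, meet e f * (if (τ f).cls = (τ e).cls then 1 else 0) : ℤ) : ℝ) := by
            push_cast
            refine Finset.sum_congr rfl fun f _ => ?_
            simp only [hp, hc, ne_eq, not_false_eq_true, and_true, mul_ite, mul_one, mul_zero,
              eq_comm (a := (τ e).cls)]
          rw [h4, h5]
          exact_mod_cast h2
        have hm' : (0 : ℝ) < m := by exact_mod_cast hm
        have h5 : ∑ f, p' e f ≤ 2 / m * ∑ f, p e f + 4 := by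
          rw [← sub_nonneg] at h3 ⊢
          have : 2 / m * ∑ f, p e f + 4 - ∑ f, p' e f =
            (2 * ∑ f, p e f + 4 * m - m * ∑ f, p' e f) / m := by field_simp
          rw [this]
          positivity
        rw [if_pos hc]
        have := mul_le_mul_of_nonneg_left h5 h1
        linarith
    rw [e2, e1, classWeight]
    have := Finset.sum_le_sum fun e (_ : e ∈ Finset.univ) => e3 e
    rw [Finset.sum_add_distrib, ← Finset.mul_sum, ← Finset.mul_sum] at this
    linarith
  refine ⟨?_, ?_, ?_, ?_⟩
  · intro e
    rw [hnew, hfr]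
    exact ⟨rfl, rfl, rfl, rfl⟩
  · intro e he
    rw [hnew]
    simp [he]
  · intro e he
    rw [hnew]
    simp only [he, if_false]
    split_ifs <;> simp
  · have hfin : 2 * classConflict (run N (splitProg m) τ) =
        classConflict τ + ∑ e, ∑ f, q e f * ((σ T e).z : ℝ) * ((σ T f).z : ℝ) := by
      simp only [classConflict]
      rw [Finset.mul_sum, ← Finset.sum_add_distrib]
      refine Finset.sum_congr rfl fun e _ => ?_
      rw [Finset.mul_sum, ← Finset.sum_add_distrib]
      refine Finset.sum_congr rfl fun f _ => ?_
      simp only [hnew, hq, hwt]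
      by_cases hc : (τ e).cls = (τ f).cls ∧ (τ e).cls ≠ 0
      · have hce := hc.2
        have hcf : (τ f).cls ≠ 0 := hc.1 ▸ hc.2
        simp only [if_pos hc, if_neg hce, if_neg hcf]
        rw [hc.1]
        rcases hz1 T e (fun h => hce ((hl0 e).1 h)) (hlT e) with h | h <;>
        rcases hz1 T f (fun h => hcf ((hl0 f).1 h)) (hlT f) with h' | h' <;>
        simp [h, h', hcf] <;> ring
      · have hne : ¬ ((if (τ e).cls = 0 then 0 else
            2 * (τ e).cls + if (σ T e).z = 1 then 1 else 0) =
            (if (τ f).cls = 0 then 0 else 2 * (τ f).cls + if (σ T f).z = 1 then 1 else 0) ∧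
            (if (τ e).cls = 0 then 0 else
              2 * (τ e).cls + if (σ T e).z = 1 then 1 else 0) ≠ 0) := by
          rintro ⟨h1, h2⟩
          by_cases ha : (τ e).cls = 0
          · simp [ha] at h2
          by_cases hb : (τ f).cls = 0
          · simp [ha, hb] at h1
          rw [if_neg ha, if_neg hb] at h1
          refine hc ⟨?_, ha⟩
          split_ifs at h1 <;> omega
        rw [if_neg hc, if_neg hne]
        simp
    linarith
end split

section rounding

variable {N : Network}

open Network

lemma classWeight_splitProg {m : ℕ} (hm : 0 < m) (τ : N.Edge → EdgeState)
    (hw : ∀ e, 0 ≤ (τ e).w) : classWeight (run N (splitProg m) τ) = classWeight τ := by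
  obtain ⟨h1, h2, h3, -⟩ := splitProg_spec hm τ hw
  refine Finset.sum_congr rfl fun e _ => ?_
  rw [(h1 e).2.2.1]
  refine if_congr ⟨fun h h' => h (h2 e h'), fun h => ?_⟩ rfl rfl
  rcases h3 e h with h4 | h4 <;> omega

/-- `J` successive splittings. -/
theorem replicate_splitProg_spec {m J : ℕ} (hm : 4 ≤ m) (hJ : 2 * J ≤ m)
    (τ : N.Edge → EdgeState) (hw : ∀ e, 0 ≤ (τ e).w) (hcls : ∀ e, (τ e).cls ≤ 1) :
    SameMain τ (run N (List.replicate J (splitProg m)).flatten τ) ∧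
    (∀ e, (τ e).cls = 0 → (run N (List.replicate J (splitProg m)).flatten τ e).cls = 0) ∧
    (∀ e, (τ e).cls ≠ 0 →
      2 ^ J ≤ (run N (List.replicate J (splitProg m)).flatten τ e).cls ∧
      (run N (List.replicate J (splitProg m)).flatten τ e).cls < 2 ^ (J + 1)) ∧
    classConflict (run N (List.replicate J (splitProg m)).flatten τ) ≤
      3 / 2 ^ J * classConflict τ + 16 * classWeight τ := by
  have hm0 : 0 < m := by omega
  have hmr : (4 : ℝ) ≤ m := by exact_mod_cast hm
  have hW := classWeight_nonneg τ hw
  have hM := classConflict_nonneg τ hw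
  set ρ : ℝ := 1 / 2 * (1 + 2 / m) with hρ
  have hρ0 : 0 ≤ ρ := by positivity
  have hρ1 : ρ ≤ 3 / 4 := by
    have : 2 / (m : ℝ) ≤ 1 / 2 := by
      rw [div_le_div_iff₀ (by linarith) (by norm_num)]
      linarith
    rw [hρ]
    linarith
  have key : ∀ j, SameMain τ (run N (List.replicate j (splitProg m)).flatten τ) ∧
      (∀ e, (τ e).cls = 0 → (run N (List.replicate j (splitProg m)).flatten τ e).cls = 0) ∧
      (∀ e, (τ e).cls ≠ 0 →
        2 ^ j ≤ (run N (List.replicate j (splitProg m)).flatten τ e).cls ∧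
        (run N (List.replicate j (splitProg m)).flatten τ e).cls < 2 ^ (j + 1)) ∧
      classWeight (run N (List.replicate j (splitProg m)).flatten τ) = classWeight τ ∧
      classConflict (run N (List.replicate j (splitProg m)).flatten τ) ≤
        ρ ^ j * classConflict τ + 16 * classWeight τ := by
    intro j
    induction j with
    | zero =>
      refine ⟨SameMain.refl τ, fun e h => h, fun e h => ?_, rfl, ?_⟩
      · have := hcls e
        simp
        omega
      · simp
        exact hW
    | succ j ih =>
      obtain ⟨i1, i2, i3, i4, i5⟩ := ih
      rw [run_replicate_succ]
      set τ' := run N (List.replicate j (splitProg m)).flatten τ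
      have hw' : ∀ e, 0 ≤ (τ' e).w := fun e => by rw [(i1 e).2.2.1]; exact hw e
      obtain ⟨s1, s2, s3, s4⟩ := splitProg_spec hm0 τ' hw'
      refine ⟨i1.trans s1, fun e h => s2 e (i2 e h), fun e h => ?_,
        (classWeight_splitProg hm0 τ' hw').trans i4, ?_⟩
      · obtain ⟨k1, k2⟩ := i3 e h
        have : (τ' e).cls ≠ 0 := by have := Nat.two_pow_pos j; omega
        rcases s3 e this with h4 | h4 <;> rw [h4] <;> constructor <;>
          simp only [pow_succ] at * <;> omega
      · rw [i4, ← hρ] at s4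
        refine s4.trans ?_
        have h6 := mul_le_mul_of_nonneg_left i5 hρ0
        have h7 := mul_le_mul_of_nonneg_right hρ1 hW
        rw [pow_succ']
        linarith
  obtain ⟨k1, k2, k3, -, k5⟩ := key J
  refine ⟨k1, k2, k3, k5.trans ?_⟩
  have h1 : ρ ^ J ≤ 3 / 2 ^ J := by
    rw [hρ, mul_pow, one_div, inv_pow, div_eq_inv_mul (3 : ℝ)]
    refine mul_le_mul_of_nonneg_left ?_ (by positivity)
    have h2 : 1 + 2 / (m : ℝ) ≤ Real.exp (2 / m) := by
      rw [add_comm]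
      exact Real.add_one_le_exp _
    calc (1 + 2 / (m : ℝ)) ^ J ≤ Real.exp (2 / m) ^ J := pow_le_pow_left₀ (by positivity) h2 J
      _ = Real.exp (J * (2 / m)) := by rw [Real.exp_nat_mul]
      _ ≤ Real.exp 1 := by
        refine Real.exp_le_exp.2 ?_
        have : (2 * J : ℝ) ≤ m := by exact_mod_cast hJ
        rw [mul_div_assoc', div_le_one (by linarith)]
        linarith
      _ ≤ 3 := by linarith [Real.exp_one_lt_d9]
  have := mul_le_mul_of_nonneg_right h1 hM
  linarith

/-! ### Rounding -/

/-- The total weight of the fractional matching, in multiples of `2 ^ (-K)`. -/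
noncomputable def totalValue (τ : N.Edge → EdgeState) : ℝ := ∑ e, ((τ e).w * (τ e).x : ℝ)

/-- The total weight which is lost in conflicts if every edge `e` of the fractional matching is
selected independently with probability `x_e / 2 ^ K` and gives way to every adjacent edge that
is selected, too; in multiples of `2 ^ (-2 * K)`. -/
noncomputable def totalConflict (τ : N.Edge → EdgeState) : ℝ :=
  ∑ e, ((τ e).w : ℝ) * ∑ f, (meet e f * (τ e).x * (τ f).x : ℝ)

/-- A weighted difference of value and conflicts, the potential function of the rounding. -/
noncomputable def potential (K : ℕ) (a b : ℝ) (τ : N.Edge → EdgeState) : ℝ :=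
  b * 2 ^ K * totalValue τ - a * totalConflict τ

/-- The edges with value in `[2 ^ r, 2 ^ (r + 1))` form a class. -/
def classifyInstr (r : ℕ) : Instr :=
  Instr.silent fun s => { s with cls := if 2 ^ r ≤ s.x ∧ s.x < 2 ^ (r + 1) then 1 else 0 }

/-- Round `t` of the sweep in which every edge with a class doubles its value or drops it to zero,
in the direction in which the potential function increases. -/
noncomputable def roundInstr (K : ℕ) (a b : ℝ) (t : ℕ) : Instr :=
  Instr.gather (fun s s' => (s.w + s'.w) * s'.x) fun s m => if s.cls = t + 1 then
    { s with x := open scoped Classical in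
        if a * m ≤ b * 2 ^ K * s.w then min (2 * s.x) (2 ^ K) else 0 } else s

/-- The values in `[2 ^ r, 2 ^ (r + 1))` are rounded to multiples of `2 ^ (r + 1)`. -/
noncomputable def roundProg (K J m : ℕ) (a b : ℝ) (r : ℕ) : List Instr :=
  classifyInstr r :: ((List.replicate J (splitProg m)).flatten ++
    (List.range (2 ^ (J + 1))).map (roundInstr K a b))

open scoped Classical in
lemma step_roundInstr (K : ℕ) (a b : ℝ) (τ : N.Edge → EdgeState) (t : ℕ) (e : N.Edge) :
    (roundInstr K a b t).step τ e = if (τ e).cls = t + 1 then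
      { τ e with x := if a * (∑ f, meet e f * (((τ e).w + (τ f).w) * (τ f).x) : ℤ) ≤
          b * 2 ^ K * (τ e).w then min (2 * (τ e).x) (2 ^ K) else 0 }
      else τ e := by
  rw [roundInstr, Instr.step_gather]

lemma two_mul_totalConflict (τ : N.Edge → EdgeState) : 2 * totalConflict τ =
    ∑ e, ∑ f, ((τ e).w + (τ f).w : ℝ) * (meet e f * (τ e).x * (τ f).x) := by
  rw [sum_symm_two (fun e f => (meet e f * (τ e).x * (τ f).x : ℝ))
    (fun e f => by rw [meet_comm]; ring) fun e => ((τ e).w : ℝ)]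
  rfl

/-- Rounding one scale. The values in `[2 ^ r, 2 ^ (r + 1))` vanish or double; the loss is a small
fraction of the conflicts, which is absorbed by the factor `a`, and a multiple of `2 ^ r / 2 ^ K` of
the value, which is absorbed by the factor `b`. -/
theorem roundProg_spec {K J m : ℕ} {a b : ℝ} {r : ℕ} (hm : 4 ≤ m) (hJ : 2 * J ≤ m) (ha : 0 ≤ a)
    (hr : r + 2 ≤ K) (τ : N.Edge → EdgeState) (hw : ∀ e, 0 ≤ (τ e).w)
    (hx : ∀ e, (τ e).x = 0 ∨ 2 ^ r ≤ (τ e).x) :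
    (∀ e, (run N (roundProg K J m a b r) τ e).out = (τ e).out ∧
      (run N (roundProg K J m a b r) τ e).col = (τ e).col ∧
      (run N (roundProg K J m a b r) τ e).w = (τ e).w) ∧
    (∀ e, (run N (roundProg K J m a b r) τ e).x = 0 ∨
      2 ^ (r + 1) ≤ (run N (roundProg K J m a b r) τ e).x) ∧
    (∀ e, (τ e).x = 0 → (run N (roundProg K J m a b r) τ e).x = 0) ∧
    (∀ e, (τ e).x ≤ 2 ^ K → (run N (roundProg K J m a b r) τ e).x ≤ 2 ^ K) ∧
    potential K (a * (1 + 12 / 2 ^ J)) (b - 32 * a * 2 ^ r / 2 ^ K) τ ≤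
      potential K a b (run N (roundProg K J m a b r) τ) := by
  set τ₁ := (classifyInstr r).step τ with hτ₁
  have h1 : ∀ e, τ₁ e =
      { τ e with cls := if 2 ^ r ≤ (τ e).x ∧ (τ e).x < 2 ^ (r + 1) then 1 else 0 } := by
    intro e
    rw [hτ₁, classifyInstr, Instr.step_silent]
  obtain ⟨s1, s2, s3, s4⟩ := replicate_splitProg_spec hm hJ τ₁ (fun e => by rw [h1]; exact hw e)
    (fun e => by rw [h1]; dsimp only; split_ifs <;> simp)
  set τ₂ := run N (List.replicate J (splitProg m)).flatten τ₁ with hτ₂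
  have hw2 : ∀ e, (τ₂ e).w = (τ e).w := fun e => by rw [(s1 e).2.2.1, h1]
  have hx2 : ∀ e, (τ₂ e).x = (τ e).x := fun e => by rw [(s1 e).2.2.2, h1]
  have hcx : ∀ e, (τ₂ e).cls ≠ 0 ↔ 2 ^ r ≤ (τ e).x ∧ (τ e).x < 2 ^ (r + 1) := by
    intro e
    have hc : (τ₁ e).cls ≠ 0 ↔ 2 ^ r ≤ (τ e).x ∧ (τ e).x < 2 ^ (r + 1) := by
      rw [h1]
      dsimp only
      split_ifs with h <;> simp [h]
    rw [← hc]
    constructor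
    · exact fun h h' => h (s2 e h')
    · intro h
      have := (s3 e h).1
      have := Nat.two_pow_pos J
      omega
  have hcT : ∀ e, (τ₂ e).cls ≤ 2 ^ (J + 1) := by
    intro e
    by_cases h : (τ₁ e).cls = 0
    · rw [s2 e h]
      positivity
    · exact (s3 e h).2.le
  set σ : ℕ → N.Edge → EdgeState :=
    fun t => run N ((List.range t).map (roundInstr K a b)) τ₂ with hσ
  have hσs : ∀ t, σ (t + 1) = (roundInstr K a b t).step (σ t) := fun t => run_map_range_succ _ _ _
  set T := 2 ^ (J + 1) with hT
  have hrun : run N (roundProg K J m a b r) τ = σ T := by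
    rw [roundProg, run_cons, run_append]
  have hfr : ∀ t e, σ t e = { τ₂ e with x := (σ t e).x } := by
    intro t
    induction t with
    | zero => intro e; rfl
    | succ t ih =>
      intro e
      rw [hσs, step_roundInstr]
      have h1 := ih e
      generalize σ t e = s at h1 ⊢
      split_ifs <;> rw [h1]
  have hcls : ∀ t e, (σ t e).cls = (τ₂ e).cls := fun t e => by rw [hfr]
  have hwt : ∀ t e, (σ t e).w = (τ e).w := fun t e => by rw [hfr]; exact hw2 e
  have hbefore : ∀ t e, (τ₂ e).cls = 0 ∨ t < (τ₂ e).cls → (σ t e).x = (τ e).x := by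
    intro t
    induction t with
    | zero => intro e _; exact hx2 e
    | succ t ih =>
      intro e he
      rw [hσs, step_roundInstr, hcls, if_neg (by omega)]
      exact ih e (by omega)
  have hmin : ∀ e, (τ₂ e).cls ≠ 0 → min (2 * (τ e).x) (2 ^ K) = 2 * (τ e).x := by
    intro e he
    refine min_eq_left ?_
    have h3 := ((hcx e).1 he).2
    have h4 : (2 : ℤ) ^ (r + 2) ≤ 2 ^ K := pow_le_pow_right₀ (by norm_num) hr
    have h5 : (2 : ℤ) ^ (r + 2) = 2 * 2 ^ (r + 1) := by ring
    linarith
  have hafter : ∀ t e, (τ₂ e).cls ≠ 0 → (τ₂ e).cls ≤ t →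
      (σ t e).x = 0 ∨ (σ t e).x = 2 * (τ e).x := by
    intro t
    induction t with
    | zero => intro e _ _; omega
    | succ t ih =>
      intro e he he'
      rw [hσs, step_roundInstr, hcls]
      split_ifs with h3
      · right
        dsimp only
        rw [hbefore t e (Or.inr (by omega)), hmin e he]
      · exact Or.inl rfl
      · exact ih e he (by omega)
  rw [hrun]
  refine ⟨fun e => ?_, fun e => ?_, fun e he => ?_, fun e he => ?_, ?_⟩
  · rw [hfr]
    refine ⟨?_, ?_, hw2 e⟩
    · dsimp only
      rw [(s1 e).1, h1]
    · dsimp only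
      rw [(s1 e).2.1, h1]
  · by_cases hc : (τ₂ e).cls = 0
    · rw [hbefore T e (Or.inl hc)]
      rcases hx e with h | h
      · exact Or.inl h
      · by_contra! h'
        exact (hcx e).2 ⟨h, h'.2⟩ hc
    · rcases hafter T e hc (hcT e) with h | h
      · exact Or.inl h
      · right
        rw [h, pow_succ']
        have := ((hcx e).1 hc).1
        linarith
  · have hc : (τ₂ e).cls = 0 := by
      by_contra hc
      have := ((hcx e).1 hc).1
      rw [he] at this
      exact absurd this (not_le.2 (by positivity))
    rw [hbefore T e (Or.inl hc), he]
  · by_cases hc : (τ₂ e).cls = 0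
    · rwa [hbefore T e (Or.inl hc)]
    · rcases hafter T e hc (hcT e) with h | h <;> rw [h]
      · positivity
      · rw [← hmin e hc]
        exact min_le_right _ _
  have hwr : ∀ e, (0 : ℝ) ≤ (τ e).w := fun e => by exact_mod_cast hw e
  have hmr : ∀ e f : N.Edge, (0 : ℝ) ≤ meet e f := fun e f => by exact_mod_cast meet_nonneg e f
  have hxr : ∀ e, (0 : ℝ) ≤ (τ e).x := by
    intro e
    have : 0 ≤ (τ e).x := by
      rcases hx e with h | h
      · exact h.ge
      · exact le_trans (by positivity) h
    exact_mod_cast this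
  set q : N.Edge → N.Edge → ℝ := fun e f => a * (((τ e).w + (τ f).w) * meet e f) with hq
  have hsweep := greedy_sweep q (fun e f => by simp only [hq, meet_comm e f]; ring)
    (fun e f => mul_nonneg ha (mul_nonneg (add_nonneg (hwr e) (hwr f)) (hmr e f)))
    (fun e => b * 2 ^ K * (τ e).w) (fun e => (τ e).x) (fun e => (τ₂ e).cls)
    (fun t e => ((σ t e).x : ℝ))
    (by
      intro t e he
      simp only [hσs, step_roundInstr, hcls, if_neg he])
    (by
      intro t e he
      have hsum : ∑ f, q e f * ((σ t f).x : ℝ) = a * ((∑ f, meet e f *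
          (((σ t e).w + (σ t f).w) * (σ t f).x) : ℤ) : ℝ) := by
        push_cast
        rw [Finset.mul_sum]
        refine Finset.sum_congr rfl fun f _ => ?_
        simp only [hq, hwt]
        ring
      simp only [hσs, step_roundInstr, hcls, if_pos he, hsum, hwt]
      rw [hbefore t e (Or.inr (by omega)), hmin e (by omega)]
      have := hxr e
      generalize a * ((∑ f, meet e f * (((τ e).w + (τ f).w) * (σ t f).x) : ℤ) : ℝ) = S
      split_ifs with hS
      · refine mul_nonneg ?_ (by linarith)
        push_cast
        linarith
      · refine mul_nonneg_of_nonpos_of_nonpos ?_ (by linarith)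
        push_cast
        linarith)
    (by
      intro t e he
      have := hxr e
      rcases hafter (t + 1) e (by omega) (by omega) with h | h <;>
      rw [h, hbefore t e (Or.inr (by omega))]
      · push_cast
        rw [zero_sub, abs_neg, abs_of_nonneg this]
      · push_cast
        rw [two_mul, add_sub_cancel_right, abs_of_nonneg this]) T
  have hpot : ∀ t, ∑ e, b * 2 ^ K * ((τ e).w : ℝ) * ((σ t e).x : ℝ) -
      1 / 2 * ∑ e, ∑ f, q e f * ((σ t e).x : ℝ) * ((σ t f).x : ℝ) =
      potential K a b (σ t) := by
    intro t
    have : ∑ e, ∑ f, q e f * ((σ t e).x : ℝ) * ((σ t f).x : ℝ) = a * (2 * totalConflict (σ t)) := by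
      rw [two_mul_totalConflict, Finset.mul_sum]
      refine Finset.sum_congr rfl fun e _ => ?_
      rw [Finset.mul_sum]
      refine Finset.sum_congr rfl fun f _ => ?_
      simp only [hq, hwt]
      ring
    rw [this, potential, totalValue, Finset.mul_sum]
    have h2 : ∑ e, b * 2 ^ K * ((τ e).w : ℝ) * ((σ t e).x : ℝ) =
        ∑ e, b * 2 ^ K * (((σ t e).w : ℝ) * ((σ t e).x : ℝ)) := by
      refine Finset.sum_congr rfl fun e _ => ?_
      rw [hwt]
      ring
    rw [h2]
    ring
  rw [hpot, hpot] at hsweep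
  have hσ0 : potential K a b (σ 0) = potential K a b τ := by
    have hx0 : ∀ e, (σ 0 e).x = (τ e).x := hx2
    simp only [potential, totalValue, totalConflict, hwt, hx0]
  -- the loss, in terms of the conflicts within the classes
  have hlt : ∀ e, (τ₂ e).cls ≠ 0 → ((τ e).x : ℝ) ≤ 2 * 2 ^ r ∧ (2 : ℝ) ^ r ≤ (τ e).x := by
    intro e he
    have h3 := (hcx e).1 he
    rw [pow_succ'] at h3
    exact ⟨by exact_mod_cast h3.2.le, by exact_mod_cast h3.1⟩
  have hloss : ∑ e, ∑ f, (if (τ₂ e).cls = (τ₂ f).cls ∧ (τ₂ e).cls ≠ 0 then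
      q e f * ((τ e).x : ℝ) * ((τ f).x : ℝ) else 0) ≤ a * (4 * 4 ^ r * classConflict τ₂) := by
    rw [classConflict, Finset.mul_sum, Finset.mul_sum]
    refine Finset.sum_le_sum fun e _ => ?_
    rw [Finset.mul_sum, Finset.mul_sum]
    refine Finset.sum_le_sum fun f _ => ?_
    split_ifs with h
    · have hxx : ((τ e).x : ℝ) * (τ f).x ≤ 4 * 4 ^ r := by
        have := mul_le_mul (hlt e h.2).1 (hlt f (h.1 ▸ h.2)).1 (hxr f) (by positivity)
        refine this.trans (le_of_eq ?_)
        rw [show (4 : ℝ) = 2 * 2 by norm_num, mul_pow]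
        ring
      rw [mul_assoc, hw2, hw2]
      simp only [hq]
      have hqq : 0 ≤ a * (((τ e).w + (τ f).w) * meet e f : ℝ) :=
        mul_nonneg ha (mul_nonneg (add_nonneg (hwr e) (hwr f)) (hmr e f))
      refine (mul_le_mul_of_nonneg_left hxx hqq).trans (le_of_eq ?_)
      ring
    · simp
  have hc1 : ∀ e, (τ₁ e).cls ≠ 0 → (2 : ℝ) ^ r ≤ (τ e).x := by
    intro e he
    have : (2 : ℤ) ^ r ≤ (τ e).x := by
      by_contra h
      apply he
      rw [h1]
      simp [h]
    exact_mod_cast this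
  have hM : 4 ^ r * classConflict τ₁ ≤ 2 * totalConflict τ := by
    rw [two_mul_totalConflict, classConflict, Finset.mul_sum]
    refine Finset.sum_le_sum fun e _ => ?_
    rw [Finset.mul_sum]
    refine Finset.sum_le_sum fun f _ => ?_
    have h0 : (0 : ℝ) ≤ ((τ e).w + (τ f).w) * meet e f :=
      mul_nonneg (add_nonneg (hwr e) (hwr f)) (hmr e f)
    split_ifs with h
    · have hxx : (4 : ℝ) ^ r ≤ (τ e).x * (τ f).x := by
        have := mul_le_mul (hc1 e h.2) (hc1 f (h.1 ▸ h.2)) (by positivity) (hxr e)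
        rwa [← mul_pow, show (2 : ℝ) * 2 = 4 by norm_num] at this
      have h5 := mul_le_mul_of_nonneg_right hxx h0
      have h6 : (τ₁ e).w = (τ e).w ∧ (τ₁ f).w = (τ f).w := by rw [h1, h1]; exact ⟨rfl, rfl⟩
      rw [h6.1, h6.2]
      linarith
    · rw [mul_zero]
      have := mul_nonneg h0 (mul_nonneg (hxr e) (hxr f))
      linarith
  have hW : 2 ^ r * classWeight τ₁ ≤ totalValue τ := by
    rw [classWeight, totalValue, Finset.mul_sum]
    refine Finset.sum_le_sum fun e _ => ?_
    split_ifs with h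
    · have h5 := mul_le_mul_of_nonneg_right (hc1 e h) (hwr e)
      have h6 : (τ₁ e).w = (τ e).w := by rw [h1]
      rw [h6]
      linarith
    · rw [mul_zero]
      exact mul_nonneg (hwr e) (hxr e)
  have e1 : 4 * 4 ^ r * classConflict τ₂ ≤
      24 / 2 ^ J * totalConflict τ + 64 * 2 ^ r * totalValue τ := by
    have k1 := mul_le_mul_of_nonneg_left s4 (show (0 : ℝ) ≤ 4 * 4 ^ r by positivity)
    have k2 := mul_le_mul_of_nonneg_left hM (show (0 : ℝ) ≤ 12 / 2 ^ J by positivity)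
    have k3 := mul_le_mul_of_nonneg_left hW (show (0 : ℝ) ≤ 64 * 2 ^ r by positivity)
    have k4 : (4 : ℝ) ^ r = 2 ^ r * 2 ^ r := by rw [← mul_pow]; norm_num
    calc 4 * 4 ^ r * classConflict τ₂
        ≤ 4 * 4 ^ r * (3 / 2 ^ J * classConflict τ₁ + 16 * classWeight τ₁) := k1
      _ = 12 / 2 ^ J * (4 ^ r * classConflict τ₁) + 64 * 2 ^ r * (2 ^ r * classWeight τ₁) := by
        rw [k4]
        ring
      _ ≤ 12 / 2 ^ J * (2 * totalConflict τ) + 64 * 2 ^ r * totalValue τ := add_le_add k2 k3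
      _ = _ := by ring
  have e2 := mul_le_mul_of_nonneg_left e1 ha
  have e3 : potential K (a * (1 + 12 / 2 ^ J)) (b - 32 * a * 2 ^ r / 2 ^ K) τ =
      potential K a b τ - 1 / 2 * (a * (24 / 2 ^ J * totalConflict τ +
        64 * 2 ^ r * totalValue τ)) := by
    rw [potential, potential]
    have : (b - 32 * a * 2 ^ r / 2 ^ K) * 2 ^ K = b * 2 ^ K - 32 * a * 2 ^ r := by
      field_simp
    rw [this]
    ring
  rw [e3]
  rw [hσ0] at hsweep
  linarith

end rounding

section loop

variable {N : Network}

open Network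

/-- The number of splittings before the edges of one scale are rounded. -/
def splitDepth (L : ℕ) : ℕ := Nat.clog 2 (24 * L)

/-- The factor of the conflicts in the potential function after the first `r` scales. -/
noncomputable def conflictFactor (L r : ℕ) : ℝ := (1 + 12 / 2 ^ splitDepth L) ^ (L - r)

/-- The factor of the value in the potential function after the first `r` scales. -/
noncomputable def valueFactor (L r : ℕ) : ℝ := 1 - 64 * (2 ^ L - 2 ^ r) / 2 ^ (L + 7)

/-- The rounding of one scale after the other. -/
noncomputable def scalesProg (L : ℕ) : List Instr :=
  (List.range L).flatMap fun r => roundProg (L + 7) (splitDepth L) (2 * splitDepth L + 4)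
    (conflictFactor L (r + 1)) (valueFactor L (r + 1)) r

lemma totalValue_nonneg (τ : N.Edge → EdgeState) (hw : ∀ e, 0 ≤ (τ e).w)
    (hx : ∀ e, 0 ≤ (τ e).x) : 0 ≤ totalValue τ :=
  Finset.sum_nonneg fun e _ => mul_nonneg (by exact_mod_cast hw e) (by exact_mod_cast hx e)

lemma totalConflict_nonneg (τ : N.Edge → EdgeState) (hw : ∀ e, 0 ≤ (τ e).w)
    (hx : ∀ e, 0 ≤ (τ e).x) : 0 ≤ totalConflict τ :=
  Finset.sum_nonneg fun e _ => mul_nonneg (by exact_mod_cast hw e) <|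
    Finset.sum_nonneg fun f _ => mul_nonneg (mul_nonneg (by exact_mod_cast meet_nonneg e f)
      (by exact_mod_cast hx e)) (by exact_mod_cast hx f)

lemma two_pow_splitDepth_ge (L : ℕ) : 24 * L ≤ 2 ^ splitDepth L :=
  Nat.le_pow_clog (by norm_num) _

lemma conflictFactor_nonneg (L r : ℕ) : 0 ≤ conflictFactor L r := by
  unfold conflictFactor
  positivity

lemma conflictFactor_le {L r : ℕ} (hL : 0 < L) : conflictFactor L r ≤ 2 := by
  have h1 : (24 * L : ℝ) ≤ 2 ^ splitDepth L := by exact_mod_cast two_pow_splitDepth_ge L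
  have hL' : (0 : ℝ) < L := by exact_mod_cast hL
  have h2 : (12 : ℝ) / 2 ^ splitDepth L ≤ 1 / (2 * L) := by
    rw [div_le_div_iff₀ (by positivity) (by positivity)]
    linarith
  calc conflictFactor L r ≤ (1 + 12 / 2 ^ splitDepth L) ^ L :=
        pow_le_pow_right₀ (le_add_of_nonneg_right (by positivity)) (Nat.sub_le _ _)
    _ ≤ Real.exp (1 / (2 * L)) ^ L := by
      refine pow_le_pow_left₀ (by positivity) ?_ _
      have := Real.add_one_le_exp (1 / (2 * L) : ℝ)
      linarith
    _ = Real.exp (1 / 2) := by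
      rw [← Real.exp_nat_mul]
      congr 1
      field_simp
    _ ≤ 2 := by
      have h3 : Real.exp (1 / 2) ^ 2 = Real.exp 1 := by
        rw [← Real.exp_nat_mul]
        norm_num
      nlinarith [Real.exp_one_lt_d9, Real.exp_pos (1 / 2)]

/-- The losses at the different scales add up to a constant factor. -/
theorem scalesProg_spec {L : ℕ} (hL : 0 < L) (τ : N.Edge → EdgeState)
    (hw : ∀ e, 0 ≤ (τ e).w) (hx : ∀ e, 0 ≤ (τ e).x) :
    (∀ e, (run N (scalesProg L) τ e).out = (τ e).out ∧
      (run N (scalesProg L) τ e).col = (τ e).col ∧ (run N (scalesProg L) τ e).w = (τ e).w) ∧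
    (∀ e, (run N (scalesProg L) τ e).x = 0 ∨ 2 ^ L ≤ (run N (scalesProg L) τ e).x) ∧
    (∀ e, (τ e).x = 0 → (run N (scalesProg L) τ e).x = 0) ∧
    (∀ e, (τ e).x ≤ 2 ^ (L + 7) → (run N (scalesProg L) τ e).x ≤ 2 ^ (L + 7)) ∧
    potential (L + 7) 2 (1 / 2) τ ≤ potential (L + 7) 1 1 (run N (scalesProg L) τ) := by
  set prog : ℕ → List Instr := fun r => roundProg (L + 7) (splitDepth L) (2 * splitDepth L + 4)
    (conflictFactor L (r + 1)) (valueFactor L (r + 1)) r with hprog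
  have key : ∀ r, r ≤ L →
      (∀ e, (run N ((List.range r).flatMap prog) τ e).out = (τ e).out ∧
        (run N ((List.range r).flatMap prog) τ e).col = (τ e).col ∧
        (run N ((List.range r).flatMap prog) τ e).w = (τ e).w) ∧
      (∀ e, (run N ((List.range r).flatMap prog) τ e).x = 0 ∨
        2 ^ r ≤ (run N ((List.range r).flatMap prog) τ e).x) ∧
      (∀ e, (τ e).x = 0 → (run N ((List.range r).flatMap prog) τ e).x = 0) ∧
      (∀ e, (τ e).x ≤ 2 ^ (L + 7) →
        (run N ((List.range r).flatMap prog) τ e).x ≤ 2 ^ (L + 7)) ∧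
      potential (L + 7) (conflictFactor L 0) (valueFactor L 0) τ ≤
        potential (L + 7) (conflictFactor L r) (valueFactor L r)
          (run N ((List.range r).flatMap prog) τ) := by
    intro r
    induction r with
    | zero =>
      intro _
      refine ⟨fun e => ⟨rfl, rfl, rfl⟩, fun e => ?_, fun e h => h, fun e h => h, le_rfl⟩
      have := hx e
      simp only [List.range_zero, List.flatMap_nil, run_nil, pow_zero]
      omega
    | succ r ih =>
      intro hr
      obtain ⟨i1, i2, i3, i5, i4⟩ := ih (by omega)
      have hrun : run N ((List.range (r + 1)).flatMap prog) τ =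
          run N (prog r) (run N ((List.range r).flatMap prog) τ) := by
        rw [List.range_succ, List.flatMap_append, run_append]
        simp
      rw [hrun]
      set τ' := run N ((List.range r).flatMap prog) τ
      have hw' : ∀ e, 0 ≤ (τ' e).w := fun e => by rw [(i1 e).2.2]; exact hw e
      have hx' : ∀ e, 0 ≤ (τ' e).x := fun e => by
        rcases i2 e with h | h
        · exact h.ge
        · exact le_trans (by positivity) h
      obtain ⟨s1, s2, s3, s5, s4⟩ := roundProg_spec (m := 2 * splitDepth L + 4) (J := splitDepth L)
        (b := valueFactor L (r + 1)) (K := L + 7) (by omega) (by omega)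
        (conflictFactor_nonneg L (r + 1)) (show r + 2 ≤ L + 7 by omega) τ' hw' i2
      refine ⟨fun e => ⟨(s1 e).1.trans (i1 e).1, (s1 e).2.1.trans (i1 e).2.1,
        (s1 e).2.2.trans (i1 e).2.2⟩, s2, fun e h => s3 e (i3 e h),
        fun e h => s5 e (i5 e h),
        i4.trans (le_trans ?_ s4)⟩
      have ha : conflictFactor L (r + 1) * (1 + 12 / 2 ^ splitDepth L) = conflictFactor L r := by
        rw [conflictFactor, conflictFactor, ← pow_succ]
        congr 1
        omega
      have hb : valueFactor L r ≤
          valueFactor L (r + 1) - 32 * conflictFactor L (r + 1) * 2 ^ r / 2 ^ (L + 7) := by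
        have h5 : 32 * conflictFactor L (r + 1) * 2 ^ r / 2 ^ (L + 7) ≤
            64 * 2 ^ r / 2 ^ (L + 7) := by
          have := conflictFactor_le (r := r + 1) hL
          gcongr
          linarith
        have h6 : valueFactor L (r + 1) = valueFactor L r + 64 * 2 ^ r / 2 ^ (L + 7) := by
          rw [valueFactor, valueFactor, pow_succ]
          ring
        linarith
      rw [ha, potential, potential]
      have h7 := mul_le_mul_of_nonneg_right hb
        (mul_nonneg (show (0 : ℝ) ≤ 2 ^ (L + 7) by positivity) (totalValue_nonneg τ' hw' hx'))
      linarith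
  obtain ⟨k1, k2, k3, k5, k4⟩ := key L le_rfl
  refine ⟨k1, k2, k3, k5, ?_⟩
  have hR : potential (L + 7) (conflictFactor L L) (valueFactor L L)
      (run N ((List.range L).flatMap prog) τ) =
      potential (L + 7) 1 1 (run N (scalesProg L) τ) := by
    simp [conflictFactor, valueFactor, scalesProg, hprog]
  rw [hR] at k4
  refine le_trans ?_ k4
  have h1 : (1 / 2 : ℝ) ≤ valueFactor L 0 := by
    have h8 : (0 : ℝ) < 2 ^ L := by positivity
    have : valueFactor L 0 = 1 / 2 + 1 / (2 * 2 ^ L) := by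
      rw [valueFactor, pow_add]
      field_simp
      ring
    rw [this]
    linarith [show (0 : ℝ) < 1 / (2 * 2 ^ L) by positivity]
  have h2 := mul_le_mul_of_nonneg_right h1
    (mul_nonneg (show (0 : ℝ) ≤ 2 ^ (L + 7) by positivity) (totalValue_nonneg τ hw hx))
  have h3 := mul_le_mul_of_nonneg_right (conflictFactor_le (r := 0) hL)
    (totalConflict_nonneg τ hw hx)
  rw [potential, potential]
  linarith

/-! ### From small fractional degree to a matching -/

lemma potential_one_one (K : ℕ) (τ : N.Edge → EdgeState) :
    potential K 1 1 τ =
      ∑ e, (((τ e).w * (τ e).x * (2 ^ K - ∑ f, meet e f * (τ f).x) : ℤ) : ℝ) := by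
  rw [potential, totalValue, totalConflict, one_mul, one_mul, Finset.mul_sum,
    ← Finset.sum_sub_distrib]
  refine Finset.sum_congr rfl fun e _ => ?_
  push_cast
  have : ∑ f, (meet e f : ℝ) * (τ e).x * (τ f).x = (τ e).x * ∑ f, (meet e f : ℝ) * (τ f).x := by
    rw [Finset.mul_sum]
    exact Finset.sum_congr rfl fun f _ => by ring
  rw [this]
  ring

/-- Edges whose adjacent edges have total value more than `1` are dropped. -/
def cleanInstr (K : ℕ) : Instr :=
  Instr.gather (fun _ s' => s'.x) fun s m => if 2 ^ K < m then { s with x := 0 } else s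

theorem step_cleanInstr (K : ℕ) (τ : N.Edge → EdgeState) (e : N.Edge) :
    (cleanInstr K).step τ e =
      if 2 ^ K < ∑ f, meet e f * (τ f).x then { τ e with x := 0 } else τ e := by
  rw [cleanInstr, Instr.step_gather]

/-- The dropped edges contribute negatively to the potential, and those that remain have fewer
conflicts than before. -/
theorem cleanInstr_spec (K : ℕ) (τ : N.Edge → EdgeState) (hw : ∀ e, 0 ≤ (τ e).w)
    (hx : ∀ e, 0 ≤ (τ e).x) :
    (∀ e, ((cleanInstr K).step τ e).x = 0 ∨ ((cleanInstr K).step τ e).x = (τ e).x) ∧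
    (∀ e, ((cleanInstr K).step τ e).x ≠ 0 →
      ∑ f, meet e f * ((cleanInstr K).step τ f).x ≤ 2 ^ K) ∧
    potential K 1 1 τ ≤ potential K 1 1 ((cleanInstr K).step τ) := by
  have h1 : ∀ e, ((cleanInstr K).step τ e).x = 0 ∨ ((cleanInstr K).step τ e).x = (τ e).x := by
    intro e
    rw [step_cleanInstr]
    split_ifs
    · exact Or.inl rfl
    · exact Or.inr rfl
  have hle : ∀ e, ((cleanInstr K).step τ e).x ≤ (τ e).x := by
    intro e
    rcases h1 e with h | h <;> rw [h]
    exact hx e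
  have hsum : ∀ e, ∑ f, meet e f * ((cleanInstr K).step τ f).x ≤ ∑ f, meet e f * (τ f).x :=
    fun e => Finset.sum_le_sum fun f _ => mul_le_mul_of_nonneg_left (hle f) (meet_nonneg e f)
  have hkeep : ∀ e, ((cleanInstr K).step τ e).x ≠ 0 → ∑ f, meet e f * (τ f).x ≤ 2 ^ K := by
    intro e he
    by_contra! h
    rw [step_cleanInstr, if_pos h] at he
    exact he rfl
  refine ⟨h1, fun e he => (hsum e).trans (hkeep e he), ?_⟩
  rw [potential_one_one, potential_one_one]
  refine Finset.sum_le_sum fun e _ => ?_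
  have hwe : ((cleanInstr K).step τ e).w = (τ e).w := by
    rw [step_cleanInstr]
    split_ifs <;> rfl
  have hs := hsum e
  rw [hwe]
  generalize ∑ f, meet e f * ((cleanInstr K).step τ f).x = S at hs ⊢
  rw [step_cleanInstr]
  generalize ∑ f, meet e f * (τ f).x = S' at hs ⊢
  have h2 := mul_nonneg (hw e) (hx e)
  norm_cast
  split_ifs with h
  · simp only [mul_zero, zero_mul]
    push_cast at h
    exact mul_nonpos_of_nonneg_of_nonpos h2 (by push_cast; linarith)
  · exact mul_le_mul_of_nonneg_left (by linarith) h2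

/-- The number of binary digits of the colours after one colour reduction step. -/
def reducedBits (k : ℕ) : ℕ := 2 * Nat.clog 2 (2 * k + 1)

lemma sq_le_two_pow_reducedBits (k : ℕ) : (2 * k + 1) ^ 2 ≤ 2 ^ reducedBits k := by
  rw [reducedBits, mul_comm 2 (Nat.clog 2 _), pow_mul]
  exact Nat.pow_le_pow_left (Nat.le_pow_clog (by norm_num) _) 2

lemma reducedBits_pos {k : ℕ} (hk : 0 < k) : 0 < reducedBits k :=
  Nat.mul_pos (by norm_num) (Nat.clog_pos (by norm_num) (by omega))

lemma reducedBits_le_ten {k : ℕ} (hk : k ≤ 10) : reducedBits k ≤ 10 := by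
  have : Nat.clog 2 (2 * k + 1) ≤ 5 := (Nat.clog_le_iff_le_pow (by norm_num)).2 (by omega)
  unfold reducedBits
  omega

lemma reducedBits_lt {k : ℕ} (hk : 10 < k) : reducedBits k < k := by
  have h : ∀ j, 5 ≤ j → 4 * j + 5 ≤ 2 ^ j := by
    intro j hj
    induction j, hj using Nat.le_induction with
    | base => norm_num
    | succ j hj ih =>
      rw [pow_succ]
      omega
  have h1 := h ((k - 1) / 2) (by omega)
  have : Nat.clog 2 (2 * k + 1) ≤ (k - 1) / 2 :=
    (Nat.clog_le_iff_le_pow (by norm_num)).2 (by omega)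
  unfold reducedBits
  omega

lemma reducedBits_iterate_le {k n : ℕ} (h : k ≤ n + 10) : reducedBits^[n] k ≤ 10 := by
  induction n generalizing k with
  | zero => simpa using h
  | succ n ih =>
    rw [Function.iterate_succ_apply]
    apply ih
    rcases Nat.lt_or_ge 10 k with h1 | h1
    · have := reducedBits_lt h1
      omega
    · have := reducedBits_le_ten h1
      omega

/-- Colour reduction by `n` steps, starting from colours of `k` binary digits. -/
theorem replicate_reduce_spec (τ : N.Edge → EdgeState) (hs : Instr.SparseLabels τ)
    (hp : Instr.ProperWithinLabels τ) {k : ℕ} (hk : 0 < k) (hb : ∀ e, (τ e).tcol < 2 ^ k)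
    (n : ℕ) :
    Instr.ProperWithinLabels (run N (List.replicate n Instr.reduce) τ) ∧
    (∀ e, (run N (List.replicate n Instr.reduce) τ e).tcol < 2 ^ reducedBits^[n] k) ∧
    (∀ e, run N (List.replicate n Instr.reduce) τ e =
      { τ e with tcol := (run N (List.replicate n Instr.reduce) τ e).tcol }) := by
  induction n generalizing τ k with
  | zero => exact ⟨hp, hb, fun e => rfl⟩
  | succ n ih =>
    rw [List.replicate_succ, run_cons]
    have h1 := Instr.step_reduce_proper τ hs hp
    have h2 : ∀ e, (Instr.reduce.step τ e).tcol < 2 ^ reducedBits k := fun e =>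
      (Instr.step_reduce_lt τ hk hb e).trans_le (sq_le_two_pow_reducedBits k)
    obtain ⟨i1, i2, i3⟩ := ih (Instr.reduce.step τ) hs h1 (reducedBits_pos hk) h2
    refine ⟨i1, i2, fun e => ?_⟩
    rw [i3]
    rfl

/-- The number of rounds of the last sweep. The slot of an edge is the code of its label, which is at
most `129 ^ 2 = 16641`, and of its reduced colour, which is less than `1024`. -/
def finalSlots : ℕ := 16642 ^ 2

/-- Round `t` of the sweep in which every labelled edge enters or leaves the matching for good, in
the direction in which the potential function increases. -/
def finalInstr (K t : ℕ) : Instr :=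
  Instr.gather (fun s s' => (s.w + s'.w) * s'.x) fun s m =>
    if s.lab ≠ 0 ∧ Nat.pair s.lab s.tcol = t then
      { s with x := if m ≤ 2 ^ K * s.w then 2 ^ K else 0 } else s

lemma step_finalInstr (K t : ℕ) (τ : N.Edge → EdgeState) (e : N.Edge) :
    (finalInstr K t).step τ e = if (τ e).lab ≠ 0 ∧ Nat.pair (τ e).lab (τ e).tcol = t then
      { τ e with x := if ∑ f, meet e f * (((τ e).w + (τ f).w) * (τ f).x) ≤ 2 ^ K * (τ e).w
          then 2 ^ K else 0 } else τ e := by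
  rw [finalInstr, Instr.step_gather]

/-- The last sweep loses nothing, since no two adjacent edges choose simultaneously. -/
theorem finalSweep_spec (K : ℕ) (τ : N.Edge → EdgeState) (hw : ∀ e, 0 ≤ (τ e).w)
    (hx : ∀ e, 0 ≤ (τ e).x) (hxle : ∀ e, (τ e).x ≤ 2 ^ K) (h0 : ∀ e, (τ e).lab = 0 → (τ e).x = 0)
    (hp : Instr.ProperWithinLabels τ) (hlab : ∀ e, (τ e).lab ≤ 129 ^ 2)
    (htcol : ∀ e, (τ e).tcol < 1024) {T : ℕ} (hT : 16642 ^ 2 ≤ T) :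
    (∀ e, run N ((List.range T).map (finalInstr K)) τ e =
      { τ e with x := (run N ((List.range T).map (finalInstr K)) τ e).x }) ∧
    (∀ e, (τ e).lab = 0 → (run N ((List.range T).map (finalInstr K)) τ e).x = 0) ∧
    (∀ e, (run N ((List.range T).map (finalInstr K)) τ e).x = 0 ∨
      (run N ((List.range T).map (finalInstr K)) τ e).x = 2 ^ K) ∧
    potential K 1 1 τ ≤
      potential K 1 1 (run N ((List.range T).map (finalInstr K)) τ) := by
  set σ : ℕ → N.Edge → EdgeState :=
    fun t => run N ((List.range t).map (finalInstr K)) τ with hσ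
  have hσs : ∀ t, σ (t + 1) = (finalInstr K t).step (σ t) := fun t => run_map_range_succ _ _ _
  have hfr : ∀ t e, σ t e = { τ e with x := (σ t e).x } := by
    intro t
    induction t with
    | zero => intro e; rfl
    | succ t ih =>
      intro e
      rw [hσs, step_finalInstr]
      have h1 := ih e
      generalize σ t e = s at h1 ⊢
      by_cases hc : s.lab ≠ 0 ∧ Nat.pair s.lab s.tcol = t
      · rw [if_pos hc, h1]
      · rw [if_neg hc, h1]
  have hlabt : ∀ t e, (σ t e).lab = (τ e).lab := fun t e => by rw [hfr]
  have htcolt : ∀ t e, (σ t e).tcol = (τ e).tcol := fun t e => by rw [hfr]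
  have hwt : ∀ t e, (σ t e).w = (τ e).w := fun t e => by rw [hfr]
  set slot : N.Edge → ℕ := fun e =>
    if (τ e).lab = 0 then 0 else Nat.pair (τ e).lab (τ e).tcol + 1 with hslot
  have hslot_iff : ∀ e t, slot e = t + 1 ↔
      (τ e).lab ≠ 0 ∧ Nat.pair (τ e).lab (τ e).tcol = t := by
    intro e t
    simp only [hslot]
    split_ifs with h <;> simp [h]
  have hslotT : ∀ e, slot e ≤ T := by
    intro e
    simp only [hslot]
    split_ifs with h
    · simp
    · rw [Nat.add_one_le_iff]
      refine (Nat.pair_lt_max_add_one_sq _ _).trans_le (le_trans (Nat.pow_le_pow_left ?_ 2) hT)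
      have h1 := hlab e
      have h2 := htcol e
      omega
  have hstay : ∀ t e, slot e ≠ t + 1 → σ (t + 1) e = σ t e := by
    intro t e he
    rw [ne_eq, hslot_iff] at he
    rw [hσs, step_finalInstr, hlabt, htcolt, if_neg he]
  have hgo : ∀ t e, slot e = t + 1 → (σ (t + 1) e).x =
      if ∑ f, meet e f * (((τ e).w + (τ f).w) * (σ t f).x) ≤ 2 ^ K * (τ e).w
        then 2 ^ K else 0 := by
    intro t e he
    rw [hslot_iff] at he
    rw [hσs, step_finalInstr, hlabt, htcolt, if_pos he]
    simp only [hwt]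
  have hbefore : ∀ t e, slot e = 0 ∨ t < slot e → (σ t e).x = (τ e).x := by
    intro t
    induction t with
    | zero => intro e _; rfl
    | succ t ih =>
      intro e he
      rw [hstay t e (by omega)]
      exact ih e (by omega)
  have hafter : ∀ t e, slot e ≠ 0 → slot e ≤ t → (σ t e).x = 0 ∨ (σ t e).x = 2 ^ K := by
    intro t
    induction t with
    | zero => intro e _ _; omega
    | succ t ih =>
      intro e he he'
      by_cases h : slot e = t + 1
      · rw [hgo t e h]
        split_ifs
        · exact Or.inr rfl
        · exact Or.inl rfl
      · rw [hstay t e h]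
        exact ih e he (by omega)
  have hslot0 : ∀ e, (τ e).lab = 0 ↔ slot e = 0 := by
    intro e
    simp only [hslot]
    split_ifs with h <;> simp [h]
  refine ⟨hfr T, fun e he => ?_, fun e => ?_, ?_⟩
  · exact (hbefore T e (Or.inl ((hslot0 e).1 he))).trans (h0 e he)
  · by_cases h : slot e = 0
    · left
      exact (hbefore T e (Or.inl h)).trans (h0 e ((hslot0 e).2 h))
    · exact hafter T e h (hslotT e)
  have hwr : ∀ e, (0 : ℝ) ≤ (τ e).w := fun e => by exact_mod_cast hw e
  have hmr : ∀ e f : N.Edge, (0 : ℝ) ≤ meet e f := fun e f => by exact_mod_cast meet_nonneg e f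
  set q : N.Edge → N.Edge → ℝ := fun e f => ((τ e).w + (τ f).w) * meet e f with hq
  have hxK : ∀ e, (0 : ℝ) ≤ (τ e).x ∧ ((τ e).x : ℝ) ≤ 2 ^ K := fun e =>
    ⟨by exact_mod_cast hx e, by exact_mod_cast hxle e⟩
  have hsweep := greedy_sweep q (fun e f => by simp only [hq, meet_comm e f]; ring)
    (fun e f => mul_nonneg (add_nonneg (hwr e) (hwr f)) (hmr e f))
    (fun e => 2 ^ K * (τ e).w) (fun e => 2 ^ K + (τ e).x) slot
    (fun t e => ((σ t e).x : ℝ))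
    (by
      intro t e he
      simp only [hstay t e he])
    (by
      intro t e he
      have hsum : ∑ f, q e f * ((σ t f).x : ℝ) = ((∑ f, meet e f *
          (((τ e).w + (τ f).w) * (σ t f).x) : ℤ) : ℝ) := by
        push_cast
        refine Finset.sum_congr rfl fun f _ => ?_
        simp only [hq]
        ring
      have hx2 := hxK e
      simp only [hsum, hgo t e he]
      rw [hbefore t e (Or.inr (by omega))]
      generalize (∑ f, meet e f * (((τ e).w + (τ f).w) * (σ t f).x)) = S
      split_ifs with hS
      · have : (S : ℝ) ≤ 2 ^ K * (τ e).w := by exact_mod_cast hS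
        refine mul_nonneg ?_ (by linarith)
        push_cast
        linarith
      · have : (2 ^ K * (τ e).w : ℝ) < S := by exact_mod_cast not_le.1 hS
        refine mul_nonneg_of_nonpos_of_nonpos ?_ (by linarith)
        push_cast
        linarith)
    (by
      intro t e he
      have hx2 := hxK e
      rw [hbefore t e (Or.inr (by omega))]
      rcases hafter (t + 1) e (by omega) (by omega) with h | h <;> rw [h, abs_le] <;>
        push_cast <;> constructor <;> linarith [show (0 : ℝ) < 2 ^ K by positivity]) T
  have hpot : ∀ t, ∑ e, 2 ^ K * ((τ e).w : ℝ) * ((σ t e).x : ℝ) -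
      1 / 2 * ∑ e, ∑ f, q e f * ((σ t e).x : ℝ) * ((σ t f).x : ℝ) =
      potential K 1 1 (σ t) := by
    intro t
    have : ∑ e, ∑ f, q e f * ((σ t e).x : ℝ) * ((σ t f).x : ℝ) = 2 * totalConflict (σ t) := by
      rw [two_mul_totalConflict]
      refine Finset.sum_congr rfl fun e _ => ?_
      refine Finset.sum_congr rfl fun f _ => ?_
      simp only [hq, hwt]
      ring
    rw [this, potential, totalValue, one_mul, Finset.mul_sum]
    have h2 : ∑ e, 2 ^ K * ((τ e).w : ℝ) * ((σ t e).x : ℝ) =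
        ∑ e, 2 ^ K * (((σ t e).w : ℝ) * ((σ t e).x : ℝ)) := by
      refine Finset.sum_congr rfl fun e _ => ?_
      rw [hwt]
      ring
    rw [h2]
    ring
  rw [hpot, hpot] at hsweep
  have hnone : ∑ e, ∑ f, (if slot e = slot f ∧ slot e ≠ 0 then
      q e f * (2 ^ K + (τ e).x : ℝ) * (2 ^ K + (τ f).x) else 0) = 0 := by
    refine Finset.sum_eq_zero fun e _ => Finset.sum_eq_zero fun f _ => ?_
    split_ifs with h
    · have hm : meet e f = 0 := by
        by_contra hm
        obtain ⟨hne, v, he, hf⟩ := exists_of_meet_ne_zero hm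
        have h1 : (τ e).lab ≠ 0 := fun h' => h.2 ((hslot0 e).1 h')
        have h2 : (τ f).lab ≠ 0 := fun h' => h.2 (h.1.trans ((hslot0 f).1 h'))
        have h3 := h.1
        simp only [hslot, h1, h2, if_false, add_left_inj, Nat.pair_eq_pair] at h3
        exact hp v e f he hf hne h3.1 h1 h3.2
      simp [hq, hm]
    · rfl
  rw [hnone, mul_zero, sub_zero] at hsweep
  exact hsweep

end loop

/-! ### One phase -/

/-- Every edge without an output learns the number `w` of adjacent such edges (itself counted
twice), and starts with about `1 / (16 * w)` in the fractional matching. -/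
def degreeInstr (L : ℕ) : Instr :=
  Instr.gather (fun _ s' => if s'.out = none then 1 else 0) fun s m =>
    if s.out = none then { s with w := m + 2, x := 2 ^ (L + 3) / (m + 2) }
    else { s with w := 0, x := 0 }

/-- The edges of positive value form a class, and their colours are going to be reduced. -/
def startInstr : Instr :=
  Instr.silent fun s => { s with cls := if 0 < s.x then 1 else 0, tcol := s.col }

/-- The selected edges without selected neighbours enter the matching. -/
def selectInstr : Instr :=
  Instr.gather (fun _ s' => s'.x) fun s m =>
    if s.out = none ∧ 0 < s.x ∧ m = 0 then { s with out := some true } else s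

/-- The edges adjacent to the matching leave the game. -/
def killInstr : Instr :=
  Instr.gather (fun _ s' => if s'.out = some true then 1 else 0) fun s m =>
    if s.out = none ∧ 0 < m then { s with out := some false } else s

/-- The number of binary digits of the permanent edge colours on networks of maximum degree at most
`2 ^ L`. This many steps also suffice to reduce them to colours of ten digits. -/
def colBits (L : ℕ) : ℕ := 4 * L + 22

/-- The part of a phase from the end of the rounding of small values to the integral solution; `l` is
the program for the colour reduction. -/
def finishProg (L : ℕ) (l : List Instr) : List Instr :=
  cleanInstr (L + 7) :: startInstr :: Instr.label 129 ::
    (l ++ (List.range finalSlots).map (finalInstr (L + 7)))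

/-- A phase: a matching is found such that a constant fraction of the remaining edges is in the
matching or adjacent to it. -/
noncomputable def phaseProg (L : ℕ) : List Instr :=
  degreeInstr L :: (scalesProg L ++ (finishProg L (List.replicate (colBits L) Instr.reduce) ++
    [selectInstr, killInstr]))

section phase

variable {N : Network}

open Network

/-- The number of edges at `v` which have no output. -/
def activeDegree (τ : N.Edge → EdgeState) (v : N.V) : ℤ :=
  ∑ f : N.Edge, if v ∈ f.1 then if (τ f).out = none then 1 else 0 else 0

/-- The number of edges which have no output. -/
def activeCount (τ : N.Edge → EdgeState) : ℕ :=
  (Finset.univ.filter fun e => (τ e).out = none).card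

lemma activeDegree_le (τ : N.Edge → EdgeState) (v : N.V) :
    activeDegree τ v ≤ N.graph.maxDegree := by
  unfold activeDegree
  rw [← sum_edge v fun f => if (τ f).out = none then (1 : ℤ) else 0]
  refine (Finset.sum_le_sum (g := fun _ => (1 : ℤ)) fun p _ => by split_ifs <;> simp).trans ?_
  simp [N.graph.degree_le_maxDegree v]

lemma activeDegree_pos (τ : N.Edge → EdgeState) {v : N.V} {e : N.Edge} (hv : v ∈ e.1)
    (he : (τ e).out = none) : 1 ≤ activeDegree τ v := by
  unfold activeDegree
  refine le_trans ?_ (Finset.single_le_sum (a := e)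
    (fun f _ => by split_ifs <;> simp) (Finset.mem_univ e))
  simp [hv, he]

lemma step_degreeInstr (L : ℕ) (τ : N.Edge → EdgeState) (e : N.Edge) :
    (degreeInstr L).step τ e = if (τ e).out = none then
      { τ e with
        w := ∑ v, if v ∈ e.1 then activeDegree τ v else 0
        x := 2 ^ (L + 3) / ∑ v, if v ∈ e.1 then activeDegree τ v else 0 }
      else { τ e with w := 0, x := 0 } := by
  rw [degreeInstr, Instr.step_gather]
  by_cases he : (τ e).out = none
  · have h : (∑ f, meet e f * if (τ f).out = none then 1 else 0) + 2 =
        ∑ v, if v ∈ e.1 then activeDegree τ v else 0 := by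
      have h1 : ∀ v, v ∈ e.1 → (∑ f : N.Edge, if v ∈ f.1 then if f = e then 0 else
          if (τ f).out = none then (1 : ℤ) else 0 else 0) = activeDegree τ v - 1 := by
        intro v hv
        have : ∀ f : N.Edge, (if v ∈ f.1 then if f = e then 0 else
            if (τ f).out = none then (1 : ℤ) else 0 else 0) =
            (if v ∈ f.1 then if (τ f).out = none then 1 else 0 else 0) -
              if f = e then 1 else 0 := by
          intro f
          by_cases hfe : f = e
          · subst hfe
            simp [hv, he]
          · simp [hfe]
        rw [Finset.sum_congr rfl fun f _ => this f, Finset.sum_sub_distrib, activeDegree]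
        simp
      obtain ⟨v, w, hvw, -⟩ := e.exists_eq
      rw [sum_meet, sum_mem hvw, sum_mem hvw, h1 v (by simp [hvw]), h1 w (by simp [hvw])]
      ring
    rw [if_pos he, if_pos he, h]
  · rw [if_neg he, if_neg he]

/-- The initial fractional matching: its potential is proportional to the number of edges without
output. -/
theorem degreeInstr_spec {L : ℕ} (hL : N.graph.maxDegree ≤ 2 ^ L) (τ : N.Edge → EdgeState) :
    (∀ e, 0 ≤ ((degreeInstr L).step τ e).w) ∧ (∀ e, 0 ≤ ((degreeInstr L).step τ e).x) ∧
    (∀ e, ((degreeInstr L).step τ e).x ≤ 2 ^ (L + 7)) ∧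
    (2 : ℝ) ^ (2 * L + 7) * activeCount τ ≤
      potential (L + 7) 2 (1 / 2) ((degreeInstr L).step τ) := by
  set τ' := (degreeInstr L).step τ with hτ'
  have hin : ∀ e, (τ e).out ≠ none → (τ' e).w = 0 ∧ (τ' e).x = 0 := by
    intro e he
    rw [hτ', step_degreeInstr, if_neg he]
    exact ⟨rfl, rfl⟩
  have hw : ∀ e, (τ e).out = none → (τ' e).w = ∑ v, if v ∈ e.1 then activeDegree τ v else 0 := by
    intro e he
    rw [hτ', step_degreeInstr, if_pos he]
  have hx : ∀ e, (τ e).out = none → (τ' e).x = 2 ^ (L + 3) / (τ' e).w := by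
    intro e he
    rw [hw e he, hτ', step_degreeInstr, if_pos he]
  have hLz : (N.graph.maxDegree : ℤ) ≤ 2 ^ L := by exact_mod_cast hL
  have hwb : ∀ e, (τ e).out = none → 2 ≤ (τ' e).w ∧ (τ' e).w ≤ 2 ^ (L + 1) := by
    intro e he
    obtain ⟨v, w, hvw, -⟩ := e.exists_eq
    rw [hw e he, sum_mem hvw]
    have h1 := activeDegree_pos τ (show v ∈ e.1 by simp [hvw]) he
    have h2 := activeDegree_pos τ (show w ∈ e.1 by simp [hvw]) he
    have h3 := activeDegree_le τ v
    have h4 := activeDegree_le τ w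
    rw [pow_succ]
    constructor <;> linarith
  have hxw : ∀ e, (τ e).out = none →
      2 ^ (L + 2) ≤ (τ' e).w * (τ' e).x ∧ (τ' e).w * (τ' e).x ≤ 2 ^ (L + 3) := by
    intro e he
    obtain ⟨h1, h2⟩ := hwb e he
    rw [hx e he]
    have h3 := Int.mul_ediv_add_emod (2 ^ (L + 3)) (τ' e).w
    have h4 := Int.emod_nonneg (2 ^ (L + 3)) (show (τ' e).w ≠ 0 by omega)
    have h5 := Int.emod_lt_of_pos (2 ^ (L + 3)) (show 0 < (τ' e).w by omega)
    have h6 : (2 : ℤ) ^ (L + 3) = 8 * 2 ^ L := by ring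
    have h7 : (2 : ℤ) ^ (L + 2) = 4 * 2 ^ L := by ring
    have h8 : (2 : ℤ) ^ (L + 1) = 2 * 2 ^ L := by ring
    have h9 : (0 : ℤ) < 2 ^ L := by positivity
    constructor <;> linarith
  have hw0 : ∀ e, 0 ≤ (τ' e).w := by
    intro e
    by_cases he : (τ e).out = none
    · linarith [(hwb e he).1]
    · exact (hin e he).1.ge
  have hx0 : ∀ e, 0 ≤ (τ' e).x := by
    intro e
    by_cases he : (τ e).out = none
    · rw [hx e he]
      exact Int.ediv_nonneg (by positivity) (hw0 e)
    · exact (hin e he).2.ge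
  have hx1 : ∀ e, (τ' e).x ≤ 2 ^ (L + 7) := by
    intro e
    by_cases he : (τ e).out = none
    · have h1 := (hwb e he).1
      have h2 := (hxw e he).2
      have h3 : (2 : ℤ) ^ (L + 3) ≤ 2 ^ (L + 7) := pow_le_pow_right₀ (by norm_num) (by omega)
      nlinarith [hx0 e]
    · rw [(hin e he).2]
      positivity
  refine ⟨hw0, hx0, hx1, ?_⟩
  -- the values at a node sum up to at most `1 / 16`
  have hnode : ∀ v, (∑ f : N.Edge, if v ∈ f.1 then (τ' f).x else 0) ≤ 2 ^ (L + 3) := by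
    intro v
    by_cases hv : ∃ e : N.Edge, v ∈ e.1 ∧ (τ e).out = none
    · obtain ⟨e, hve, he⟩ := hv
      have hd := activeDegree_pos τ hve he
      have h1 : activeDegree τ v * (∑ f : N.Edge, if v ∈ f.1 then (τ' f).x else 0) ≤
          activeDegree τ v * 2 ^ (L + 3) := by
        rw [Finset.mul_sum]
        nth_rw 2 [activeDegree]
        rw [Finset.sum_mul]
        refine Finset.sum_le_sum fun f _ => ?_
        split_ifs with h2 h3
        · have h4 := (hxw f h3).2
          have h5 : activeDegree τ v ≤ (τ' f).w := by
            obtain ⟨u, hu⟩ := h2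
            have h6 := activeDegree_pos τ (show u ∈ f.1 by simp [hu]) h3
            rw [hw f h3, sum_mem hu]
            linarith
          have := mul_le_mul_of_nonneg_right h5 (hx0 f)
          linarith
        · rw [(hin f h3).2]
          simp
        · simp
      exact le_of_mul_le_mul_left h1 (by linarith)
    · push Not at hv
      rw [Finset.sum_eq_zero]
      · positivity
      · intro f _
        split_ifs with h
        · exact (hin f (hv f h)).2
        · rfl
  have hadj : ∀ e, ∑ f, meet e f * (τ' f).x ≤ 2 ^ (L + 4) := by
    intro e
    obtain ⟨v, w, hvw, -⟩ := e.exists_eq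
    rw [sum_meet, sum_mem hvw]
    have h1 : ∀ u, (∑ f : N.Edge, if u ∈ f.1 then if f = e then 0 else (τ' f).x else 0) ≤
        2 ^ (L + 3) := fun u => (Finset.sum_le_sum fun f _ => by
          split_ifs
          · exact hx0 f
          · rfl
          · rfl).trans (hnode u)
    have h2 := h1 v
    have h3 := h1 w
    have : (2 : ℤ) ^ (L + 4) = 2 ^ (L + 3) + 2 ^ (L + 3) := by ring
    linarith
  have hC : totalConflict τ' ≤ 2 ^ (L + 4) * totalValue τ' := by
    rw [totalConflict, totalValue, Finset.mul_sum]
    refine Finset.sum_le_sum fun e _ => ?_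
    have h1 : ∑ f, (meet e f : ℝ) * (τ' e).x * (τ' f).x =
        (τ' e).x * ((∑ f, meet e f * (τ' f).x : ℤ) : ℝ) := by
      push_cast
      rw [Finset.mul_sum]
      exact Finset.sum_congr rfl fun f _ => by ring
    have h2 : ((∑ f, meet e f * (τ' f).x : ℤ) : ℝ) ≤ 2 ^ (L + 4) := by exact_mod_cast hadj e
    have h3 : (0 : ℝ) ≤ (τ' e).w * (τ' e).x := by exact_mod_cast mul_nonneg (hw0 e) (hx0 e)
    rw [h1]
    have := mul_le_mul_of_nonneg_left h2 h3
    linarith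
  have hU : (2 : ℝ) ^ (L + 2) * activeCount τ ≤ totalValue τ' := by
    rw [totalValue, activeCount, Finset.card_filter]
    push_cast
    rw [Finset.mul_sum]
    refine Finset.sum_le_sum fun e _ => ?_
    split_ifs with he
    · rw [mul_one]
      exact_mod_cast (hxw e he).1
    · simp [(hin e he).1]
  rw [potential]
  have e1 : (2 : ℝ) ^ (L + 7) = 128 * 2 ^ L := by ring
  have e2 : (2 : ℝ) ^ (L + 4) = 16 * 2 ^ L := by ring
  have e3 : (2 : ℝ) ^ (2 * L + 7) = (32 * 2 ^ L) * 2 ^ (L + 2) := by ring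
  have h1 := mul_le_mul_of_nonneg_left hU (show (0 : ℝ) ≤ 32 * 2 ^ L by positivity)
  rw [e1, e3]
  rw [e2] at hC
  linarith

lemma step_startInstr (τ : N.Edge → EdgeState) (e : N.Edge) : startInstr.step τ e =
    { τ e with cls := if 0 < (τ e).x then 1 else 0, tcol := (τ e).col } := by
  rw [startInstr, Instr.step_silent]

/-- The edges at a node whose value is at least `2 ^ (-7)` are few if their total value is
bounded. -/
lemma card_le_of_clean {L : ℕ} (τ : N.Edge → EdgeState)
    (hx : ∀ e, (τ e).x = 0 ∨ 2 ^ L ≤ (τ e).x)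
    (hs : ∀ e, (τ e).x ≠ 0 → ∑ f, meet e f * (τ f).x ≤ 2 ^ (L + 7)) (v : N.V) :
    (Finset.univ.filter fun e : N.Edge => v ∈ e.1 ∧ 0 < (τ e).x).card ≤ 129 := by
  rcases Finset.eq_empty_or_nonempty
    (Finset.univ.filter fun e : N.Edge => v ∈ e.1 ∧ 0 < (τ e).x) with h | ⟨e, he⟩
  · simp [h]
  · have hcard := Finset.card_erase_add_one he
    simp only [Finset.mem_filter, Finset.mem_univ, true_and] at he
    have hx0 : ∀ f, 0 ≤ (τ f).x := fun f => by
      rcases hx f with h | h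
      · exact h.ge
      · exact le_trans (by positivity) h
    set S := (Finset.univ.filter fun e : N.Edge => v ∈ e.1 ∧ 0 < (τ e).x).erase e with hS
    have h1 : (S.card : ℤ) * 2 ^ L ≤ ∑ f, meet e f * (τ f).x := by
      calc (S.card : ℤ) * 2 ^ L = ∑ f ∈ S, (2 : ℤ) ^ L := by rw [Finset.sum_const, nsmul_eq_mul]
        _ ≤ ∑ f ∈ S, meet e f * (τ f).x := by
          refine Finset.sum_le_sum fun f hf => ?_
          simp only [hS, Finset.mem_erase, Finset.mem_filter, Finset.mem_univ, true_and] at hf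
          have h2 := meet_pos (Ne.symm hf.1) he.1 hf.2.1
          have h3 : (2 : ℤ) ^ L ≤ (τ f).x := by
            rcases hx f with h | h
            · omega
            · exact h
          nlinarith [hx0 f]
        _ ≤ _ := Finset.sum_le_sum_of_subset_of_nonneg (Finset.subset_univ _)
          fun f _ _ => mul_nonneg (meet_nonneg e f) (hx0 f)
    have h2 := h1.trans (hs e he.2.ne')
    have h3 : (S.card : ℤ) ≤ 128 := by
      have h4 : (2 : ℤ) ^ (L + 7) = 128 * 2 ^ L := by ring
      rw [h4] at h2
      exact le_of_mul_le_mul_right h2 (by positivity)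
    omega

/-- The integral solution is as good as the fractional one, up to the losses of the potential
function. -/
theorem finishProg_spec {L : ℕ} (τ : N.Edge → EdgeState) (hw : ∀ e, 0 ≤ (τ e).w)
    (hx : ∀ e, (τ e).x = 0 ∨ 2 ^ L ≤ (τ e).x) (hxle : ∀ e, (τ e).x ≤ 2 ^ (L + 7))
    (hcol : ∀ v (e f : N.Edge), v ∈ e.1 → v ∈ f.1 → e ≠ f → (τ e).col ≠ (τ f).col)
    (hbits : ∀ e, (τ e).col < 2 ^ colBits L) :
    ∃ τ' : N.Edge → EdgeState,
    run N (finishProg L (List.replicate (colBits L) Instr.reduce)) τ = τ' ∧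
    (∀ e, (τ' e).out = (τ e).out ∧ (τ' e).col = (τ e).col ∧ (τ' e).w = (τ e).w) ∧
    (∀ e, (τ' e).x = 0 ∨ (τ' e).x = 2 ^ (L + 7)) ∧
    (∀ e, (τ e).x = 0 → (τ' e).x = 0) ∧
    potential (L + 7) 1 1 τ ≤ potential (L + 7) 1 1 τ' := by
  have hx0 : ∀ f, 0 ≤ (τ f).x := fun f => by
    rcases hx f with h | h
    · exact h.ge
    · exact le_trans (by positivity) h
  obtain ⟨c1, c2, c3⟩ := cleanInstr_spec (L + 7) τ hw hx0
  have c4 : ∀ e, (cleanInstr (L + 7)).step τ e =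
      { τ e with x := ((cleanInstr (L + 7)).step τ e).x } := by
    intro e
    rw [step_cleanInstr]
    split_ifs <;> rfl
  generalize hτ₁ : (cleanInstr (L + 7)).step τ = τ₁ at c1 c2 c3 c4
  have hx1 : ∀ e, (τ₁ e).x = 0 ∨ 2 ^ L ≤ (τ₁ e).x := fun e => by
    rcases c1 e with h | h
    · exact Or.inl h
    · rw [h]
      exact hx e
  have hcard := card_le_of_clean τ₁ hx1 c2
  have s1 := step_startInstr τ₁
  generalize hτ₂ : startInstr.step τ₁ = τ₂ at s1
  have hcls : ∀ e, (τ₂ e).cls ≠ 0 ↔ 0 < (τ₁ e).x := by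
    intro e
    rw [s1]
    dsimp only
    split_ifs with h <;> simp [h]
  have hcls1 : ∀ e, (τ₂ e).cls ≤ 1 := by
    intro e
    rw [s1]
    dsimp only
    split_ifs <;> simp
  have hsp : Instr.SparseLabels ((Instr.label 129).step τ₂) := by
    refine Instr.label_sparse τ₂ (by norm_num) ?_ ?_
    · intro v k hk
      refine le_trans (Finset.card_le_card fun e he => ?_) (hcard v)
      simp only [Finset.mem_filter, Finset.mem_univ, true_and] at he ⊢
      exact ⟨he.1, (hcls e).1 (by omega)⟩
    · intro e f he hf
      have := hcls1 e
      have := hcls1 f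
      omega
  have hl0 := Instr.lab_step_label (m := 129) τ₂
  have hlle := Instr.lab_step_label_le (m := 129) τ₂ (by norm_num)
  have hleq := Instr.step_label_eq (m := 129) τ₂
  generalize hτ₃ : (Instr.label 129).step τ₂ = τ₃ at hsp hl0 hlle hleq
  have ht3 : ∀ e, (τ₃ e).tcol = (τ e).col := fun e => by rw [hleq, s1, c4]
  have hp3 : Instr.ProperWithinLabels τ₃ := by
    intro v e f he hf hne _ _
    rw [ht3, ht3]
    exact hcol v e f he hf hne
  obtain ⟨r1, r2, r3⟩ := replicate_reduce_spec τ₃ hsp hp3 (k := colBits L)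
    (by unfold colBits; omega) (fun e => by rw [ht3]; exact hbits e) (colBits L)
  generalize hτ₄ : run N (List.replicate (colBits L) Instr.reduce) τ₃ = τ₄ at r1 r2 r3
  have e4 : ∀ e, (τ₄ e).out = (τ e).out ∧ (τ₄ e).col = (τ e).col ∧ (τ₄ e).w = (τ e).w := by
    intro e
    rw [r3, hleq, s1, c4]
    exact ⟨rfl, rfl, rfl⟩
  have e5 : ∀ e, (τ₄ e).x = (τ₁ e).x ∧ (τ₄ e).lab = (τ₃ e).lab := by
    intro e
    rw [r3]
    refine ⟨?_, rfl⟩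
    rw [hleq, s1]
  have hlx : ∀ e, (τ₄ e).lab = 0 → (τ₄ e).x = 0 := by
    intro e he
    rw [(e5 e).2, hl0] at he
    rw [(e5 e).1]
    have h1 : ¬ 0 < (τ₁ e).x := fun h => (hcls e).2 h he
    rcases hx1 e with h | h
    · exact h
    · exact absurd (lt_of_lt_of_le (by positivity) h) h1
  have hxx : ∀ e, (τ₄ e).x = 0 ∨ (τ₄ e).x = (τ e).x := fun e => by rw [(e5 e).1]; exact c1 e
  obtain ⟨f1, f2, f3, f4⟩ := finalSweep_spec (L + 7) τ₄ (fun e => by rw [(e4 e).2.2]; exact hw e)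
    (fun e => by
      rcases hxx e with h | h <;> rw [h]
      exact hx0 e)
    (fun e => by
      rcases hxx e with h | h <;> rw [h]
      · positivity
      · exact hxle e) hlx r1 (fun e => by rw [(e5 e).2]; exact hlle e)
    (fun e => lt_of_lt_of_le (r2 e) (Nat.pow_le_pow_right (by norm_num)
      (reducedBits_iterate_le (by omega)))) (T := finalSlots) (Nat.le_refl _)
  generalize hτ₅ : run N ((List.range finalSlots).map (finalInstr (L + 7))) τ₄ = τ₅
    at f1 f2 f3 f4
  refine ⟨τ₅, ?_, ?_, f3, ?_, ?_⟩
  · rw [finishProg, run_cons, run_cons, run_cons, run_append, hτ₁, hτ₂, hτ₃, hτ₄, hτ₅]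
  · intro e
    rw [f1]
    exact e4 e
  · intro e he
    refine f2 e ?_
    rw [(e5 e).2, hl0]
    by_contra h
    have h1 := (hcls e).1 h
    rcases c1 e with h2 | h2 <;> omega
  · refine c3.trans (le_trans (le_of_eq ?_) f4)
    have h1 : ∀ e, (τ₄ e).w = (τ₁ e).w := fun e => by rw [(e4 e).2.2, c4]
    have h2 : ∀ e, (τ₄ e).x = (τ₁ e).x := fun e => (e5 e).1
    simp only [potential, totalValue, totalConflict, h1, h2]

end phase

section phaseEnd

variable {N : Network}

open Network

/-- What holds between two phases: the permanent colours form a proper edge colouring, the edges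
with output `true` form a matching, and an edge has an output if it is adjacent to one of these,
and has the output `false` only then. -/
structure PhaseInv (L : ℕ) (τ : N.Edge → EdgeState) : Prop where
  col_ne : ∀ v (e f : N.Edge), v ∈ e.1 → v ∈ f.1 → e ≠ f → (τ e).col ≠ (τ f).col
  col_lt : ∀ e, (τ e).col < 2 ^ colBits L
  matched : ∀ v (e f : N.Edge), v ∈ e.1 → v ∈ f.1 → (τ e).out = some true →
    (τ f).out = some true → e = f
  dead : ∀ e, (τ e).out = some false → ∃ v, ∃ f : N.Edge, v ∈ e.1 ∧ v ∈ f.1 ∧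
    (τ f).out = some true
  active : ∀ v (e f : N.Edge), v ∈ e.1 → v ∈ f.1 → (τ e).out = none → (τ f).out ≠ some true

lemma step_selectInstr (τ : N.Edge → EdgeState) (e : N.Edge) : selectInstr.step τ e =
    if (τ e).out = none ∧ 0 < (τ e).x ∧ ∑ f, meet e f * (τ f).x = 0 then
      { τ e with out := some true } else τ e := by
  rw [selectInstr, Instr.step_gather]

lemma step_killInstr (τ : N.Edge → EdgeState) (e : N.Edge) : killInstr.step τ e =
    if (τ e).out = none ∧ 0 < ∑ f, meet e f * (if (τ f).out = some true then 1 else 0) then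
      { τ e with out := some false } else τ e := by
  rw [killInstr, Instr.step_gather]

/-- The end of a phase. The selected edges form a matching, and their weights bound the number
of edges removed by them: an edge is counted at most once at each of its endpoints. -/
theorem select_kill_spec {L : ℕ} (σ τ : N.Edge → EdgeState) (h : PhaseInv L σ)
    (hout : ∀ e, (τ e).out = (σ e).out) (hcol : ∀ e, (τ e).col = (σ e).col)
    (hw : ∀ e, (σ e).out = none → (τ e).w = ∑ v, if v ∈ e.1 then activeDegree σ v else 0)
    (hx : ∀ e, (τ e).x = 0 ∨ (τ e).x = 2 ^ (L + 7))
    (hin : ∀ e, (σ e).out ≠ none → (τ e).x = 0)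
    (hpot : (2 : ℝ) ^ (2 * L + 7) * activeCount σ ≤ potential (L + 7) 1 1 τ) :
    PhaseInv L (killInstr.step (selectInstr.step τ)) ∧
    256 * activeCount (killInstr.step (selectInstr.step τ)) ≤ 255 * activeCount σ := by
  classical
  set sel : N.Edge → Prop := fun e => 0 < (τ e).x ∧ ∑ f, meet e f * (τ f).x = 0 with hsel
  have hx0 : ∀ e, 0 ≤ (τ e).x := fun e => by
    rcases hx e with h | h <;> rw [h]
    positivity
  have hsela : ∀ e, sel e → (σ e).out = none := by
    intro e he
    by_contra hne
    have := hin e hne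
    have := he.1
    omega
  -- no value next to a selected edge
  have hselx : ∀ v (e f : N.Edge), sel e → v ∈ e.1 → v ∈ f.1 → e ≠ f → (τ f).x = 0 := by
    intro v e f he hve hvf hne
    have h1 := (Finset.sum_eq_zero_iff_of_nonneg
      fun f _ => mul_nonneg (meet_nonneg e f) (hx0 f)).1 he.2 f (Finset.mem_univ f)
    have h2 := meet_pos hne hve hvf
    rcases mul_eq_zero.1 h1 with h3 | h3
    · omega
    · exact h3
  have hselu : ∀ v (e f : N.Edge), sel e → sel f → v ∈ e.1 → v ∈ f.1 → e = f := by
    intro v e f he hf hve hvf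
    by_contra hne
    have := hselx v e f he hve hvf hne
    have := hf.1
    omega
  set τ₁ := selectInstr.step τ with hτ₁
  have h1 : ∀ e, (τ₁ e).out = if sel e then some true else (σ e).out := by
    intro e
    rw [hτ₁, step_selectInstr]
    by_cases he : sel e
    · rw [if_pos ⟨(hout e).trans (hsela e he), he⟩, if_pos he]
    · rw [if_neg fun h' => he h'.2, if_neg he, hout]
  have h1t : ∀ e, (τ₁ e).out = some true ↔ sel e ∨ (σ e).out = some true := by
    intro e
    rw [h1]
    split_ifs with he <;> simp [he]
  have h1n : ∀ e, (τ₁ e).out = none ↔ ¬ sel e ∧ (σ e).out = none := by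
    intro e
    rw [h1]
    split_ifs with he <;> simp [he]
  set τ₂ := killInstr.step τ₁ with hτ₂
  have hpos : ∀ e, (τ₁ e).out = none →
      (0 < (∑ f, meet e f * (if (τ₁ f).out = some true then 1 else 0)) ↔
      ∃ v, ∃ f : N.Edge, v ∈ e.1 ∧ v ∈ f.1 ∧ (τ₁ f).out = some true) := by
    intro e he
    have hnn : ∀ f, 0 ≤ meet e f * (if (τ₁ f).out = some true then 1 else 0) :=
      fun f => mul_nonneg (meet_nonneg e f) (by split_ifs <;> simp)
    constructor
    · intro hs
      by_contra! hno
      refine hs.ne' (Finset.sum_eq_zero fun f _ => ?_)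
      split_ifs with hf
      · rw [mul_one]
        by_contra hm
        obtain ⟨-, v, hve, hvf⟩ := exists_of_meet_ne_zero hm
        exact hno v f hve hvf hf
      · simp
    · rintro ⟨v, f, hve, hvf, hf⟩
      have hne : e ≠ f := by
        rintro rfl
        rw [he] at hf
        cases hf
      refine lt_of_lt_of_le ?_ (Finset.single_le_sum (fun f _ => hnn f) (Finset.mem_univ f))
      rw [if_pos hf, mul_one]
      have := meet_pos hne hve hvf
      omega
  have h2 : ∀ e, (τ₂ e).out = if (τ₁ e).out = none ∧
      ∃ v, ∃ f : N.Edge, v ∈ e.1 ∧ v ∈ f.1 ∧ (τ₁ f).out = some true then some false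
      else (τ₁ e).out := by
    intro e
    rw [hτ₂, step_killInstr]
    by_cases he : (τ₁ e).out = none
    · simp only [he, true_and, hpos e he]
      split_ifs
      · rfl
      · exact he
    · rw [if_neg fun h' => he h'.1, if_neg fun h' => he h'.1]
  have h2t : ∀ e, (τ₂ e).out = some true ↔ (τ₁ e).out = some true := by
    intro e
    rw [h2]
    split_ifs with he
    · simp [he.1]
    · rfl
  have hc : ∀ e, (τ₂ e).col = (σ e).col := by
    intro e
    rw [← hcol, hτ₂, step_killInstr]
    have : (τ₁ e).col = (τ e).col := by
      rw [hτ₁, step_selectInstr]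
      split_ifs <;> rfl
    split_ifs <;> exact this
  -- edges adjacent to a selected edge do not survive
  have hsurv : ∀ v (e f : N.Edge), sel e → v ∈ e.1 → v ∈ f.1 → (τ₂ f).out ≠ none := by
    intro v e f he hve hvf
    rw [h2]
    split_ifs with hf
    · simp
    · intro hn
      exact hf ⟨hn, v, e, hvf, hve, (h1t e).2 (Or.inl he)⟩
  constructor
  · refine ⟨?_, ?_, ?_, ?_, ?_⟩
    · intro v e f he hf hne
      rw [hc, hc]
      exact h.col_ne v e f he hf hne
    · intro e
      rw [hc]
      exact h.col_lt e
    · intro v e f he hf hte htf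
      rw [h2t, h1t] at hte htf
      rcases hte with hte | hte <;> rcases htf with htf | htf
      · exact hselu v e f hte htf he hf
      · exact absurd htf (h.active v e f he hf (hsela e hte))
      · exact absurd hte (h.active v f e hf he (hsela f htf))
      · exact h.matched v e f he hf hte htf
    · intro e he
      rw [h2] at he
      split_ifs at he with hk
      · obtain ⟨v, f, hve, hvf, hf⟩ := hk.2
        exact ⟨v, f, hve, hvf, (h2t f).2 hf⟩
      · rw [h1] at he
        split_ifs at he
        · cases he
        obtain ⟨v, f, hve, hvf, hf⟩ := h.dead e he
        exact ⟨v, f, hve, hvf, (h2t f).2 ((h1t f).2 (Or.inr hf))⟩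
    · intro v e f hve hvf he hf
      rw [h2] at he
      split_ifs at he with hk
      exact hk ⟨he, v, f, hve, hvf, (h2t f).1 hf⟩
  · -- the selected edges carry the whole potential
    have hsum : potential (L + 7) 1 1 τ ≤
        ((∑ e, if sel e then (τ e).w * (2 ^ (L + 7) * 2 ^ (L + 7)) else 0 : ℤ) : ℝ) := by
      rw [potential_one_one, ← Int.cast_sum]
      refine Int.cast_le.2 (Finset.sum_le_sum fun e _ => ?_)
      have hS0 : 0 ≤ ∑ f, meet e f * (τ f).x :=
        Finset.sum_nonneg fun f _ => mul_nonneg (meet_nonneg e f) (hx0 f)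
      by_cases he : sel e
      · have hxe : (τ e).x = 2 ^ (L + 7) := by
          rcases hx e with h' | h'
          · have := he.1
            omega
          · exact h'
        rw [if_pos he, he.2, hxe]
        exact le_of_eq (by ring)
      · rw [if_neg he]
        rcases hx e with h' | h'
        · rw [h']
          simp
        · have hxe : 0 < (τ e).x := by
            rw [h']
            positivity
          have hwe : 0 ≤ (τ e).w := by
            have ha : (σ e).out = none := by
              by_contra hne
              have := hin e hne
              omega
            rw [hw e ha]
            refine Finset.sum_nonneg fun v _ => ?_
            split_ifs
            · exact Finset.sum_nonneg fun f _ => by split_ifs <;> simp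
            · rfl
          have hS : 2 ^ (L + 7) ≤ ∑ f, meet e f * (τ f).x := by
            have hne : ∑ f, meet e f * (τ f).x ≠ 0 := fun h0 => he ⟨hxe, h0⟩
            obtain ⟨f, -, hf⟩ := Finset.exists_ne_zero_of_sum_ne_zero hne
            refine le_trans ?_ (Finset.single_le_sum
              (fun f _ => mul_nonneg (meet_nonneg e f) (hx0 f)) (Finset.mem_univ f))
            have hm : 1 ≤ meet e f := by
              have h3 := meet_nonneg e f
              have h4 : meet e f ≠ 0 := left_ne_zero_of_mul hf
              omega
            have hxf : (τ f).x = 2 ^ (L + 7) := (hx f).resolve_left (right_ne_zero_of_mul hf)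
            rw [hxf]
            exact le_mul_of_one_le_left (by positivity) hm
          exact mul_nonpos_of_nonneg_of_nonpos (mul_nonneg hwe hxe.le) (by linarith)
    have hcount : (∑ e, if sel e then (τ e).w else 0) ≤
        2 * ((activeCount σ : ℤ) - activeCount τ₂) := by
      have e1 : ∀ e, (if sel e then (τ e).w else 0) =
          ∑ f, ∑ v, if (σ f).out = none then
            if v ∈ f.1 then if sel e ∧ v ∈ e.1 then (1 : ℤ) else 0 else 0 else 0 := by
        intro e
        split_ifs with he
        · rw [hw e (hsela e he), Finset.sum_comm]
          refine Finset.sum_congr rfl fun v _ => ?_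
          by_cases hv : v ∈ e.1
          · rw [if_pos hv, activeDegree]
            refine Finset.sum_congr rfl fun f _ => ?_
            rw [if_pos (⟨he, hv⟩ : sel e ∧ v ∈ e.1)]
            split_ifs <;> rfl
          · simp [hv]
        · simp [he]
      have e2 : ∀ f, (∑ e, ∑ v, if (σ f).out = none then
            if v ∈ f.1 then if sel e ∧ v ∈ e.1 then (1 : ℤ) else 0 else 0 else 0) ≤
          2 * ((if (σ f).out = none then 1 else 0) - if (τ₂ f).out = none then 1 else 0) := by
        intro f
        by_cases hf : (σ f).out = none
        · simp only [hf, if_true]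
          obtain ⟨v, w, hvw, -⟩ := f.exists_eq
          rw [Finset.sum_comm]
          have hv1 : ∀ v, v ∈ f.1 → (∑ e : N.Edge, if sel e ∧ v ∈ e.1 then (1 : ℤ) else 0) ≤
              1 - if (τ₂ f).out = none then 1 else 0 := by
            intro v hv
            rw [Finset.sum_boole]
            split_ifs with hk
            · simp only [sub_self]
              rw [Finset.filter_eq_empty_iff.2]
              · simp
              · intro e _ he
                exact hsurv v e f he.1 he.2 hv hk
            · simp only [sub_zero]
              have : (Finset.univ.filter fun e : N.Edge => sel e ∧ v ∈ e.1).card ≤ 1 := by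
                refine Finset.card_le_one.2 fun a ha b hb => ?_
                simp only [Finset.mem_filter, Finset.mem_univ, true_and] at ha hb
                exact hselu v a b ha.1 hb.1 ha.2 hb.2
              exact_mod_cast this
          have e3 : ∀ v : N.V, (∑ e : N.Edge, if v ∈ f.1 then
              if sel e ∧ v ∈ e.1 then (1 : ℤ) else 0 else 0) =
              if v ∈ f.1 then ∑ e : N.Edge, if sel e ∧ v ∈ e.1 then (1 : ℤ) else 0 else 0 := by
            intro v
            split_ifs <;> simp
          rw [Finset.sum_congr rfl fun v _ => e3 v, sum_mem hvw, two_mul]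
          exact add_le_add (hv1 v (by simp [hvw])) (hv1 w (by simp [hvw]))
        · have hf2 : (τ₂ f).out ≠ none := by
            rw [h2]
            split_ifs with hk
            · simp
            · rw [ne_eq, h1n]
              exact fun h' => hf h'.2
          simp [hf, hf2]
      rw [Finset.sum_congr rfl fun e _ => e1 e, Finset.sum_comm]
      refine (Finset.sum_le_sum fun f _ => e2 f).trans (le_of_eq ?_)
      rw [← Finset.mul_sum, Finset.sum_sub_distrib, Finset.sum_boole, Finset.sum_boole]
      rfl
    have e4 : (∑ e, if sel e then (τ e).w * (2 ^ (L + 7) * 2 ^ (L + 7)) else 0) =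
        (2 ^ (L + 7) * 2 ^ (L + 7)) * ∑ e, if sel e then (τ e).w else 0 := by
      rw [Finset.mul_sum]
      refine Finset.sum_congr rfl fun e _ => ?_
      split_ifs <;> ring
    rw [e4] at hsum
    have h5 := hpot.trans hsum
    have h6 : (2 : ℤ) ^ (2 * L + 7) * activeCount σ ≤
        (2 ^ (L + 7) * 2 ^ (L + 7)) * ∑ e, if sel e then (τ e).w else 0 := by exact_mod_cast h5
    have h7 : (2 : ℤ) ^ (L + 7) * 2 ^ (L + 7) = 2 ^ (2 * L + 7) * 128 := by ring
    rw [h7, mul_assoc] at h6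
    have h8 := le_of_mul_le_mul_left h6 (by positivity)
    omega

/-- A phase removes a constant fraction of the remaining edges. -/
theorem phaseProg_spec {L : ℕ} (hL0 : 0 < L) (hL : N.graph.maxDegree ≤ 2 ^ L)
    (σ : N.Edge → EdgeState) (h : PhaseInv L σ) :
    PhaseInv L (run N (phaseProg L) σ) ∧
    256 * activeCount (run N (phaseProg L) σ) ≤ 255 * activeCount σ := by
  obtain ⟨d1, d2, d3, d4⟩ := degreeInstr_spec hL σ
  have d5 := step_degreeInstr L σ
  have hrun : run N (phaseProg L) σ = killInstr.step (selectInstr.step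
      (run N (finishProg L (List.replicate (colBits L) Instr.reduce))
        (run N (scalesProg L) ((degreeInstr L).step σ)))) := by
    rw [phaseProg, run_cons, run_append, run_append]
    rfl
  rw [hrun]
  generalize (degreeInstr L).step σ = τ₁ at d1 d2 d3 d4 d5
  obtain ⟨s1, s2, s3, s4, s5⟩ := scalesProg_spec hL0 τ₁ d1 d2
  generalize run N (scalesProg L) τ₁ = τ₂ at s1 s2 s3 s4 s5
  have d6 : ∀ e, (τ₁ e).out = (σ e).out ∧ (τ₁ e).col = (σ e).col := by
    intro e
    rw [d5]
    split_ifs <;> exact ⟨rfl, rfl⟩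
  obtain ⟨τ₃, f0, f1, f2, f3, f4⟩ := finishProg_spec τ₂
    (fun e => by rw [(s1 e).2.2]; exact d1 e) s2 (fun e => s4 e (d3 e))
    (fun v e f he hf hne => by
      rw [(s1 e).2.1, (s1 f).2.1, (d6 e).2, (d6 f).2]
      exact h.col_ne v e f he hf hne)
    (fun e => by
      rw [(s1 e).2.1, (d6 e).2]
      exact h.col_lt e)
  rw [f0]
  refine select_kill_spec σ τ₃ h (fun e => ?_) (fun e => ?_) (fun e he => ?_) f2
    (fun e he => ?_) (d4.trans (s5.trans f4))
  · rw [(f1 e).1, (s1 e).1, (d6 e).1]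
  · rw [(f1 e).2.1, (s1 e).2.1, (d6 e).2]
  · rw [(f1 e).2.2, (s1 e).2.2, d5, if_pos he]
  · refine f3 e (s3 e ?_)
    rw [d5, if_neg he]

end phaseEnd

/-! ### Preprocessing -/

/-- The preprocessing: a proper edge colouring whose number of colours is polynomial in the
maximum degree `D`. At most two edges at a node can have the same pair of port numbers, and
these have different identifiers, which are reduced in `T` steps. -/
noncomputable def preProg (D T : ℕ) : List Instr :=
  Instr.silent (fun s => { s with cls := 1 }) :: Instr.label D :: Instr.ids ::
    (List.replicate T Instr.reduce ++
      [Instr.silent fun s => { s with col := Nat.pair (s.lab % (D ^ 2 + 1)) (s.tcol % 1024) }])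

lemma pair_mod_lt {D L : ℕ} (hL : D ≤ 2 ^ L) (a b : ℕ) :
    Nat.pair (a % (D ^ 2 + 1)) (b % 1024) < 2 ^ colBits L := by
  refine (Nat.pair_lt_max_add_one_sq _ _).trans_le ?_
  have h1 : colBits L = (2 * L + 11) * 2 := by unfold colBits; ring
  rw [h1, pow_mul]
  refine Nat.pow_le_pow_left ?_ 2
  have h2 : a % (D ^ 2 + 1) ≤ D ^ 2 := Nat.lt_succ_iff.1 (Nat.mod_lt _ (by positivity))
  have h3 : b % 1024 < 1024 := Nat.mod_lt _ (by norm_num)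
  have h4 : D ^ 2 ≤ 2 ^ (2 * L) := by
    rw [mul_comm, pow_mul]
    exact Nat.pow_le_pow_left hL 2
  have h5 : 1 ≤ 2 ^ (2 * L) := Nat.one_le_two_pow
  have h6 : 2 ^ (2 * L + 11) = 2048 * 2 ^ (2 * L) := by ring
  omega

section pre

variable {N : Network}

open Network

/-- The preprocessing establishes the invariant of the phases. -/
theorem preProg_spec {L T k : ℕ} (hL : N.graph.maxDegree ≤ 2 ^ L)
    (hD : 0 < N.graph.maxDegree) (hk : 0 < k) (hid : ∀ v w, symPair (N.ident v) (N.ident w) < 2 ^ k)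
    (hT : reducedBits^[T] k ≤ 10) (τ : N.Edge → EdgeState) (hout : ∀ e, (τ e).out = none) :
    PhaseInv L (run N (preProg N.graph.maxDegree T) τ) := by
  set D := N.graph.maxDegree with hDdef
  set τ₁ : N.Edge → EdgeState :=
    (Instr.silent (fun s => { s with cls := 1 })).step τ with hτ₁
  have h1 : ∀ e, τ₁ e = { τ e with cls := 1 } := fun e => by rw [hτ₁, Instr.step_silent]
  have hsp : Instr.SparseLabels ((Instr.label D).step τ₁) := by
    refine Instr.label_sparse τ₁ hD ?_ ?_
    · intro v k _
      have h2 := Instr.card_edge_filter v fun e => (τ₁ e).cls = k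
      rw [h2]
      refine (Finset.card_le_univ _).trans ?_
      rw [Fintype.card_fin]
      exact N.graph.degree_le_maxDegree v
    · intro e f _ _
      rw [h1, h1]
  have hl0 := Instr.lab_step_label (m := D) τ₁
  have hlle := Instr.lab_step_label_le (m := D) τ₁ hD
  have hleq := Instr.step_label_eq (m := D) τ₁
  generalize hτ₂ : (Instr.label D).step τ₁ = τ₂ at hsp hl0 hlle hleq
  have hlne : ∀ e, (τ₂ e).lab ≠ 0 := fun e h => by
    rw [hl0, h1] at h
    cases h
  have h3 : ∀ (e : N.Edge) (v w : N.V), e.1 = s(v, w) → Instr.ids.step τ₂ e =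
      { τ₂ e with tcol := symPair (N.ident v) (N.ident w) } :=
    fun e v w h => Instr.step_ids τ₂ h
  generalize hτ₃ : Instr.ids.step τ₂ = τ₃ at h3
  have hlab3 : ∀ e, (τ₃ e).lab = (τ₂ e).lab ∧ (τ₃ e).out = none := by
    intro e
    obtain ⟨v, w, hvw, -⟩ := e.exists_eq
    rw [h3 e v w hvw]
    refine ⟨rfl, ?_⟩
    dsimp only
    rw [hleq, h1]
    exact hout e
  have hsp3 : Instr.SparseLabels τ₃ := by
    intro v e f g he hf hg hef heg hfg h4 h5
    rw [(hlab3 e).1, (hlab3 f).1] at h4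
    rw [(hlab3 e).1, (hlab3 g).1] at h5
    rw [(hlab3 e).1]
    exact hsp v e f g he hf hg hef heg hfg h4 h5
  have hp3 : Instr.ProperWithinLabels τ₃ := by
    intro v e f he hf hne _ _ hc
    obtain ⟨u, hu⟩ := he
    obtain ⟨w, hw⟩ := hf
    rw [h3 e v u hu, h3 f v w hw] at hc
    apply hne
    apply Subtype.ext
    rw [hu, hw]
    rcases symPair_eq (by positivity) (by positivity) (by positivity) (by positivity) hc
      with ⟨-, h4⟩ | ⟨h4, h5⟩
    · rw [N.ident_injective (Nat.cast_inj.1 h4)]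
    · rw [N.ident_injective (Nat.cast_inj.1 h5), ← N.ident_injective (Nat.cast_inj.1 h4)]
  obtain ⟨r1, r2, r3⟩ := replicate_reduce_spec τ₃ hsp3 hp3 hk (fun e => by
    obtain ⟨v, w, hvw, -⟩ := e.exists_eq
    rw [h3 e v w hvw]
    exact hid v w) T
  generalize hτ₄ : run N (List.replicate T Instr.reduce) τ₃ = τ₄ at r1 r2 r3
  have hrun : ∀ e, run N (preProg D T) τ e =
      { τ₄ e with col := Nat.pair ((τ₄ e).lab % (D ^ 2 + 1)) ((τ₄ e).tcol % 1024) } := by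
    intro e
    rw [preProg, run_cons, run_cons, run_cons, run_append, ← hτ₁, hτ₂, hτ₃, hτ₄, run_singleton,
      Instr.step_silent]
  have hlab4 : ∀ e, (τ₄ e).lab = (τ₂ e).lab ∧ (τ₄ e).out = none := by
    intro e
    rw [r3]
    exact hlab3 e
  have hout' : ∀ e, (run N (preProg D T) τ e).out = none := fun e => by
    rw [hrun]
    exact (hlab4 e).2
  refine ⟨?_, ?_, ?_, ?_, ?_⟩
  · intro v e f he hf hne hc
    rw [hrun, hrun] at hc
    obtain ⟨c1, c2⟩ := Nat.pair_eq_pair.1 hc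
    have hm : ∀ e, (τ₄ e).lab % (D ^ 2 + 1) = (τ₄ e).lab := fun e =>
      Nat.mod_eq_of_lt (Nat.lt_succ_of_le (by rw [(hlab4 e).1]; exact hlle e))
    have ht : ∀ e, (τ₄ e).tcol % 1024 = (τ₄ e).tcol := fun e =>
      Nat.mod_eq_of_lt ((r2 e).trans_le (Nat.pow_le_pow_right (by norm_num) hT))
    rw [hm, hm] at c1
    rw [ht, ht] at c2
    exact r1 v e f he hf hne c1 (by rw [(hlab4 e).1]; exact hlne e) c2
  · intro e
    rw [hrun]
    exact pair_mod_lt hL _ _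
  · intro v e f _ _ h4
    rw [hout'] at h4
    cases h4
  · intro e h4
    rw [hout'] at h4
    cases h4
  · intro v e f _ _ _ h4
    rw [hout'] at h4
    cases h4

end pre

/-! ### The iterated logarithm -/

lemma exists_iterate_logb_le (k : ℕ) : ∀ x : ℝ, x ≤ 2 ^ k → ∃ j ≤ k, (Real.logb 2)^[j] x ≤ 1 := by
  induction k with
  | zero => exact fun x hx => ⟨0, le_rfl, by simpa using hx⟩
  | succ k ih =>
    intro x hx
    rcases le_or_gt x 1 with h | h
    · exact ⟨0, Nat.zero_le _, h⟩
    · have h1 : Real.logb 2 x ≤ k + 1 := by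
        rw [Real.logb_le_iff_le_rpow (by norm_num) (by linarith)]
        exact_mod_cast hx
      have h2 : (k + 1 : ℝ) ≤ 2 ^ k := by exact_mod_cast Nat.lt_two_pow_self (n := k)
      obtain ⟨j, hj, hj'⟩ := ih _ (h1.trans h2)
      exact ⟨j + 1, by omega, by rwa [Function.iterate_succ_apply]⟩

lemma logStar_le_clog (n : ℕ) : logStar n ≤ Nat.clog 2 n := by
  obtain ⟨j, hj, hj'⟩ := exists_iterate_logb_le (Nat.clog 2 n) n
    (by exact_mod_cast Nat.le_pow_clog (by norm_num) n)
  exact (Nat.sInf_le hj').trans hj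

lemma iterate_logStar_le (n : ℕ) : (Real.logb 2)^[logStar n] (n : ℝ) ≤ 1 := by
  obtain ⟨j, -, hj'⟩ := exists_iterate_logb_le (Nat.clog 2 n) n
    (by exact_mod_cast Nat.le_pow_clog (by norm_num) n)
  exact Nat.sInf_mem (s := {k : ℕ | (Real.logb 2)^[k] (n : ℝ) ≤ 1}) ⟨j, hj'⟩

lemma clog_le_logb {n : ℕ} (hn : 1 ≤ n) : (Nat.clog 2 n : ℝ) ≤ Real.logb 2 n + 1 := by
  have h0 : 0 ≤ Real.logb 2 n := Real.logb_nonneg (by norm_num) (by exact_mod_cast hn)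
  have h := Real.natCeil_logb_natCast 2 n
  rw [← h]
  push_cast
  exact (Nat.ceil_lt_add_one h0).le

/-- The number of binary digits of the codes of pairs of identifiers. -/
def idBits (c n : ℕ) : ℕ := 2 * (c * Nat.clog 2 n) + 1

/-- The iterated colour reduction is as fast as the iterated logarithm, up to a constant number of
steps: the number of digits stays below a constant multiple of the iterated logarithm. -/
theorem exists_reducedBits_iterate_le (c : ℕ) :
    ∃ C, ∀ n, reducedBits^[logStar n + C] (idBits c n) ≤ 10 := by
  set j := 4 * c + 6 with hj
  have hj2 : 8 + 2 * j ≤ 2 ^ j := by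
    have : ∀ j, 5 ≤ j → 8 + 2 * j ≤ 2 ^ j := by
      intro j hj
      induction j, hj using Nat.le_induction with
      | base => norm_num
      | succ j hj ih =>
        rw [pow_succ]
        omega
    exact this j (by omega)
  have hM : (8 + 2 * j : ℝ) ≤ 2 ^ j := by exact_mod_cast hj2
  refine ⟨2 ^ j, fun n => ?_⟩
  have key : ∀ k, (reducedBits^[k] (idBits c n) : ℝ) ≤
      2 ^ j * max 1 (Real.logb 2 ((Real.logb 2)^[k] (n : ℝ))) := by
    intro k
    induction k with
    | zero =>
      have h1 : (Nat.clog 2 n : ℝ) ≤ 2 * max 1 (Real.logb 2 n) := by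
        rcases Nat.eq_zero_or_pos n with h | h
        · subst h
          simp
        · have h2 := clog_le_logb h
          have h3 := le_max_left 1 (Real.logb 2 n)
          have h4 := le_max_right 1 (Real.logb 2 n)
          linarith
      have h2 := le_max_left 1 (Real.logb 2 n)
      have h3 : ((4 * c + 1 : ℕ) : ℝ) ≤ 2 ^ j := by
        have : 4 * c + 1 ≤ 2 ^ j := by omega
        exact_mod_cast this
      simp only [Function.iterate_zero, id_eq, idBits]
      push_cast at h3 ⊢
      have h4 := mul_le_mul_of_nonneg_left h1 (show (0 : ℝ) ≤ 2 * c by positivity)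
      have h5 := mul_le_mul_of_nonneg_right h3 (show (0 : ℝ) ≤ max 1 (Real.logb 2 n) by linarith)
      linarith
    | succ k ih =>
      rw [Function.iterate_succ_apply', Function.iterate_succ_apply']
      generalize (Real.logb 2)^[k] (n : ℝ) = z at ih ⊢
      generalize reducedBits^[k] (idBits c n) = l at ih ⊢
      set y := max 1 (Real.logb 2 z) with hy
      have hy1 : 1 ≤ y := le_max_left _ _
      set y' := max 1 (Real.logb 2 (Real.logb 2 z)) with hy'
      have hy1' : 1 ≤ y' := le_max_left _ _
      have hlog : Real.logb 2 y ≤ y' := by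
        rcases le_total (Real.logb 2 z) 1 with h | h
        · rw [hy, max_eq_left h, Real.logb_one]
          linarith
        · rw [hy, max_eq_right h]
          exact le_max_right _ _
      have h1 : (2 * l + 1 : ℝ) ≤ 2 ^ (j + 2) * y := by
        have h2 : (1 : ℝ) ≤ 2 ^ j * y := by
          have := one_le_mul_of_one_le_of_one_le
            (one_le_pow₀ (by norm_num : (1 : ℝ) ≤ 2) (n := j)) hy1
          exact this
        rw [pow_add]
        linarith
      have h2 : Real.logb 2 (2 * l + 1) ≤ j + 2 + y' := by
        refine (Real.logb_le_logb_of_le (by norm_num) (by positivity) h1).trans ?_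
        rw [Real.logb_mul (by positivity) (by positivity), Real.logb_pow, Real.logb_self_eq_one
          (by norm_num)]
        push_cast
        linarith
      have h3 := clog_le_logb (n := 2 * l + 1) (by omega)
      push_cast at h3
      rw [reducedBits]
      push_cast
      have h4 := mul_le_mul_of_nonneg_right hM (show (0 : ℝ) ≤ y' by linarith)
      nlinarith
  rcases h : logStar n with _ | k
  · have h1 := iterate_logStar_le n
    rw [h, Function.iterate_zero, id] at h1
    have h2 : n ≤ 1 := by exact_mod_cast h1
    refine reducedBits_iterate_le ?_
    rw [idBits, Nat.clog_of_right_le_one h2]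
    omega
  · have h1 := iterate_logStar_le n
    rw [h, Function.iterate_succ_apply'] at h1
    have h2 := key k
    rw [max_eq_left h1, mul_one] at h2
    have h3 : reducedBits^[k] (idBits c n) ≤ 2 ^ j := by exact_mod_cast h2
    rw [show k + 1 + 2 ^ j = (2 ^ j + 1) + k by ring, Function.iterate_add_apply]
    exact reducedBits_iterate_le (by omega)

/-! ### The length of the programs -/

lemma length_splitProg (m : ℕ) : (splitProg m).length = m ^ 2 + 2 := by
  simp [splitProg]

lemma length_roundProg (K J m : ℕ) (a b : ℝ) (r : ℕ) :
    (roundProg K J m a b r).length = J * (m ^ 2 + 2) + 2 ^ (J + 1) + 1 := by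
  simp [roundProg, length_splitProg]

lemma length_scalesProg (L : ℕ) : (scalesProg L).length =
    L * (splitDepth L * ((2 * splitDepth L + 4) ^ 2 + 2) + 2 ^ (splitDepth L + 1) + 1) := by
  simp [scalesProg, List.length_flatMap, length_roundProg]

lemma length_phaseProg (L : ℕ) :
    (phaseProg L).length = (scalesProg L).length + colBits L + finalSlots + 6 := by
  simp only [phaseProg, finishProg, List.length_cons, List.length_append, List.length_replicate,
    List.length_map, List.length_range, List.length_nil]
  ring

lemma length_preProg (D T : ℕ) : (preProg D T).length = T + 4 := by
  simp [preProg]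

lemma two_pow_splitDepth_le {L : ℕ} (hL : 0 < L) : 2 ^ splitDepth L ≤ 48 * L := by
  have h1 : 1 < 24 * L := by omega
  have h2 := Nat.pow_pred_clog_lt_self (b := 2) (by norm_num) h1
  have h3 : 0 < Nat.clog 2 (24 * L) := Nat.clog_pos (by norm_num) h1
  have h4 : 2 ^ splitDepth L = 2 * 2 ^ (Nat.clog 2 (24 * L)).pred := by
    rw [splitDepth, ← pow_succ', Nat.pred_eq_sub_one, Nat.sub_add_cancel h3]
  omega

lemma cubic_le_two_pow (J : ℕ) : J * ((2 * J + 4) ^ 2 + 2) ≤ 200 * 2 ^ J := by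
  rcases Nat.lt_or_ge J 4 with h | h
  · interval_cases J <;> norm_num
  · induction J, h using Nat.le_induction with
    | base => norm_num
    | succ J hJ ih =>
      have h1 : (J + 1) * ((2 * (J + 1) + 4) ^ 2 + 2) ≤ 2 * (J * ((2 * J + 4) ^ 2 + 2)) := by
        obtain ⟨k, rfl⟩ := Nat.exists_eq_add_of_le hJ
        ring_nf
        linarith [Nat.zero_le (k ^ 2), Nat.zero_le (k ^ 3), Nat.zero_le k]
      rw [pow_succ 2 J]
      omega

/-- A phase takes `O(L ^ 2)` rounds. -/
theorem exists_length_phaseProg_le : ∃ C : ℕ, ∀ L, 0 < L → (phaseProg L).length ≤ C * L ^ 2 := by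
  refine ⟨20000 + finalSlots, fun L hL => ?_⟩
  rw [length_phaseProg, length_scalesProg]
  have h1 := cubic_le_two_pow (splitDepth L)
  have h2 := two_pow_splitDepth_le hL
  have h3 : splitDepth L * ((2 * splitDepth L + 4) ^ 2 + 2) + 2 ^ (splitDepth L + 1) + 1 ≤
      9697 * L := by
    rw [pow_succ 2 (splitDepth L)]
    omega
  have h4 := Nat.mul_le_mul_left L h3
  have h5 : L ≤ L ^ 2 := Nat.le_self_pow (by norm_num) L
  have h6 : finalSlots ≤ finalSlots * L ^ 2 := Nat.le_mul_of_pos_right _ (by positivity)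
  have h7 : L * (9697 * L) = 9697 * L ^ 2 := by ring
  have h8 : 1 ≤ L ^ 2 := Nat.one_le_pow _ _ hL
  rw [add_mul]
  unfold colBits
  omega

/-! ### The size of the messages -/

/-- Bounds for the variables of an edge on which messages depend. -/
structure EdgeState.Bounded (D K k : ℕ) (s : EdgeState) : Prop where
  w_nonneg : 0 ≤ s.w
  w_le : s.w ≤ 2 * D
  x_nonneg : 0 ≤ s.x
  x_le : s.x ≤ 2 ^ K
  z_le : |s.z| ≤ 1
  col_lt : s.col < 2 ^ k
  tcol_lt : s.tcol < 2 ^ k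

/-- An instruction which respects outputs that are already fixed, sends messages of absolute
value at most `B` on networks of maximum degree at most `D` with identifiers of at most `b` bits,
and preserves the bounds for the variables. -/
structure Instr.Sound (D b K k B : ℕ) (I : Instr) : Prop where
  keep : ∀ s m m', s.out.isSome → (I.upd s m m').out = s.out
  bound : ∃ lo hi : ℤ, -B ≤ lo ∧ hi ≤ B ∧
    (∀ d ≤ D, ∀ i < 2 ^ b, ∀ σ : Fin d → EdgeState, (∀ p, (σ p).Bounded D K k) → ∀ p,
      lo ≤ I.msg i σ p ∧ I.msg i σ p ≤ hi) ∧
    ∀ s m m', s.Bounded D K k → lo ≤ m → m ≤ hi → lo ≤ m' → m' ≤ hi →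
      (I.upd s m m').Bounded D K k

section sound

variable {D b K k B : ℕ}

lemma Instr.sound_gather {g : EdgeState → EdgeState → ℤ} {f : EdgeState → ℤ → EdgeState} (G : ℕ)
    (hG : D * G ≤ B) (hg : ∀ s s', s.Bounded D K k → s'.Bounded D K k → |g s s'| ≤ G)
    (hf : ∀ s m, s.Bounded D K k → (f s m).Bounded D K k)
    (hk : ∀ s m, s.out.isSome → (f s m).out = s.out) : (gather g f).Sound D b K k B := by
  refine ⟨fun s m m' h => hk s (m + m') h, -(D * G : ℕ), (D * G : ℕ), by omega, by omega, ?_,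
    fun s m m' h _ _ _ _ => hf s (m + m') h⟩
  intro d hd i _ σ hσ p
  rw [← abs_le]
  show |∑ q, if q = p then 0 else g (σ p) (σ q)| ≤ _
  refine (Finset.abs_sum_le_sum_abs _ _).trans ?_
  refine (Finset.sum_le_sum (g := fun _ => (G : ℤ)) fun q _ => ?_).trans ?_
  · split_ifs
    · simp
    · exact hg _ _ (hσ p) (hσ q)
  · rw [Finset.sum_const, Finset.card_univ, Fintype.card_fin, nsmul_eq_mul]
    exact_mod_cast Nat.mul_le_mul_right G hd

lemma Instr.sound_silent {f : EdgeState → EdgeState}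
    (hf : ∀ s, s.Bounded D K k → (f s).Bounded D K k)
    (hk : ∀ s, s.out.isSome → (f s).out = s.out) : (silent f).Sound D b K k B :=
  sound_gather 0 (by simp) (fun _ _ _ _ => by simp) (fun s _ => hf s) fun s _ => hk s

lemma abs_add_mul_le {a a' y : ℤ} {D Y : ℕ} (h : 0 ≤ a) (h' : a ≤ 2 * D) (h2 : 0 ≤ a')
    (h2' : a' ≤ 2 * D) (hy : |y| ≤ Y) : |(a + a') * y| ≤ (4 * D * Y : ℕ) := by
  rw [abs_mul, abs_of_nonneg (by linarith)]
  push_cast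
  exact mul_le_mul (by linarith) hy (abs_nonneg _) (by positivity)

lemma EdgeState.Bounded.abs_mul_x_le {s s' : EdgeState} (h : s.Bounded D K k)
    (h' : s'.Bounded D K k) : |(s.w + s'.w) * s'.x| ≤ (4 * D * 2 ^ K : ℕ) := by
  refine abs_add_mul_le h.w_nonneg h.w_le h'.w_nonneg h'.w_le ?_
  rw [abs_of_nonneg h'.x_nonneg]
  exact_mod_cast h'.x_le

lemma EdgeState.Bounded.abs_x_le {s : EdgeState} (h : s.Bounded D K k) :
    |s.x| ≤ (2 ^ K : ℕ) := by
  rw [abs_of_nonneg h.x_nonneg]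
  exact_mod_cast h.x_le

lemma Instr.sound_label {m : ℕ} (hDB : D ≤ B) : (label m).Sound D b K k B := by
  refine ⟨fun s a a' _ => rfl, 0, D, by omega, by omega, ?_, ?_⟩
  · intro d hd i _ σ _ p
    refine ⟨Int.natCast_nonneg _, ?_⟩
    refine Int.ofNat_le.2 ((Nat.mod_le _ _).trans ((Finset.card_le_univ _).trans ?_))
    simpa using hd
  · intro s a a' h _ _ _ _
    exact { h with z_le := by simp [label] }

lemma Instr.sound_ids (hbB : 2 ^ b ≤ B) (hbk : 2 * b ≤ k) : ids.Sound D b K k B := by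
  refine ⟨fun s a a' _ => rfl, 0, (2 ^ b : ℕ) - 1, by omega, by omega, ?_, ?_⟩
  · intro d hd i hi σ _ p
    have h : ids.msg i σ p = i := rfl
    rw [h]
    omega
  · intro s m m' h _ h1 _ h2
    refine { h with tcol_lt := ?_ }
    refine lt_of_lt_of_le (symPair_lt (m := 2 ^ b) (by positivity) (by omega) (by omega)) ?_
    rw [← pow_mul, mul_comm b 2]
    exact Nat.pow_le_pow_right (by norm_num) hbk

lemma Instr.sound_reduce (hk : 10 ≤ k) (hkB : 2 * k ≤ B) : reduce.Sound D b K k B := by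
  refine ⟨fun s a a' _ => rfl, 0, (2 * k : ℕ), by omega, by omega, ?_, ?_⟩
  · intro d hd i _ σ hσ p
    refine ⟨Int.natCast_nonneg _, Int.ofNat_le.2 (Finset.sup_le fun q _ => ?_)⟩
    split_ifs
    · exact digitFact_le (by omega) (hσ p).tcol_lt (hσ q).tcol_lt
    · simp
  · intro s m m' h _ h1 _ h2
    refine { h with tcol_lt := ?_ }
    refine lt_of_lt_of_le (symPair_lt (m := 2 * k + 1) (by positivity) (by omega) (by omega)) ?_
    refine (sq_le_two_pow_reducedBits k).trans (Nat.pow_le_pow_right (by norm_num) ?_)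
    rcases Nat.lt_or_ge 10 k with h3 | h3
    · exact (reducedBits_lt h3).le
    · exact (reducedBits_le_ten h3).trans hk

lemma sound_splitProg {m : ℕ} (hB : D * (4 * D * 2 ^ K) ≤ B) (hDB : D ≤ B) :
    ∀ I ∈ splitProg m, I.Sound D b K k B := by
  intro I hI
  simp only [splitProg, List.mem_cons, List.mem_append, List.mem_map, List.not_mem_nil,
    or_false] at hI
  rcases hI with rfl | ⟨t, -, rfl⟩ | rfl
  · exact Instr.sound_label hDB
  · refine Instr.sound_gather (4 * D * 1) (le_trans (Nat.mul_le_mul_left D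
      (Nat.mul_le_mul_left _ Nat.one_le_two_pow)) hB) ?_ ?_ ?_
    · intro s s' h h'
      split_ifs
      · exact abs_add_mul_le h.w_nonneg h.w_le h'.w_nonneg h'.w_le (by exact_mod_cast h'.z_le)
      · simp
    · intro s a h
      split_ifs
      · exact { h with z_le := by simp }
      · exact { h with z_le := by simp }
      · exact h
    · intro s a _
      split_ifs <;> rfl
  · refine Instr.sound_silent (fun s h => ?_) fun s _ => rfl
    exact { h with }

lemma sound_roundProg {J m : ℕ} {a' b' : ℝ} {r : ℕ} (hB : D * (4 * D * 2 ^ K) ≤ B) (hDB : D ≤ B) :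
    ∀ I ∈ roundProg K J m a' b' r, I.Sound D b K k B := by
  intro I hI
  simp only [roundProg, List.mem_cons, List.mem_append, List.mem_map, List.mem_flatten,
    List.mem_replicate] at hI
  rcases hI with rfl | ⟨l, ⟨-, rfl⟩, hI⟩ | ⟨t, -, rfl⟩
  · refine Instr.sound_silent (fun s h => ?_) fun s _ => rfl
    exact { h with }
  · exact sound_splitProg hB hDB I hI
  · refine Instr.sound_gather _ hB (fun s s' h h' => h.abs_mul_x_le h') ?_ ?_
    · intro s m h
      split_ifs
      · have := h.x_nonneg
        exact { h with
          x_nonneg := le_min (by positivity) (by positivity)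
          x_le := min_le_right _ _ }
      · exact { h with
          x_nonneg := le_rfl
          x_le := by positivity }
      · exact h
    · intro s m _
      split_ifs <;> rfl

lemma sound_preProg {L T : ℕ} (hL : D ≤ 2 ^ L) (hk : 10 ≤ k) (hkL : colBits L ≤ k)
    (hbk : 2 * b ≤ k) (hDB : D ≤ B) (hbB : 2 ^ b ≤ B) (hkB : 2 * k ≤ B) :
    ∀ I ∈ preProg D T, I.Sound D b K k B := by
  intro I hI
  simp only [preProg, List.mem_cons, List.mem_append, List.mem_replicate, List.not_mem_nil,
    or_false] at hI
  rcases hI with rfl | rfl | rfl | ⟨-, rfl⟩ | rfl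
  · refine Instr.sound_silent (fun s h => ?_) fun s _ => rfl
    exact { h with }
  · exact Instr.sound_label hDB
  · exact Instr.sound_ids hbB hbk
  · exact Instr.sound_reduce hk hkB
  · refine Instr.sound_silent (fun s h => ?_) fun s _ => rfl
    exact { h with
      col_lt := (pair_mod_lt hL _ _).trans_le (Nat.pow_le_pow_right (by norm_num) hkL) }

lemma sound_phaseProg {L : ℕ} (hD : 0 < D) (hk : 10 ≤ k) (hkB : 2 * k ≤ B)
    (hB : D * (4 * D * 2 ^ (L + 7)) ≤ B) : ∀ I ∈ phaseProg L, I.Sound D b (L + 7) k B := by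
  have h1 : D * 2 ^ (L + 7) ≤ B := le_trans (Nat.mul_le_mul_left D
    (Nat.le_mul_of_pos_left _ (by positivity))) hB
  have hDB : D ≤ B := le_trans (Nat.le_mul_of_pos_right _ (by positivity)) h1
  intro I hI
  simp only [phaseProg, finishProg, scalesProg, List.mem_cons, List.mem_append, List.mem_replicate,
    List.mem_map, List.mem_flatMap, List.not_mem_nil, or_false] at hI
  rcases hI with rfl | ⟨r, -, hI⟩ |
    (rfl | rfl | rfl | ⟨-, rfl⟩ | ⟨t, -, rfl⟩) | rfl | rfl
  · -- messages are nonnegative here, and an edge does not count itself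
    refine ⟨?_, 0, D - 1, by omega, by omega, ?_, ?_⟩
    · intro s m m' h
      have h2 : ¬ s.out = none := by
        intro h'
        rw [h'] at h
        cases h
      show (if s.out = none then _ else _ : EdgeState).out = _
      rw [if_neg h2]
    · intro d hd i _ σ _ p
      show 0 ≤ (∑ q, if q = p then 0 else if (σ q).out = none then (1 : ℤ) else 0) ∧
        (∑ q, if q = p then 0 else if (σ q).out = none then (1 : ℤ) else 0) ≤ _
      constructor
      · exact Finset.sum_nonneg fun q _ => by split_ifs <;> simp
      · have h3 : ∀ q, (if q = p then 0 else if (σ q).out = none then (1 : ℤ) else 0) ≤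
            1 - if q = p then 1 else 0 := by
          intro q
          split_ifs <;> simp
        refine (Finset.sum_le_sum fun q _ => h3 q).trans ?_
        rw [Finset.sum_sub_distrib]
        simp only [Finset.sum_const, Finset.card_univ, Fintype.card_fin, nsmul_eq_mul, mul_one,
          Finset.sum_ite_eq', Finset.mem_univ, if_true]
        omega
    · intro s m m' h h2 h3 h4 h5
      show (if s.out = none then _ else _ : EdgeState).Bounded D (L + 7) k
      split_ifs
      · have h6 : (2 : ℤ) ^ (L + 3) / (m + m' + 2) ≤ 2 ^ (L + 3) :=
          Int.ediv_le_self _ (by positivity)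
        have h7 : (2 : ℤ) ^ (L + 3) ≤ 2 ^ (L + 7) := pow_le_pow_right₀ (by norm_num) (by omega)
        exact { h with
          w_nonneg := by dsimp only; omega
          w_le := by dsimp only; omega
          x_nonneg := Int.ediv_nonneg (by positivity) (by omega)
          x_le := h6.trans h7 }
      · exact { h with
          w_nonneg := le_rfl
          w_le := by positivity
          x_nonneg := le_rfl
          x_le := by positivity }
  · exact sound_roundProg hB hDB I hI
  · refine Instr.sound_gather _ h1 (fun s s' h h' => h'.abs_x_le) ?_ ?_
    · intro s m h
      split_ifs
      · exact { h with
          x_nonneg := le_rfl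
          x_le := by positivity }
      · exact h
    · intro s m _
      split_ifs <;> rfl
  · refine Instr.sound_silent (fun s h => ?_) fun s _ => rfl
    exact { h with tcol_lt := h.col_lt }
  · exact Instr.sound_label hDB
  · exact Instr.sound_reduce hk hkB
  · refine Instr.sound_gather _ hB (fun s s' h h' => h.abs_mul_x_le h') ?_ ?_
    · intro s m h
      split_ifs
      · exact { h with
          x_nonneg := by positivity
          x_le := le_rfl }
      · exact { h with
          x_nonneg := le_rfl
          x_le := by positivity }
      · exact h
    · intro s m _
      split_ifs <;> rfl
  · refine Instr.sound_gather _ h1 (fun s s' h h' => h'.abs_x_le) ?_ ?_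
    · intro s m h
      split_ifs
      · exact { h with }
      · exact h
    · intro s m h
      have h2 : ¬ s.out = none := by
        intro h'
        rw [h'] at h
        cases h
      rw [if_neg fun h' => h2 h'.1]
  · refine Instr.sound_gather 1 (by omega) (fun s s' _ _ => by split_ifs <;> simp) ?_ ?_
    · intro s m h
      split_ifs
      · exact { h with }
      · exact h
    · intro s m h
      have h2 : ¬ s.out = none := by
        intro h'
        rw [h'] at h
        cases h
      rw [if_neg fun h' => h2 h'.1]

variable {N : Network}

lemma Instr.Sound.sent_le {I : Instr} (hI : I.Sound D b K k B) (hD : N.graph.maxDegree ≤ D)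
    (hid : ∀ v, N.ident v < 2 ^ b) {τ : N.Edge → EdgeState} (hτ : ∀ e, (τ e).Bounded D K k)
    (v : N.V) (e : N.Edge) : |I.sent τ v e| ≤ B := by
  obtain ⟨lo, hi, h1, h2, h3, -⟩ := hI.bound
  unfold Instr.sent
  split_ifs with h
  · obtain ⟨h4, h5⟩ := h3 _ ((N.graph.degree_le_maxDegree v).trans hD) _ (hid v)
      (fun p => τ (N.edge v p)) (fun p => hτ _) (Network.portOf v e h)
    rw [abs_le]
    constructor <;> omega
  · simp

lemma Instr.Sound.step_bounded {I : Instr} (hI : I.Sound D b K k B)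
    (hD : N.graph.maxDegree ≤ D) (hid : ∀ v, N.ident v < 2 ^ b) {τ : N.Edge → EdgeState}
    (hτ : ∀ e, (τ e).Bounded D K k) (e : N.Edge) : (I.step τ e).Bounded D K k := by
  obtain ⟨lo, hi, h1, h2, h3, h4⟩ := hI.bound
  obtain ⟨v, w, hvw, -⟩ := e.exists_eq
  have h5 : ∀ u, u ∈ e.1 → lo ≤ I.sent τ u e ∧ I.sent τ u e ≤ hi := by
    intro u hu
    unfold Instr.sent
    rw [dif_pos hu]
    exact h3 _ ((N.graph.degree_le_maxDegree u).trans hD) _ (hid u)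
      (fun p => τ (N.edge u p)) (fun p => hτ _) (Network.portOf u e hu)
  rw [I.step_eq τ hvw]
  have hv := h5 v (by simp [hvw])
  have hw := h5 w (by simp [hvw])
  exact h4 _ _ _ (hτ e) hv.1 hv.2 hw.1 hw.2

lemma run_bounded {P : List Instr} (hP : ∀ I ∈ P, I.Sound D b K k B)
    (hD : N.graph.maxDegree ≤ D) (hid : ∀ v, N.ident v < 2 ^ b) {τ : N.Edge → EdgeState}
    (hτ : ∀ e, (τ e).Bounded D K k) (e : N.Edge) : (run N P τ e).Bounded D K k := by
  induction P generalizing τ with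
  | nil => exact hτ e
  | cons I P ih =>
    rw [run_cons]
    exact ih (fun I hI => hP I (List.mem_cons_of_mem _ hI))
      (fun e => (hP I List.mem_cons_self).step_bounded hD hid hτ e)

end sound

/-! ### Correctness -/

section correctness

open Network

variable (P : ℕ → ℕ → List Instr) (s₀ : ℕ → ℕ → EdgeState) (N : Network)

/-- If outputs are never changed, and in the end the edges with output `true` form a matching to
which all other edges are adjacent, then the algorithm computes a maximal matching. -/
theorem computesMaximalMatching_of_final
    (hkeep : ∀ t e, (edgeAlgorithm.at_ P s₀ N t e).out.isSome →
      (edgeAlgorithm.at_ P s₀ N (t + 1) e).out = (edgeAlgorithm.at_ P s₀ N t e).out)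
    (T : ℕ) (hT : ∀ e, (edgeAlgorithm.at_ P s₀ N T e).out.isSome)
    (hmatched : ∀ v (e f : N.Edge), v ∈ e.1 → v ∈ f.1 →
      (edgeAlgorithm.at_ P s₀ N T e).out = some true →
      (edgeAlgorithm.at_ P s₀ N T f).out = some true → e = f)
    (hdead : ∀ e, (edgeAlgorithm.at_ P s₀ N T e).out = some false →
      ∃ v, ∃ f : N.Edge, v ∈ e.1 ∧ v ∈ f.1 ∧ (edgeAlgorithm.at_ P s₀ N T f).out = some true) :
    (edgeAlgorithm P s₀).ComputesMaximalMatching N := by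
  have hmono : ∀ t s e, (edgeAlgorithm.at_ P s₀ N t e).out.isSome →
      (edgeAlgorithm.at_ P s₀ N (t + s) e).out = (edgeAlgorithm.at_ P s₀ N t e).out := by
    intro t s e h
    induction s with
    | zero => rfl
    | succ s ih => rw [← add_assoc, hkeep _ _ (by rw [ih]; exact h), ih]
  have hfinal : ∀ t e b, (edgeAlgorithm.at_ P s₀ N t e).out = some b →
      (edgeAlgorithm.at_ P s₀ N T e).out = some b := by
    intro t e b h
    have h1 := hmono t T e (by rw [h]; rfl)
    have h2 := hmono T t e (hT e)
    rw [← h2, add_comm, h1, h]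
  refine ⟨?_, ?_, ?_⟩
  · intro t v w h b hb
    rw [edgeAlgorithm.label_eq] at hb ⊢
    rw [hkeep _ _ (by rw [hb]; rfl), hb]
  · intro v w h
    exact ⟨T, by rw [edgeAlgorithm.label_eq]; exact hT _⟩
  · let M : N.graph.Subgraph :=
      { verts := {v | ∃ w, ∃ h : N.graph.Adj v w,
          (edgeAlgorithm.at_ P s₀ N T ⟨s(v, w), h⟩).out = some true}
        Adj := fun v w => ∃ h : N.graph.Adj v w,
          (edgeAlgorithm.at_ P s₀ N T ⟨s(v, w), h⟩).out = some true
        adj_sub := fun h => h.1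
        edge_vert := fun {v w} h => ⟨w, h⟩
        symm := ⟨fun v w ⟨h, h'⟩ => ⟨h.symm, by
          rw [← h']
          congr 2
          exact Subtype.ext Sym2.eq_swap⟩⟩ }
    refine ⟨M, ⟨?_, ?_⟩, ?_⟩
    · rintro v ⟨w, h, hw⟩
      refine ⟨w, ⟨h, hw⟩, ?_⟩
      rintro u ⟨h', hu⟩
      have := hmatched v ⟨s(v, u), h'⟩ ⟨s(v, w), h⟩ (by simp) (by simp) hu hw
      exact Sym2.congr_right.1 (congrArg Subtype.val this)
    · intro M' hM' hle
      have hadj : ∀ v w, M'.Adj v w → M.Adj v w := by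
        intro v w hvw
        have h := M'.adj_sub hvw
        refine ⟨h, ?_⟩
        rcases hb : (edgeAlgorithm.at_ P s₀ N T ⟨s(v, w), h⟩).out with _ | b
        · have := hT ⟨s(v, w), h⟩
          rw [hb] at this
          cases this
        · cases b
          · exfalso
            obtain ⟨u, f, hu, hf, hft⟩ := hdead _ hb
            -- the matched neighbour of `u` in the larger matching is the one in `M`
            obtain ⟨x, hx⟩ := hf
            have hux : N.graph.Adj u x := by
              have := f.2
              rwa [hx] at this
            have hfe : f = ⟨s(u, x), hux⟩ := Subtype.ext hx
            have hMux : M'.Adj u x := hle.2 ⟨hux, hfe ▸ hft⟩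
            have huniq : ∀ y, M'.Adj u y → y = x := fun y hy =>
              (hM' (M'.edge_vert hMux)).unique hy hMux
            have hne : f ≠ ⟨s(v, w), h⟩ := by
              rintro rfl
              rw [hb] at hft
              cases hft
            simp only [Sym2.mem_iff] at hu
            rcases hu with rfl | rfl
            · obtain rfl := huniq w hvw
              exact hne (Subtype.ext hx)
            · obtain rfl := huniq v hvw.symm
              exact hne (Subtype.ext (hx.trans Sym2.eq_swap))
          · rfl
      refine ⟨?_, fun v w h => hadj v w h⟩
      intro v hv
      obtain ⟨w, hw, -⟩ := hM' hv
      exact ⟨w, hadj v w hw⟩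
    · intro t v w h b hb
      rw [edgeAlgorithm.label_eq] at hb
      have h1 := hfinal _ _ _ hb
      constructor
      · rintro rfl
        exact ⟨h, h1⟩
      · rintro ⟨_, h2⟩
        rw [h1] at h2
        exact Option.some.inj h2

end correctness

/-! ### The algorithm -/

/-- The number of additional colour reduction steps in the preprocessing. -/
noncomputable def extraSteps (c : ℕ) : ℕ := (exists_reducedBits_iterate_le c).choose

/-- The number of phases: `256` phases halve the number of unlabelled edges, which is at most
`n ^ 2` in the beginning. -/
def phaseCount (n : ℕ) : ℕ := 256 * (2 * Nat.clog 2 n + 1)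

/-- The program for networks with `n` nodes and maximum degree `D`. For `D ≤ 1` all edges are in
the matching from the beginning. -/
noncomputable def matchProg (c n D : ℕ) : List Instr :=
  if D ≤ 1 then [] else
    preProg D (logStar n + extraSteps c) ++
      (List.replicate (phaseCount n) (phaseProg (Nat.clog 2 D))).flatten

/-- The initial state of all edges. -/
def initState (_ D : ℕ) : EdgeState :=
  ⟨if D ≤ 1 then some true else none, 0, 0, 0, 0, 0, 0, 0⟩

/-- The algorithm. -/
noncomputable def matchAlgorithm (c : ℕ) : DistAlgorithm := edgeAlgorithm (matchProg c) initState

lemma initState_bounded (n D K k : ℕ) : (initState n D).Bounded D K k where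
  w_nonneg := le_rfl
  w_le := by simp [initState]
  x_nonneg := le_rfl
  x_le := by simp [initState]
  z_le := by simp [initState]
  col_lt := by simp [initState]
  tcol_lt := by simp [initState]

section final

open Network

variable {N : Network} {c n D : ℕ}

lemma lt_of_inClass (hN : N.InClass c n D) (hD : 2 ≤ D) : D < n := by
  have : Nonempty N.V := by
    by_contra h
    rw [not_nonempty_iff] at h
    have := hN.maxDegree_eq
    rw [SimpleGraph.maxDegree_of_subsingleton] at this
    omega
  rw [← hN.maxDegree_eq, ← hN.card_eq]
  exact N.graph.maxDegree_lt_card_verts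

/-- A bound for the number of binary digits of the colours, where `nb` is that of `n`. -/
def tcolBits (c nb : ℕ) : ℕ := (2 * c + 26) * nb

lemma matchProg_sound (hN : N.InClass c n D) (hD : 2 ≤ D) : ∀ I ∈ matchProg c n D,
    I.Sound D (c * Nat.clog 2 n) (Nat.clog 2 D + 7) (tcolBits c (Nat.clog 2 n))
      (2 ^ ((64 + 5 * c) * Nat.clog 2 n)) := by
  have hn := lt_of_inClass hN hD
  set nb := Nat.clog 2 n with hnb
  set L := Nat.clog 2 D with hL
  have h1 : 1 ≤ nb := Nat.clog_pos (by norm_num) (by omega)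
  have h2 : L ≤ nb := Nat.clog_mono_right 2 hn.le
  have h3 : D ≤ 2 ^ L := Nat.le_pow_clog (by norm_num) D
  have e1 : (64 + 5 * c) * nb = 64 * nb + 5 * (c * nb) := by ring
  have e2 : tcolBits c nb = 2 * (c * nb) + 26 * nb := by unfold tcolBits; ring
  have hpow : ∀ j, j ≤ (64 + 5 * c) * nb → 2 ^ j ≤ 2 ^ ((64 + 5 * c) * nb) := fun j hj =>
    Nat.pow_le_pow_right (by norm_num) hj
  have hDB : D * (4 * D * 2 ^ (L + 7)) ≤ 2 ^ ((64 + 5 * c) * nb) := by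
    calc D * (4 * D * 2 ^ (L + 7)) ≤ 2 ^ L * (4 * 2 ^ L * 2 ^ (L + 7)) := by gcongr
      _ = 2 ^ (3 * L + 9) := by ring
      _ ≤ _ := hpow _ (by omega)
  have hkB : 2 * tcolBits c nb ≤ 2 ^ ((64 + 5 * c) * nb) := by
    refine (Nat.lt_two_pow_self).le.trans (hpow _ ?_)
    omega
  intro I hI
  rw [matchProg, if_neg (by omega), List.mem_append, List.mem_flatten] at hI
  rcases hI with hI | ⟨l, hl, hI⟩
  · refine sound_preProg h3 (by omega) (by unfold colBits; omega) (by omega)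
      (h3.trans (hpow _ (by omega))) (hpow _ (by omega)) hkB I hI
  · rw [(List.mem_replicate.1 hl).2] at hI
    exact sound_phaseProg (by omega) (by omega) hkB hDB I hI

/-- The states after `t` rounds of the algorithm. -/
noncomputable abbrev stateAt (c : ℕ) (N : Network) (t : ℕ) : N.Edge → EdgeState :=
  edgeAlgorithm.at_ (matchProg c) initState N t

lemma progOn_eq (hN : N.InClass c n D) :
    edgeAlgorithm.progOn (matchProg c) N = matchProg c n D := by
  rw [edgeAlgorithm.progOn, hN.card_eq, hN.maxDegree_eq]

lemma stateAt_bounded (hN : N.InClass c n D) (hD : 2 ≤ D) (t : ℕ) (e : N.Edge) :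
    (stateAt c N t e).Bounded D (Nat.clog 2 D + 7) (tcolBits c (Nat.clog 2 n)) := by
  refine run_bounded (b := c * Nat.clog 2 n) (B := 2 ^ ((64 + 5 * c) * Nat.clog 2 n))
    (fun I hI => matchProg_sound hN hD I ?_) hN.maxDegree_eq.le hN.ident_lt (fun e => ?_) e
  · rw [progOn_eq hN] at hI
    exact List.mem_of_mem_take hI
  · rw [hN.maxDegree_eq]
    exact initState_bounded _ _ _ _

lemma matchAlgorithm_isCongest (c : ℕ) : (matchAlgorithm c).IsCongest c := by
  refine ⟨66 + 5 * c, fun n D N hN t v p m hm => ?_⟩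
  rw [matchAlgorithm, edgeAlgorithm.message_eq, progOn_eq hN] at hm
  obtain ⟨I, hI, rfl⟩ := Option.map_eq_some_iff.1 hm
  rcases Nat.lt_or_ge D 2 with hD | hD
  · rw [matchProg, if_pos (by omega)] at hI
    simp at hI
  · have h1 := (matchProg_sound hN hD I (List.mem_of_getElem? hI)).sent_le hN.maxDegree_eq.le
      hN.ident_lt (stateAt_bounded hN hD t) v (N.edge v p)
    have hn := lt_of_inClass hN hD
    have h2 : 1 ≤ Nat.clog 2 n := Nat.clog_pos (by norm_num) (by omega)
    refine (length_encodeInt (k := (64 + 5 * c) * Nat.clog 2 n + 1)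
      (lt_of_le_of_lt h1 ?_)).trans ?_
    · push_cast
      exact pow_lt_pow_right₀ (by norm_num) (Nat.lt_succ_self _)
    · have e1 : (66 + 5 * c) * Nat.clog 2 n =
          (64 + 5 * c) * Nat.clog 2 n + 2 * Nat.clog 2 n := by ring
      omega

lemma stateAt_keep (hN : N.InClass c n D) (t : ℕ) (e : N.Edge)
    (h : (stateAt c N t e).out.isSome) :
    (stateAt c N (t + 1) e).out = (stateAt c N t e).out := by
  rcases hI : (edgeAlgorithm.progOn (matchProg c) N)[t]? with _ | I
  · rw [stateAt, edgeAlgorithm.at_succ_of_le _ _ _ (List.getElem?_eq_none_iff.1 hI)]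
  · rw [stateAt, edgeAlgorithm.at_succ _ _ _ hI]
    rw [progOn_eq hN] at hI
    have hD : 2 ≤ D := by
      by_contra hD
      rw [matchProg, if_pos (by omega)] at hI
      simp at hI
    exact (matchProg_sound hN hD I (List.mem_of_getElem? hI)).keep _ _ _ h

lemma stateAt_keep_add (hN : N.InClass c n D) (t s : ℕ) (e : N.Edge)
    (h : (stateAt c N t e).out.isSome) :
    (stateAt c N (t + s) e).out = (stateAt c N t e).out := by
  induction s with
  | zero => rfl
  | succ s ih => rw [← add_assoc, stateAt_keep hN _ _ (by rw [ih]; exact h), ih]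

/-- The length of the preprocessing. -/
noncomputable def preLength (c n : ℕ) : ℕ := logStar n + extraSteps c + 4

/-- The length of a phase. -/
noncomputable def phaseLength (D : ℕ) : ℕ := (phaseProg (Nat.clog 2 D)).length

/-- The states after the preprocessing and `k` phases. -/
noncomputable def phaseState (c n D : ℕ) (N : Network) (k : ℕ) : N.Edge → EdgeState :=
  stateAt c N (preLength c n + k * phaseLength D)

lemma phaseState_eq (hN : N.InClass c n D) (hD : 2 ≤ D) {k : ℕ} (hk : k ≤ phaseCount n) :
    phaseState c n D N k = run N (List.replicate k (phaseProg (Nat.clog 2 D))).flatten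
      (run N (preProg D (logStar n + extraSteps c)) fun _ => initState n D) := by
  rw [phaseState, stateAt, edgeAlgorithm.at_, progOn_eq hN, hN.card_eq, hN.maxDegree_eq, matchProg,
    if_neg (by omega), ← run_append]
  congr 1
  have h1 : preLength c n = (preProg D (logStar n + extraSteps c)).length := by
    rw [length_preProg, preLength]
  have h2 : (List.replicate k (phaseProg (Nat.clog 2 D))).flatten.length = k * phaseLength D := by
    simp [phaseLength]
  rw [h1, List.take_length_add_append, ← Nat.add_sub_of_le hk, List.replicate_add,
    List.flatten_append, List.take_left' h2]

/-- The invariant holds between the phases, and every phase removes a constant fraction of the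
unlabelled edges. -/
lemma phaseState_inv (hN : N.InClass c n D) (hD : 2 ≤ D) {k : ℕ} (hk : k ≤ phaseCount n) :
    PhaseInv (Nat.clog 2 D) (phaseState c n D N k) ∧
    (k < phaseCount n → 256 * activeCount (phaseState c n D N (k + 1)) ≤
      255 * activeCount (phaseState c n D N k)) := by
  have hL0 : 0 < Nat.clog 2 D := Nat.clog_pos (by norm_num) hD
  have hL : N.graph.maxDegree ≤ 2 ^ Nat.clog 2 D := by
    rw [hN.maxDegree_eq]
    exact Nat.le_pow_clog (by norm_num) D
  have hinv : PhaseInv (Nat.clog 2 D) (phaseState c n D N k) := by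
    induction k with
    | zero =>
      rw [phaseState_eq hN hD hk]
      have := preProg_spec (T := logStar n + extraSteps c) (k := idBits c n) hL
        (by rw [hN.maxDegree_eq]; omega) (by unfold idBits; omega) (fun v w => ?_)
        ((exists_reducedBits_iterate_le c).choose_spec n) (fun _ => initState n D)
        (fun e => by simp only [initState]; rw [if_neg (by omega)])
      · rw [hN.maxDegree_eq] at this
        exact this
      · refine lt_of_lt_of_le (symPair_lt (m := 2 ^ (c * Nat.clog 2 n)) (by positivity)
          (by exact_mod_cast hN.ident_lt v) (by exact_mod_cast hN.ident_lt w)) ?_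
        rw [← pow_mul]
        exact Nat.pow_le_pow_right (by norm_num) (by unfold idBits; omega)
    | succ k ih =>
      rw [phaseState_eq hN hD hk, run_replicate_succ, ← phaseState_eq hN hD (by omega)]
      exact (phaseProg_spec hL0 hL _ (ih (by omega))).1
  refine ⟨hinv, fun hk' => ?_⟩
  rw [phaseState_eq hN hD hk', run_replicate_succ, ← phaseState_eq hN hD hk]
  exact (phaseProg_spec hL0 hL _ hinv).2

end final

/-! ### Sums over the phases -/

section decay

variable {a : ℕ → ℕ} {P : ℕ}

lemma sum_le_of_decay (h : ∀ k < P, 256 * a (k + 1) ≤ 255 * a k) {i j : ℕ} (hij : i ≤ j)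
    (hj : j ≤ P) : ∑ k ∈ Finset.Ico i j, a k ≤ 256 * a i := by
  have : ∑ k ∈ Finset.Ico i j, a k + 256 * a j ≤ 256 * a i := by
    induction j, hij using Nat.le_induction with
    | base => simp
    | succ j hij ih =>
      rw [Finset.sum_Ico_succ_top hij]
      have := h j (by omega)
      have := ih (by omega)
      omega
  omega

lemma two_pow_mul_le_of_decay (h : ∀ k < P, 256 * a (k + 1) ≤ 255 * a k) {j : ℕ}
    (hj : 256 * j ≤ P) : 2 ^ j * a (256 * j) ≤ a 0 := by
  have hiter : ∀ k i, k + i ≤ P → 256 ^ i * a (k + i) ≤ 255 ^ i * a k := by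
    intro k i hi
    induction i with
    | zero => simp
    | succ i ih =>
      calc 256 ^ (i + 1) * a (k + (i + 1)) = 256 ^ i * (256 * a (k + i + 1)) := by
            rw [pow_succ, mul_assoc, add_assoc]
        _ ≤ 256 ^ i * (255 * a (k + i)) := Nat.mul_le_mul_left _ (h _ (by omega))
        _ = 255 * (256 ^ i * a (k + i)) := by ring
        _ ≤ 255 * (255 ^ i * a k) := Nat.mul_le_mul_left _ (ih (by omega))
        _ = 255 ^ (i + 1) * a k := by ring
  have hhalf : ∀ k, k + 256 ≤ P → 2 * a (k + 256) ≤ a k := by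
    intro k hk
    have h1 := hiter k 256 hk
    have h2 : 2 * 255 ^ 256 ≤ 256 ^ 256 := by norm_num
    have h3 : 255 ^ 256 * (2 * a (k + 256)) ≤ 255 ^ 256 * a k := by
      calc 255 ^ 256 * (2 * a (k + 256)) = (2 * 255 ^ 256) * a (k + 256) := by ring
        _ ≤ 256 ^ 256 * a (k + 256) := Nat.mul_le_mul_right _ h2
        _ ≤ _ := h1
    exact Nat.le_of_mul_le_mul_left h3 (by positivity)
  induction j with
  | zero => simp
  | succ j ih =>
    have h1 := hhalf (256 * j) (by omega)
    calc 2 ^ (j + 1) * a (256 * (j + 1)) = 2 ^ j * (2 * a (256 * j + 256)) := by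
          rw [mul_add_one]; ring
      _ ≤ 2 ^ j * a (256 * j) := Nat.mul_le_mul_left _ h1
      _ ≤ a 0 := ih (by omega)

end decay

/-- The number of times at which a condition holds which, once violated, stays violated, is
a time at which it is violated. -/
lemma not_card_filter_of_antitone {p : ℕ → Prop} [DecidablePred p]
    (hp : ∀ k l, k ≤ l → p l → p k) {P : ℕ} (hP : ¬ p P) :
    ¬ p ((Finset.range P).filter p).card := by
  intro h
  set q := ((Finset.range P).filter p).card with hq
  have hqP : q < P := by
    by_contra h'
    exact hP (hp _ _ (not_lt.1 h') h)
  have hsub : Finset.range (q + 1) ⊆ (Finset.range P).filter p := by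
    intro k hk
    rw [Finset.mem_range] at hk
    exact Finset.mem_filter.2 ⟨Finset.mem_range.2 (by omega), hp k q (by omega) h⟩
  have := Finset.card_le_card hsub
  rw [Finset.card_range, ← hq] at this
  omega

lemma sum_card_filter_comm {α β : Type*} [Fintype α] (s : Finset β) (p : α → β → Prop)
    [∀ x y, Decidable (p x y)] :
    ∑ x, (s.filter (p x)).card = ∑ y ∈ s, (Finset.univ.filter fun x => p x y).card := by
  simp only [Finset.card_filter]
  exact Finset.sum_comm

/-! ### The complexity -/

section complexity

open Network

variable {N : Network} {c n D : ℕ}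

lemma edgeTime_le_of_edgeCompleted {A : DistAlgorithm} {t : ℕ} {e : Sym2 N.V}
    (h : A.EdgeCompleted N t e) : A.edgeTime N e ≤ t := iInf₂_le t h

lemma nodeTime_le_of_nodeCompleted {A : DistAlgorithm} {t : ℕ} {v : N.V}
    (h : A.NodeCompleted N t v) : A.nodeTime N v ≤ t := iInf₂_le t h

lemma terminationTime_le_of_terminated {A : DistAlgorithm} {t : ℕ} (h : A.Terminated N t) :
    A.terminationTime N ≤ t := iInf₂_le t h

lemma two_mul_card_edge_le (hN : N.InClass c n D) : 2 * Fintype.card N.Edge ≤ n * D := by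
  have h := N.graph.sum_degrees_eq_twice_card_edges
  have h1 : Fintype.card N.Edge = N.graph.edgeFinset.card := by
    rw [SimpleGraph.edgeFinset, Set.toFinset_card]
  rw [h1, ← h, ← hN.card_eq, ← hN.maxDegree_eq]
  calc ∑ v, N.graph.degree v ≤ ∑ _v : N.V, N.graph.maxDegree :=
        Finset.sum_le_sum fun v _ => N.graph.degree_le_maxDegree v
    _ = _ := by simp

/-- The number of edges which have no output after `k` phases. -/
noncomputable def activeAt (c n D : ℕ) (N : Network) (k : ℕ) : ℕ :=
  activeCount (phaseState c n D N k)

lemma activeAt_decay (hN : N.InClass c n D) (hD : 2 ≤ D) :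
    ∀ k < phaseCount n, 256 * activeAt c n D N (k + 1) ≤ 255 * activeAt c n D N k :=
  fun _ hk => (phaseState_inv hN hD hk.le).2 hk

lemma activeAt_le (k : ℕ) : activeAt c n D N k ≤ Fintype.card N.Edge :=
  Finset.card_le_univ _

lemma phaseState_out_antitone (hN : N.InClass c n D) {k l : ℕ} (hkl : k ≤ l) (e : N.Edge)
    (h : (phaseState c n D N l e).out = none) : (phaseState c n D N k e).out = none := by
  by_contra h'
  have h1 := stateAt_keep_add hN (preLength c n + k * phaseLength D) ((l - k) * phaseLength D) e
    (Option.isSome_iff_ne_none.2 h')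
  rw [add_assoc, ← add_mul, Nat.add_sub_of_le hkl] at h1
  exact h' (h1.symm.trans h)

lemma phaseState_phaseCount (hN : N.InClass c n D) (hD : 2 ≤ D) (e : N.Edge) :
    (phaseState c n D N (phaseCount n) e).out ≠ none := by
  set nb := Nat.clog 2 n with hnb
  have hn := lt_of_inClass hN hD
  have h1 := two_pow_mul_le_of_decay (activeAt_decay hN hD) (j := 2 * nb + 1) le_rfl
  have h2 : activeAt c n D N 0 ≤ 2 ^ (2 * nb) := by
    have h3 := two_mul_card_edge_le hN
    have h4 : n ≤ 2 ^ nb := Nat.le_pow_clog (by norm_num) n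
    calc activeAt c n D N 0 ≤ Fintype.card N.Edge := activeAt_le 0
      _ ≤ n * D := by omega
      _ ≤ 2 ^ nb * 2 ^ nb := Nat.mul_le_mul h4 (hn.le.trans h4)
      _ = _ := by ring
  have h3 : activeAt c n D N (phaseCount n) = 0 := by
    by_contra h0
    have h4 : 2 ^ (2 * nb + 1) ≤ 2 ^ (2 * nb) :=
      (Nat.le_mul_of_pos_right _ (Nat.pos_of_ne_zero h0)).trans (h1.trans h2)
    exact absurd h4 (not_le.2 (Nat.pow_lt_pow_right (by norm_num) (Nat.lt_succ_self _)))
  intro h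
  have := Finset.card_eq_zero.1 h3
  exact Finset.notMem_empty e (this ▸ Finset.mem_filter.2 ⟨Finset.mem_univ _, h⟩)

lemma computesMaximalMatching (hN : N.InClass c n D) :
    (matchAlgorithm c).ComputesMaximalMatching N := by
  rcases Nat.lt_or_ge D 2 with hD | hD
  · have hout : ∀ e, (stateAt c N 0 e).out = some true := by
      intro e
      show (if N.graph.maxDegree ≤ 1 then some true else none) = some true
      rw [hN.maxDegree_eq, if_pos (by omega)]
    refine computesMaximalMatching_of_final _ _ N (fun t e h => stateAt_keep hN t e h) 0
      (fun e => by rw [hout e]; rfl) (fun v e f he hf _ _ => ?_) (fun e he => ?_)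
    · obtain ⟨p, rfl⟩ := exists_edge_eq he
      obtain ⟨q, rfl⟩ := exists_edge_eq hf
      have h1 := N.graph.degree_le_maxDegree v
      rw [hN.maxDegree_eq] at h1
      have h2 := p.isLt
      have h3 := q.isLt
      rw [show p = q from Fin.ext (by omega)]
    · rw [hout e] at he
      cases he
  · have hinv := (phaseState_inv hN hD le_rfl).1
    exact computesMaximalMatching_of_final _ _ N (fun t e h => stateAt_keep hN t e h)
      (preLength c n + phaseCount n * phaseLength D)
      (fun e => Option.isSome_iff_ne_none.2 (phaseState_phaseCount hN hD e)) hinv.matched hinv.dead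

open Classical in
/-- The number of phases which begin when a given edge has no output. -/
noncomputable def edgePhases (c n D : ℕ) (N : Network) (e : N.Edge) : ℕ :=
  ((Finset.range (phaseCount n)).filter fun k => (phaseState c n D N k e).out = none).card

open Classical in
/-- The number of phases which begin when a given node has an edge without output. -/
noncomputable def nodePhases (c n D : ℕ) (N : Network) (v : N.V) : ℕ :=
  ((Finset.range (phaseCount n)).filter fun k =>
    ∃ e : N.Edge, v ∈ e.1 ∧ (phaseState c n D N k e).out = none).card

lemma edgeCompleted_of_phaseState {k : ℕ} {e : N.Edge} (h : (phaseState c n D N k e).out ≠ none) :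
    (matchAlgorithm c).EdgeCompleted N (preLength c n + k * phaseLength D) e.1 :=
  (edgeAlgorithm.edgeCompleted_iff _ _ _ _ _).2 (Option.isSome_iff_ne_none.2 h)

lemma edgeTime_le (hN : N.InClass c n D) (hD : 2 ≤ D) (e : N.Edge) :
    (matchAlgorithm c).edgeTime N e.1 ≤
      ((preLength c n + edgePhases c n D N e * phaseLength D : ℕ) : ℝ≥0∞) := by
  classical
  refine edgeTime_le_of_edgeCompleted (edgeCompleted_of_phaseState ?_)
  rw [edgePhases]
  convert not_card_filter_of_antitone (p := fun k => (phaseState c n D N k e).out = none)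
    (fun k l hkl h => phaseState_out_antitone hN hkl e h) (phaseState_phaseCount hN hD e)

lemma nodeTime_le (hN : N.InClass c n D) (hD : 2 ≤ D) (v : N.V) :
    (matchAlgorithm c).nodeTime N v ≤
      ((preLength c n + nodePhases c n D N v * phaseLength D : ℕ) : ℝ≥0∞) := by
  classical
  refine nodeTime_le_of_nodeCompleted fun w hw => ?_
  refine edgeCompleted_of_phaseState (e := ⟨s(v, w), hw⟩) fun h => ?_
  refine not_card_filter_of_antitone
    (p := fun k => ∃ e : N.Edge, v ∈ e.1 ∧ (phaseState c n D N k e).out = none)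
    (fun k l hkl ⟨e, he, h⟩ => ⟨e, he, phaseState_out_antitone hN hkl e h⟩)
    (P := phaseCount n) (fun ⟨e, _, h⟩ => phaseState_phaseCount hN hD e h)
    ⟨⟨s(v, w), hw⟩, by simp, ?_⟩
  rw [nodePhases] at h
  convert h

lemma sum_edgePhases_le (hN : N.InClass c n D) (hD : 2 ≤ D) :
    ∑ e, edgePhases c n D N e ≤ 256 * Fintype.card N.Edge := by
  classical
  have h : ∑ e, edgePhases c n D N e = ∑ k ∈ Finset.Ico 0 (phaseCount n), activeAt c n D N k := by
    rw [← Finset.range_eq_Ico]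
    convert sum_card_filter_comm (Finset.range (phaseCount n))
      fun e k => (phaseState c n D N k e).out = none using 2
    simp only [edgePhases]
    congr!
  rw [h]
  exact (sum_le_of_decay (activeAt_decay hN hD) (Nat.zero_le _) le_rfl).trans
    (Nat.mul_le_mul_left _ (activeAt_le 0))

/-- After `O(log Δ)` phases there are fewer unlabelled edges than nodes; before that, the number
of nodes is used as a bound, and after it, the geometrically decreasing number of unlabelled
edges. -/
lemma sum_nodePhases_le (hN : N.InClass c n D) (hD : 2 ≤ D) :
    ∑ v, nodePhases c n D N v ≤ n * (256 * Nat.clog 2 D + 512) := by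
  classical
  set L := Nat.clog 2 D with hL
  have hLn : 256 * L ≤ phaseCount n := by
    have : L ≤ Nat.clog 2 n := Nat.clog_mono_right 2 (lt_of_inClass hN hD).le
    unfold phaseCount
    omega
  set b : ℕ → ℕ := fun k => (Finset.univ.filter fun v : N.V =>
    ∃ e : N.Edge, v ∈ e.1 ∧ (phaseState c n D N k e).out = none).card with hb
  have h : ∑ v, nodePhases c n D N v = ∑ k ∈ Finset.range (phaseCount n), b k := by
    rw [hb, ← sum_card_filter_comm]
    simp only [nodePhases]
  have hb1 : ∀ k, b k ≤ n := fun k => (Finset.card_le_univ _).trans hN.card_eq.le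
  have hb2 : ∀ k, b k ≤ 2 * activeAt c n D N k := by
    intro k
    have hsub : (Finset.univ.filter fun v : N.V =>
        ∃ e : N.Edge, v ∈ e.1 ∧ (phaseState c n D N k e).out = none) ⊆
        (Finset.univ.filter fun e : N.Edge => (phaseState c n D N k e).out = none).biUnion
          fun e => Finset.univ.filter fun v => v ∈ e.1 := by
      intro v hv
      obtain ⟨e, he, h⟩ := (Finset.mem_filter.1 hv).2
      exact Finset.mem_biUnion.2 ⟨e, by simpa using h, by simpa using he⟩
    refine (Finset.card_le_card hsub).trans ((Finset.card_biUnion_le_card_mul _ _ 2 ?_).trans ?_)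
    · intro e _
      obtain ⟨v, w, hvw, -⟩ := e.exists_eq
      refine (Finset.card_le_card (t := {v, w}) fun u hu => ?_).trans Finset.card_le_two
      simpa [hvw] using hu
    · rw [mul_comm, activeAt, activeCount]
  have hsmall : activeAt c n D N (256 * L) ≤ n := by
    have h1 := two_pow_mul_le_of_decay (activeAt_decay hN hD) hLn
    have h2 : activeAt c n D N 0 ≤ 2 ^ L * n := by
      have h3 := two_mul_card_edge_le hN
      calc activeAt c n D N 0 ≤ Fintype.card N.Edge := activeAt_le 0
        _ ≤ D * n := by rw [mul_comm]; omega
        _ ≤ _ := Nat.mul_le_mul_right _ (Nat.le_pow_clog (by norm_num) D)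
    exact Nat.le_of_mul_le_mul_left (h1.trans h2) (by positivity)
  rw [h, Finset.range_eq_Ico, ← Finset.sum_Ico_consecutive _ (Nat.zero_le _) hLn]
  have h1 : ∑ k ∈ Finset.Ico 0 (256 * L), b k ≤ 256 * L * n := by
    refine (Finset.sum_le_card_nsmul _ _ n fun k _ => hb1 k).trans ?_
    simp
  have h2 : ∑ k ∈ Finset.Ico (256 * L) (phaseCount n), b k ≤ 2 * (256 * n) := by
    refine (Finset.sum_le_sum fun k _ => hb2 k).trans ?_
    rw [← Finset.mul_sum]
    exact Nat.mul_le_mul_left _ ((sum_le_of_decay (activeAt_decay hN hD) hLn le_rfl).trans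
      (Nat.mul_le_mul_left _ hsmall))
  calc _ ≤ 256 * L * n + 2 * (256 * n) := add_le_add h1 h2
    _ = _ := by ring

lemma edgeAvg_term_le (hN : N.InClass c n D) (hD : 2 ≤ D) :
    (∑ e ∈ N.graph.edgeFinset, (matchAlgorithm c).edgeTime N e) /
      (N.graph.edgeFinset.card : ℝ≥0∞) ≤ ((preLength c n + 256 * phaseLength D : ℕ) : ℝ≥0∞) := by
  refine ENNReal.div_le_of_le_mul ?_
  have h1 : ∑ e ∈ N.graph.edgeFinset, (matchAlgorithm c).edgeTime N e =
      ∑ e : N.Edge, (matchAlgorithm c).edgeTime N e.1 := by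
    rw [SimpleGraph.edgeFinset, Finset.sum_set_coe]
  have h2 : N.graph.edgeFinset.card = Fintype.card N.Edge := by
    rw [SimpleGraph.edgeFinset, Set.toFinset_card]
  rw [h1, h2]
  refine (Finset.sum_le_sum fun e _ => edgeTime_le hN hD e).trans ?_
  rw [← Nat.cast_sum, ← Nat.cast_mul, Nat.cast_le, Finset.sum_add_distrib, ← Finset.sum_mul]
  have h3 := Nat.mul_le_mul_right (phaseLength D) (sum_edgePhases_le hN hD)
  simp only [Finset.sum_const, Finset.card_univ, smul_eq_mul]
  calc _ ≤ Fintype.card N.Edge * preLength c n + 256 * Fintype.card N.Edge * phaseLength D :=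
        Nat.add_le_add_left h3 _
    _ = _ := by ring

lemma nodeAvg_term_le (hN : N.InClass c n D) (hD : 2 ≤ D) :
    (∑ v : N.V, (matchAlgorithm c).nodeTime N v) / (Fintype.card N.V : ℝ≥0∞) ≤
      ((preLength c n + (256 * Nat.clog 2 D + 512) * phaseLength D : ℕ) : ℝ≥0∞) := by
  refine ENNReal.div_le_of_le_mul ?_
  refine (Finset.sum_le_sum fun e _ => nodeTime_le hN hD e).trans ?_
  rw [← Nat.cast_sum, ← Nat.cast_mul, Nat.cast_le, Finset.sum_add_distrib, ← Finset.sum_mul]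
  have h3 := Nat.mul_le_mul_right (phaseLength D) (sum_nodePhases_le hN hD)
  simp only [Finset.sum_const, Finset.card_univ, smul_eq_mul, hN.card_eq]
  calc _ ≤ n * preLength c n + n * (256 * Nat.clog 2 D + 512) * phaseLength D :=
        Nat.add_le_add_left h3 _
    _ = _ := by ring

lemma terminationTime_le (hN : N.InClass c n D) (hD : 2 ≤ D) :
    (matchAlgorithm c).terminationTime N ≤
      ((preLength c n + phaseCount n * phaseLength D : ℕ) : ℝ≥0∞) := by
  refine terminationTime_le_of_terminated ⟨fun v w hw => ?_, fun t ht v p => ?_⟩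
  · exact edgeCompleted_of_phaseState (e := ⟨s(v, w), hw⟩) (phaseState_phaseCount hN hD _)
  · rw [matchAlgorithm, edgeAlgorithm.message_eq, progOn_eq hN, List.getElem?_eq_none_iff.2]
    · rfl
    · refine le_trans (le_of_eq ?_) ht
      rw [matchProg, if_neg (by omega), List.length_append, length_preProg, List.length_flatten,
        List.map_replicate, List.sum_replicate, smul_eq_mul]
      rfl

/-- For maximum degree at most `1`, everything is done at time `0`. -/
lemma terminated_zero (hN : N.InClass c n D) (hD : D < 2) :
    (matchAlgorithm c).Terminated N 0 := by
  refine ⟨fun v w hw => (edgeAlgorithm.edgeCompleted_iff _ _ _ _ ⟨s(v, w), hw⟩).2 ?_,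
    fun t ht v p => ?_⟩
  · show Option.isSome (if N.graph.maxDegree ≤ 1 then some true else none)
    rw [hN.maxDegree_eq, if_pos (by omega)]
    rfl
  · rw [matchAlgorithm, edgeAlgorithm.message_eq, progOn_eq hN, matchProg, if_pos (by omega)]
    simp

end complexity

section averages

variable {c n D : ℕ}

lemma averages_eq_zero (hD : D < 2) : (matchAlgorithm c).edgeAvg c n D = 0 ∧
    (matchAlgorithm c).nodeAvg c n D = 0 ∧ (matchAlgorithm c).worstCase c n D = 0 := by
  refine ⟨?_, ?_, ?_⟩
  · simp only [DistAlgorithm.edgeAvg, ENNReal.iSup_eq_zero]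
    intro N hN
    rw [Finset.sum_eq_zero, ENNReal.zero_div]
    intro e he
    induction e using Sym2.ind with
    | _ v w =>
      have h : N.graph.Adj v w := by simpa using he
      refine le_antisymm ((edgeTime_le_of_edgeCompleted ((terminated_zero hN hD).1 v w h)).trans ?_) bot_le
      simp
  · simp only [DistAlgorithm.nodeAvg, ENNReal.iSup_eq_zero]
    intro N hN
    rw [Finset.sum_eq_zero, ENNReal.zero_div]
    intro v _
    refine le_antisymm ((nodeTime_le_of_nodeCompleted ((terminated_zero hN hD).1 v)).trans ?_) bot_le
    simp
  · simp only [DistAlgorithm.worstCase, ENNReal.iSup_eq_zero]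
    intro N hN
    refine le_antisymm ((terminationTime_le_of_terminated (terminated_zero hN hD)).trans ?_) bot_le
    simp

lemma edgeAvg_le (hD : 2 ≤ D) : (matchAlgorithm c).edgeAvg c n D ≤
    ((preLength c n + 256 * phaseLength D : ℕ) : ℝ≥0∞) :=
  iSup₂_le fun _ hN => edgeAvg_term_le hN hD

lemma nodeAvg_le (hD : 2 ≤ D) : (matchAlgorithm c).nodeAvg c n D ≤
    ((preLength c n + (256 * Nat.clog 2 D + 512) * phaseLength D : ℕ) : ℝ≥0∞) :=
  iSup₂_le fun _ hN => nodeAvg_term_le hN hD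

lemma worstCase_le (hD : 2 ≤ D) : (matchAlgorithm c).worstCase c n D ≤
    ((preLength c n + phaseCount n * phaseLength D : ℕ) : ℝ≥0∞) :=
  iSup₂_le fun _ hN => terminationTime_le hN hD

/-- Without networks there is nothing to bound; this covers `n ≤ D`. -/
lemma worstCase_eq_zero (hD : 2 ≤ D) (hn : n ≤ D) : (matchAlgorithm c).worstCase c n D = 0 := by
  simp only [DistAlgorithm.worstCase, ENNReal.iSup_eq_zero]
  intro N hN
  exact absurd (lt_of_inClass hN hD) (not_lt.2 hn)

lemma clog_le_three_mul_log (hn : 2 ≤ n) : (Nat.clog 2 n : ℝ) ≤ 3 * Real.log n := by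
  have h1 := clog_le_logb (n := n) (by omega)
  have h2 : (0.6931471803 : ℝ) < Real.log 2 := Real.log_two_gt_d9
  have h3 : Real.log 2 ≤ Real.log n := Real.log_le_log (by norm_num) (by exact_mod_cast hn)
  refine h1.trans ?_
  rw [Real.logb, div_add_one (by positivity), div_le_iff₀ (by positivity)]
  nlinarith

end averages

theorem mainTheorem4 (c : ℕ) :
    ∃ A : DistAlgorithm,
      A.IsCongest c ∧
      (∀ (n Δ : ℕ) (N : Network), N.InClass c n Δ → A.ComputesMaximalMatching N) ∧
      ∃ K : ℝ, ∀ n Δ : ℕ,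
        A.edgeAvg c n Δ ≤ ENNReal.ofReal (K * (Real.log Δ ^ 2 + logStar n)) ∧
        A.nodeAvg c n Δ ≤ ENNReal.ofReal (K * (Real.log Δ ^ 3 + logStar n)) ∧
        A.worstCase c n Δ ≤ ENNReal.ofReal (K * (Real.log Δ ^ 2 * Real.log n)) := by
  obtain ⟨C', hC'⟩ := exists_length_phaseProg_le
  -- As `⌈log₂ m⌉ ≤ 3 * log m`, a phase has at most `9 * C' * log Δ ^ 2` rounds, and the number of
  -- phases is at most `2304 * log n`; moreover `1 ≤ 27 * log Δ ^ 3` and `1 ≤ 27 * log Δ ^ 2 * log n`.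
  refine ⟨matchAlgorithm c, matchAlgorithm_isCongest c,
    fun n Δ N hN => computesMaximalMatching hN,
    27 * (extraSteps c + 5) + 20736 * C', fun n Δ => ?_⟩
  set C : ℝ := (extraSteps c : ℝ) with hC
  have hC0 : 0 ≤ C := Nat.cast_nonneg _
  have hC'0 : (0 : ℝ) ≤ C' := Nat.cast_nonneg _
  rcases Nat.lt_or_ge Δ 2 with hD | hD
  · obtain ⟨h1, h2, h3⟩ := averages_eq_zero (c := c) (n := n) hD
    rw [h1, h2, h3]
    exact ⟨zero_le, zero_le, zero_le⟩
  set l := Real.log Δ with hl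
  set s : ℝ := (logStar n : ℝ) with hs
  have hs0 : 0 ≤ s := Nat.cast_nonneg _
  have hL := clog_le_three_mul_log hD
  have hL1 : (1 : ℝ) ≤ Nat.clog 2 Δ := by
    exact_mod_cast (Nat.clog_pos (b := 2) (by norm_num) hD : 0 < Nat.clog 2 Δ)
  have hl1 : 1 ≤ 3 * l := hL1.trans hL
  have hl2 : 1 ≤ 9 * l ^ 2 := by nlinarith
  have hl3 : 9 * l ^ 2 ≤ 27 * l ^ 3 := by
    have := mul_le_mul_of_nonneg_left hl1 (by positivity : 0 ≤ 9 * l ^ 2)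
    linarith
  have hρ : (phaseLength Δ : ℝ) ≤ 9 * (C' * l ^ 2) := by
    have h1 : (phaseLength Δ : ℝ) ≤ C' * (Nat.clog 2 Δ : ℝ) ^ 2 := by
      exact_mod_cast hC' _ (Nat.clog_pos (by norm_num) hD)
    have h2 : (Nat.clog 2 Δ : ℝ) ^ 2 ≤ (3 * l) ^ 2 := by gcongr
    have h3 := mul_le_mul_of_nonneg_left h2 hC'0
    linarith
  have hρ0 : (0 : ℝ) ≤ phaseLength Δ := Nat.cast_nonneg _
  have hCl2 : 0 ≤ C' * l ^ 2 := by positivity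
  have hpre : ((preLength c n : ℕ) : ℝ) = s + C + 4 := by
    rw [preLength]
    push_cast
    ring
  have hC4 : C + 4 ≤ (C + 4) * (9 * l ^ 2) := le_mul_of_one_le_right (by positivity) hl2
  have hCl : 0 ≤ C * l ^ 2 := by positivity
  have hCs : 0 ≤ C * s := by positivity
  have hC's : 0 ≤ C' * s := by positivity
  have hl20 : 0 ≤ l ^ 2 := by positivity
  refine ⟨(edgeAvg_le hD).trans ?_, (nodeAvg_le hD).trans ?_, ?_⟩
  · rw [← ENNReal.ofReal_natCast]
    refine ENNReal.ofReal_le_ofReal ?_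
    push_cast
    rw [hpre]
    nlinarith
  · rw [← ENNReal.ofReal_natCast]
    refine ENNReal.ofReal_le_ofReal ?_
    push_cast
    rw [hpre]
    have h1 : (256 * (Nat.clog 2 Δ : ℝ) + 512) * phaseLength Δ ≤
        (2304 * l) * (9 * (C' * l ^ 2)) :=
      mul_le_mul (by linarith) hρ hρ0 (by linarith)
    have h2 : (C + 4) * (9 * l ^ 2) ≤ (C + 4) * (27 * l ^ 3) := by gcongr
    have h3 : 0 ≤ l ^ 3 := by linarith
    nlinarith
  · rcases Nat.lt_or_ge Δ n with hn | hn
    swap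
    · rw [worstCase_eq_zero hD hn]
      exact zero_le
    refine (worstCase_le hD).trans ?_
    rw [← ENNReal.ofReal_natCast]
    refine ENNReal.ofReal_le_ofReal ?_
    push_cast
    rw [hpre]
    set m := Real.log n with hm
    have hn3 := clog_le_three_mul_log (n := n) (by omega)
    have hn1 : (1 : ℝ) ≤ Nat.clog 2 n := by
      exact_mod_cast (Nat.clog_pos (b := 2) (by norm_num) (by omega) : 0 < Nat.clog 2 n)
    have hm1 : 1 ≤ 3 * m := hn1.trans hn3
    have hsm : s ≤ 3 * m := by
      have : s ≤ Nat.clog 2 n := Nat.cast_le.2 (logStar_le_clog n)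
      linarith
    have hP : ((phaseCount n : ℕ) : ℝ) ≤ 2304 * m := by
      rw [phaseCount]
      push_cast
      linarith
    have h1 : (phaseCount n : ℝ) * phaseLength Δ ≤ (2304 * m) * (9 * (C' * l ^ 2)) :=
      mul_le_mul hP hρ hρ0 (by linarith)
    have h2 : s ≤ 3 * m * (9 * l ^ 2) := hsm.trans (le_mul_of_one_le_right (by linarith) hl2)
    have h3 : C + 4 ≤ (C + 4) * (9 * l ^ 2) * (3 * m) :=
      hC4.trans (le_mul_of_one_le_right (by positivity) hm1)
    have h4 : 0 ≤ l ^ 2 * m := mul_nonneg hl20 (by linarith)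
    linarith
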